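/- Let $E$ be a non-empty countable (finite or infinite) alphabet with the discrete topology, let $A:E\times E\to\{0,1\}$, let $E_A^{\mathbb N}=\{\omega\in E^{\mathbb N}: A_{\omega_i\omega_{i+1}}=1\ \text{for all } i\ge 1\}$ carry the product topology and its Borel $\sigma$-algebra, and let $\sigma$ be the left shift on $E_A^{\mathbb N}$. Let $E_A^n$ be the set of words $w$ of length $n$ with $A_{w_iw_{i+1}}=1$ for $1\le i<n$, let $E_A^*=\bigcup_{n\ge 0}E_A^n$, and let $[w]=\{\tau\in E_A^{\mathbb N}:\tau|_{|w|}=w\}$ for $w\in E_A^*$. Assume that $A$ is *finitely irreducible*: there is a finite set $\Phi\subset E_A^*$ such that for all $i,j\in E$ there is $w\in\Phi$ with $iwj\in E_A^*$. ($A$ is *finitely primitive* if in addition $\Phi$ can be chosen to consist of words of the same length.) Let $f:E_A^{\mathbb N}\to\mathbb R$ be *Hölder continuous*, i.e. for some $\alpha>0$ $$\sup_{n\ge 1}\ \sup\{|f(\omega)-f(\tau)|e^{\alpha(n-1)}:\ \omega|_n=\tau|_n\}<\infty,$$ and *summable*, i.e. $\sum_{e\in E}\exp(\sup f|_{[e]})<\infty$.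 Write $S_nf=\sum_{j=0}^{n-1}f\circ\sigma^j$ and let $$P(f)=\lim_{n\to\infty}\frac1n\log\sum_{w\in E_A^n}\exp\Big(\sup_{[w]}S_nf\Big)$$ be the topological pressure. Let $\mathcal L_f g(\omega)=\sum_{e:\,A_{e\omega_1}=1}e^{f(e\omega)}g(e\omega)$ be the Perron–Frobenius operator on the space $C_b(E_A^{\mathbb N})$ of bounded continuous real functions, and $\mathcal L_f^*$ its conjugate on $C_b(E_A^{\mathbb N})^*$. A Borel probability measure $m$ is an *eigenmeasure* of $\mathcal L_f^*$ with eigenvalue $\lambda\in\mathbb R$ if $\mathcal L_f^*m=\lambda m$, and a *Gibbs state* for $f$ if there are $Q\ge1$ and $P_m\in\mathbb R$ with $$Q^{-1}\le \frac{m([w])}{\exp(S_{|w|}f(\tau)-P_m|w|)}\le Q\qquad\text{for all } w\in E_A^*,\ \tau\in[w].$$ A $\sigma$-invariant Borel probability measure $\mu$ is an *equilibrium state* of $f$ if $\int -f\,d\mu<+\infty$ and $h_\mu(\sigma)+\int f\,d\mu=P(f)$, where $h_\mu(\sigma)$ is the Kolmogorov–Sinai entropy. Then the limit defining $P(f)$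 exists and is finite, and the following hold. (a) $\mathcal L_f^*$ has exactly one probability eigenmeasure $m_f$ (for any eigenvalue whatsoever), and its eigenvalue is $e^{P(f)}$. (b) $m_f$ is a Gibbs state for $f$. (c) $f$ has exactly one $\sigma$-invariant Gibbs state $\mu_f$. (d) $\mu_f$ is ergodic and equivalent to $m_f$, and $\log(d\mu_f/d m_f)$ is bounded (up to a null set). (e) If $\int -f\,d\mu_f<+\infty$, then $\mu_f$ is the unique equilibrium state of $f$. (f) If $A$ is finitely primitive, then $\mu_f$ is completely ergodic, i.e. $\sigma^n$ is ergodic with respect to $\mu_f$ for every $n\ge1$. -/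

import Mathlib

open MeasureTheory Filter Topology
open scoped ENNReal BoundedContinuousFunction

noncomputable section

namespace MarkovShift

section Entropy

variable {Ω : Type*} [MeasurableSpace Ω]

/-- Shannon entropy `H_μ(ξ) = -∑ μ(ξ = i) log μ(ξ = i)` of the finite partition of `Ω` into the
fibres of a map `ξ : Ω → ι`. -/
def partitionEntropy (μ : Measure Ω) {ι : Type*} [Fintype ι] (ξ : Ω → ι) : ℝ≥0∞ :=
  ∑ i, ENNReal.ofReal (Real.negMulLog (μ.real (ξ ⁻¹' {i})))

/-- The map whose fibres form the join `ξ ∨ T⁻¹ξ ∨ ⋯ ∨ T^{-(n-1)}ξ`. -/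
def itinerary (T : Ω → Ω) {ι : Type*} (ξ : Ω → ι) (n : ℕ) : Ω → (Fin n → ι) :=
  fun x k => ξ (T^[k] x)

/-- `h_μ(T, ξ) = lim (1/n) H_μ(ξ ∨ ⋯ ∨ T^{-(n-1)}ξ)`; the limit exists by subadditivity for
every invariant probability measure. -/
def entropyOfPartition (T : Ω → Ω) (μ : Measure Ω) {ι : Type*} [Fintype ι] (ξ : Ω → ι) : ℝ≥0∞ :=
  limsup (fun n : ℕ => partitionEntropy μ (itinerary T ξ n) / (n : ℝ≥0∞)) atTop

/-- The Kolmogorov–Sinai entropy `h_μ(T)`: the supremum of `h_μ(T, ξ)` over all finite measurable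
partitions `ξ`. -/
def ksEntropy (T : Ω → Ω) (μ : Measure Ω) : ℝ≥0∞ :=
  ⨆ (k : ℕ) (ξ : Ω → Fin k) (_ : Measurable ξ), entropyOfPartition T μ ξ

/-- `T` is completely ergodic: all iterates `T^n`, `n ≥ 1`, are ergodic. -/
def CompletelyErgodic (T : Ω → Ω) (μ : Measure Ω) : Prop :=
  ∀ n : ℕ, 1 ≤ n → Ergodic (T^[n]) μ

end Entropy

variable {E : Type*}

/-- The space `E_A^ℕ` of `A`-admissible sequences (indexed from `0`). -/
abbrev Subshift (A : E → E → Fin 2) : Type _ :=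
  {ω : ℕ → E // ∀ n, A (ω n) (ω (n + 1)) = 1}

/-- A finite word (possibly empty) is `A`-admissible. -/
def Admissible (A : E → E → Fin 2) (w : List E) : Prop :=
  w.IsChain (fun a b => A a b = 1)

/-- Finite irreducibility: a finite set of admissible words (the empty word is allowed) connects
any two letters. -/
def FinitelyIrreducible (A : E → E → Fin 2) : Prop :=
  ∃ Φ : Finset (List E), (∀ w ∈ Φ, Admissible A w) ∧
    ∀ i j : E, ∃ w ∈ Φ, Admissible A (i :: (w ++ [j]))

/-- Finite primitivity: the connecting words can moreover be taken of the same length. -/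
def FinitelyPrimitive (A : E → E → Fin 2) : Prop :=
  ∃ (q : ℕ) (Φ : Finset (List E)), (∀ w ∈ Φ, Admissible A w ∧ w.length = q) ∧
    ∀ i j : E, ∃ w ∈ Φ, Admissible A (i :: (w ++ [j]))

section Dynamics

variable {A : E → E → Fin 2}

/-- The left shift on `E_A^ℕ`. -/
def shift (ω : Subshift A) : Subshift A :=
  ⟨fun n => ω.1 (n + 1), fun n => ω.2 (n + 1)⟩

/-- The concatenation `eω`. -/
def cons (e : E) (ω : Subshift A) (h : A e (ω.1 0) = 1) : Subshift A :=
  ⟨fun n => Nat.casesOn n e ω.1, fun n => by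
    cases n with
    | zero => exact h
    | succ n => exact ω.2 n⟩

variable (A) in
/-- The cylinder `[w] ⊆ E_A^ℕ`. -/
def cylinder (w : List E) : Set (Subshift A) :=
  {τ | ∀ (i : ℕ) (hi : i < w.length), τ.1 i = w[i]}

variable (A) in
/-- The words of `E_A^n`. -/
abbrev AdmissibleWord (n : ℕ) : Type _ :=
  {w : List E // w.length = n ∧ Admissible A w}

/-- Hölder continuity of some exponent `α > 0`: `|f ω - f τ| e^{α(n-1)}` is bounded over all `n ≥ 1`
and all `ω, τ` that agree in their first `n` coordinates. -/
def IsHolder (f : Subshift A → ℝ) : Prop :=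
  ∃ α : ℝ, 0 < α ∧ ∃ V : ℝ, ∀ n : ℕ, 1 ≤ n → ∀ ω τ : Subshift A,
    (∀ i < n, ω.1 i = τ.1 i) → |f ω - f τ| * Real.exp (α * ((n : ℝ) - 1)) ≤ V

/-- Summability: `∑_{e ∈ E} exp (sup f|_[e]) < ∞`. -/
def IsSummable (f : Subshift A → ℝ) : Prop :=
  ∑' e : E, EReal.exp (⨆ ω ∈ cylinder A [e], (f ω : EReal)) < ⊤

/-- The number `exp (sup f|_[e])`. -/
def letterWeight (f : Subshift A → ℝ) (e : E) : ℝ :=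
  (EReal.exp (⨆ ω ∈ cylinder A [e], (f ω : EReal))).toReal

lemma IsSummable.summable_letterWeight {f : Subshift A → ℝ} (hs : IsSummable f) :
    Summable (letterWeight f) :=
  ENNReal.summable_toReal hs.ne

/-- The partition function `Z_n(f) = ∑_{w ∈ E_A^n} exp (sup_{[w]} S_n f)`. -/
def partitionFunction (f : Subshift A → ℝ) (n : ℕ) : ℝ≥0∞ :=
  ∑' w : AdmissibleWord A n,
    EReal.exp (⨆ τ ∈ cylinder A w.1, ((birkhoffSum shift f n τ : ℝ) : EReal))

/-- The topological pressure `P(f) = lim (1/n) log Z_n(f)`. -/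
def pressure (f : Subshift A → ℝ) : EReal :=
  limsup (fun n : ℕ => ENNReal.log (partitionFunction f n) / (n : EReal)) atTop

variable [MeasurableSpace E]

/-- `m` is a Gibbs state for `f`. -/
def IsGibbs (f : Subshift A → ℝ) (m : ProbabilityMeasure (Subshift A)) : Prop :=
  ∃ Q : ℝ, 1 ≤ Q ∧ ∃ P : ℝ, ∀ w : List E, Admissible A w → ∀ τ ∈ cylinder A w,
    Q⁻¹ ≤ (m : Measure (Subshift A)).real (cylinder A w) /
        Real.exp (birkhoffSum shift f w.length τ - P * w.length) ∧
      (m : Measure (Subshift A)).real (cylinder A w) /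
        Real.exp (birkhoffSum shift f w.length τ - P * w.length) ≤ Q

/-- `μ` is a shift-invariant Gibbs state for `f`. -/
def IsInvariantGibbs (f : Subshift A → ℝ) (μ : ProbabilityMeasure (Subshift A)) : Prop :=
  IsGibbs f μ ∧ MeasurePreserving shift (μ : Measure (Subshift A)) μ

/-- The condition `∫ -f dμ < +∞`: the positive part of `-f` has finite integral. -/
def NegIntegralFinite (f : Subshift A → ℝ) (μ : ProbabilityMeasure (Subshift A)) : Prop :=
  ∫⁻ ω, ENNReal.ofReal (-f ω) ∂(μ : Measure (Subshift A)) < ⊤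

/-- The extended integral `∫ f dμ = ∫ f⁺ dμ - ∫ f⁻ dμ ∈ (-∞, +∞]`, meaningful under
`NegIntegralFinite f μ`. -/
def extIntegral (f : Subshift A → ℝ) (μ : ProbabilityMeasure (Subshift A)) : EReal :=
  ((∫⁻ ω, ENNReal.ofReal (f ω) ∂(μ : Measure (Subshift A)) : ℝ≥0∞) : EReal) -
    ((∫⁻ ω, ENNReal.ofReal (-f ω) ∂(μ : Measure (Subshift A)) : ℝ≥0∞) : EReal)

/-- `μ` is an equilibrium state of `f`: it is shift-invariant, `∫ -f dμ < +∞` and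
`h_μ(σ) + ∫ f dμ = P(f)`. -/
def IsEquilibrium (f : Subshift A → ℝ) (μ : ProbabilityMeasure (Subshift A)) : Prop :=
  MeasurePreserving shift (μ : Measure (Subshift A)) μ ∧ NegIntegralFinite f μ ∧
    (ksEntropy shift (μ : Measure (Subshift A)) : EReal) + extIntegral f μ = pressure f

end Dynamics

section PerronFrobenius

variable {A : E → E → Fin 2} [TopologicalSpace E]

/-- The term of `ℒ_f g (ω)` that belongs to the letter `e`; it is `0` unless `A_{e ω₁} = 1`. -/
def transferTerm (f g : Subshift A → ℝ) (e : E) (ω : Subshift A) : ℝ :=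
  if h : A e (ω.1 0) = 1 then Real.exp (f (cons e ω h)) * g (cons e ω h) else 0

lemma norm_transferTerm_le {f : Subshift A → ℝ} (hs : IsSummable f) (g : Subshift A →ᵇ ℝ)
    (e : E) (ω : Subshift A) : ‖transferTerm f g e ω‖ ≤ letterWeight f e * ‖g‖ := by
  unfold transferTerm
  split_ifs with h
  · rw [norm_mul, Real.norm_eq_abs, Real.abs_exp]
    refine mul_le_mul ?_ (g.norm_coe_le_norm _) (norm_nonneg _) ENNReal.toReal_nonneg
    have hmem : cons e ω h ∈ cylinder A [e] := by
      intro i hi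
      have hi0 : i = 0 := by simpa using hi
      subst hi0
      rfl
    have h1 : EReal.exp (f (cons e ω h) : EReal) ≤
        EReal.exp (⨆ ω ∈ cylinder A [e], (f ω : EReal)) :=
      EReal.exp_monotone (le_iSup₂ (f := fun τ (_ : τ ∈ cylinder A [e]) => (f τ : EReal)) _ hmem)
    have h2 := ENNReal.toReal_mono (ENNReal.ne_top_of_tsum_ne_top hs.ne e) h1
    rwa [EReal.exp_coe, ENNReal.toReal_ofReal (Real.exp_pos _).le] at h2
  · rw [norm_zero]
    exact mul_nonneg ENNReal.toReal_nonneg (norm_nonneg _)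

lemma IsSummable.summable_transferTerm {f : Subshift A → ℝ} (hs : IsSummable f)
    (g : Subshift A →ᵇ ℝ) (ω : Subshift A) : Summable fun e => transferTerm f g e ω :=
  Summable.of_norm_bounded (hs.summable_letterWeight.mul_right ‖g‖)
    fun e => norm_transferTerm_le hs g e ω

lemma norm_tsum_transferTerm_le {f : Subshift A → ℝ} (hs : IsSummable f)
    (g : Subshift A →ᵇ ℝ) (ω : Subshift A) :
    ‖∑' e, transferTerm f g e ω‖ ≤ (∑' e, letterWeight f e) * ‖g‖ := by
  rw [← tsum_mul_right]
  exact tsum_of_norm_bounded (hs.summable_letterWeight.mul_right ‖g‖).hasSum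
    fun e => norm_transferTerm_le hs g e ω

variable [DiscreteTopology E]

lemma isOpen_agree (ω : Subshift A) (n : ℕ) :
    IsOpen {τ : Subshift A | ∀ i < n, ω.1 i = τ.1 i} := by
  have : {τ : Subshift A | ∀ i < n, ω.1 i = τ.1 i} =
      ⋂ i ∈ Set.Iio n, (fun τ : Subshift A => τ.1 i) ⁻¹' {ω.1 i} := by
    ext τ; simp [eq_comm]
  rw [this]
  refine (Set.finite_Iio n).isOpen_biInter fun i _ => ?_
  exact (isOpen_discrete _).preimage ((continuous_apply i).comp continuous_subtype_val)

lemma IsHolder.continuous {f : Subshift A → ℝ} (hf : IsHolder f) : Continuous f := by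
  obtain ⟨α, hα, V, hV⟩ := hf
  rw [continuous_iff_continuousAt]
  intro ω
  rw [Metric.continuousAt_iff']
  intro ε hε
  have h1 : Tendsto (fun n : ℕ => Real.exp (α * ((n : ℝ) - 1))) atTop atTop := by
    refine Real.tendsto_exp_atTop.comp (Tendsto.const_mul_atTop hα ?_)
    exact tendsto_atTop_add_const_right _ (-1 : ℝ) tendsto_natCast_atTop_atTop
  obtain ⟨n, hn1, hn2⟩ := ((h1.eventually_gt_atTop (V / ε)).and (eventually_ge_atTop 1)).exists
  filter_upwards [(isOpen_agree ω n).mem_nhds (fun i _ => rfl)] with τ hτ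
  have h2 := hV n hn2 τ ω (fun i hi => (hτ i hi).symm)
  rw [Real.dist_eq]
  rw [div_lt_iff₀ hε] at hn1
  have h3 := Real.exp_pos (α * ((n : ℝ) - 1))
  by_contra! h4
  nlinarith

lemma continuous_transferTerm {f g : Subshift A → ℝ} (hf : Continuous f) (hg : Continuous g)
    (e : E) : Continuous (transferTerm f g e) := by
  have h0 : Continuous (fun ω : Subshift A => ω.1 0) :=
    (continuous_apply 0).comp continuous_subtype_val
  have hc : Continuous (fun u : {ω : Subshift A // A e (ω.1 0) = 1} => cons e u.1 u.2) := by
    refine Continuous.subtype_mk (continuous_pi fun n => ?_) _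
    cases n with
    | zero => exact continuous_const
    | succ n =>
      exact (continuous_apply n).comp (continuous_subtype_val.comp continuous_subtype_val)
  rw [continuous_iff_continuousAt]
  intro ω
  by_cases h : A e (ω.1 0) = 1
  · have hU : IsOpen {ω : Subshift A | A e (ω.1 0) = 1} :=
      (isOpen_discrete {a : E | A e a = 1}).preimage h0
    refine ContinuousOn.continuousAt (s := {ω : Subshift A | A e (ω.1 0) = 1}) ?_ (hU.mem_nhds h)
    rw [continuousOn_iff_continuous_domRestrict]
    have : Set.domRestrict {ω : Subshift A | A e (ω.1 0) = 1} (transferTerm f g e) =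
        fun u : {ω : Subshift A // A e (ω.1 0) = 1} =>
          Real.exp (f (cons e u.1 u.2)) * g (cons e u.1 u.2) := by
      funext u
      have hu : A e (u.1.1 0) = 1 := u.2
      simp [Set.domRestrict, transferTerm, hu]
    rw [this]
    exact (Real.continuous_exp.comp (hf.comp hc)).mul (hg.comp hc)
  · have hU : IsOpen {ω : Subshift A | ¬ A e (ω.1 0) = 1} :=
      (isOpen_discrete {a : E | ¬ A e a = 1}).preimage h0
    refine (continuousAt_const (y := (0 : ℝ))).congr ?_
    filter_upwards [hU.mem_nhds h] with τ hτ
    have : ¬ A e (τ.1 0) = 1 := hτ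
    simp [transferTerm, this]

/-- The Perron–Frobenius operator
`ℒ_f g (ω) = ∑_{e : A_{e ω₁} = 1} exp (f (eω)) g (eω)`, as a bounded operator on `C_b(E_A^ℕ)`. -/
def perronFrobenius (f : Subshift A → ℝ) (hf : IsHolder f) (hs : IsSummable f) :
    (Subshift A →ᵇ ℝ) →L[ℝ] (Subshift A →ᵇ ℝ) :=
  LinearMap.mkContinuous
    { toFun := fun g => BoundedContinuousFunction.ofNormedAddCommGroup
        (fun ω => ∑' e, transferTerm f g e ω)
        (continuous_tsum (fun e => continuous_transferTerm hf.continuous g.continuous e)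
          (hs.summable_letterWeight.mul_right ‖g‖) (fun e ω => norm_transferTerm_le hs g e ω))
        ((∑' e, letterWeight f e) * ‖g‖) (norm_tsum_transferTerm_le hs g)
      map_add' := fun g₁ g₂ => by
        ext ω
        change ∑' e, transferTerm f (g₁ + g₂ : Subshift A →ᵇ ℝ) e ω =
          (∑' e, transferTerm f g₁ e ω) + ∑' e, transferTerm f g₂ e ω
        rw [← (hs.summable_transferTerm g₁ ω).tsum_add (hs.summable_transferTerm g₂ ω)]
        refine tsum_congr fun e => ?_
        unfold transferTerm
        split_ifs <;> simp [mul_add]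
      map_smul' := fun c g => by
        ext ω
        change ∑' e, transferTerm f (c • g : Subshift A →ᵇ ℝ) e ω =
          c * ∑' e, transferTerm f g e ω
        rw [← tsum_mul_left]
        refine tsum_congr fun e => ?_
        unfold transferTerm
        split_ifs <;> simp [mul_left_comm] }
    (∑' e, letterWeight f e)
    (fun g => (BoundedContinuousFunction.norm_le
      (mul_nonneg (tsum_nonneg fun _ => ENNReal.toReal_nonneg) (norm_nonneg _))).2
        (norm_tsum_transferTerm_le hs g))

lemma perronFrobenius_apply {f : Subshift A → ℝ} (hf : IsHolder f) (hs : IsSummable f)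
    (g : Subshift A →ᵇ ℝ) (ω : Subshift A) :
    perronFrobenius f hf hs g ω = ∑' e, transferTerm f g e ω := rfl

/-- The conjugate operator `ℒ_f^*` on the dual of `C_b(E_A^ℕ)`, `ℒ_f^* φ = φ ∘ ℒ_f`. -/
def conjPerronFrobenius (f : Subshift A → ℝ) (hf : IsHolder f) (hs : IsSummable f)
    (φ : StrongDual ℝ (Subshift A →ᵇ ℝ)) : StrongDual ℝ (Subshift A →ᵇ ℝ) :=
  φ.comp (perronFrobenius f hf hs)

variable [Countable E] [MeasurableSpace E] [BorelSpace E]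

/-- The functional `g ↦ ∫ g dm` on `C_b(E_A^ℕ)`. -/
def integralFunctional (m : ProbabilityMeasure (Subshift A)) :
    StrongDual ℝ (Subshift A →ᵇ ℝ) :=
  LinearMap.mkContinuous
    { toFun := fun g => ∫ ω, g ω ∂(m : Measure (Subshift A))
      map_add' := fun g₁ g₂ => integral_add (g₁.integrable _) (g₂.integrable _)
      map_smul' := fun c g => integral_const_mul c _ }
    1
    (fun g => by
      rw [one_mul]
      exact g.norm_integral_le_norm (m : Measure (Subshift A)))

/-- The probability measure `m` is an eigenmeasure of `ℒ_f^*` with eigenvalue `c`. -/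
def IsEigenmeasure (f : Subshift A → ℝ) (hf : IsHolder f) (hs : IsSummable f)
    (m : ProbabilityMeasure (Subshift A)) (c : ℝ) : Prop :=
  conjPerronFrobenius f hf hs (integralFunctional m) = c • integralFunctional m

end PerronFrobenius

end MarkovShift

end

noncomputable section

set_option linter.unusedSectionVars false

namespace MarkovShift

/-! ### Words, cylinders and gluing of admissible sequences. -/

section Words

variable {E : Type*} {A : E → E → Fin 2}

/-! Two facts about Birkhoff sums carry everything. Hölder continuity gives bounded distortion: `S_n
f` varies by at most a constant on a cylinder of length `n` (`IsHolder.distortion`). Finite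
irreducibility glues any initial block to any sequence by one of finitely many words, at bounded
cost (`IsHolder.exists_glue`). The transfer operator `tr` acts on functions with values in `[0, ∞]`,
so that no convergence has to be discussed. For it these facts say that `ℒ^n 1_[w]` is everywhere at
most a constant times `exp (S_n f)` on `[w]` (`exists_tr_cyl_le`), and that a bounded sum of
functions `ℒ^(n+j) 1_[w]` is everywhere at least such a multiple (`exists_weight_le_tr_cyl`).
Integrated against an eigenmeasure they become the Gibbs property with `P` the logarithm of the
eigenvalue. Since cylinder masses sum to one, the constant of any Gibbs state is the pressure; hence
the eigenvalue is determined.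

Existence follows Patterson. The numbers `ℒ^n 1(τ)` are comparable with the submultiplicative
sequence `sup ℒ^n 1`, so the power series with these coefficients diverges at its radius of
convergence `R` (`exists_critical_exponent`). The normalised Abel sums `∑ s^n (ℒ^*)^n δ_τ`, `s ↑ R`,
are tight by summability of `f`, and a limit is an eigenmeasure with eigenvalue `1/R`
(`exists_isConformal`).

Uniqueness and ergodicity come from one domination: if `m` (a probability) and `ν` (finite) are
conformal with the same eigenvalue, then `ν(1) m ≤ C ν` (`IsHolder.exists_conformal_le`). Removing
from one eigenmeasure the largest multiple of another must leave nothing; and the restriction of `m`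
to an invariant set is again conformal, so the set is null or conull. This works for the `d`-th
iterate when connecting words of length divisible by `d` exist, which primitivity provides for every
`d`; complete ergodicity follows.

The measures `m ∘ σ^(-k)` are, after averaging over boundedly many `k`, uniformly comparable with
`m`, and Krylov–Bogoliubov preserves this, giving `μ`. Any other invariant Gibbs state is absolutely
continuous with respect to the ergodic `μ`, hence equal to it.

For equilibrium states, Gibbs' inequality against `μ` bounds the entropy of the `n`-cylinders under
an invariant `ν` by `n (P - ∫ f dν) + O(1)`, with a matching lower bound when `ν = μ`. The partition
by first letters generates and has finite entropy, so both bounds pass to `h`. For uniqueness, the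
reference distribution is reweighted towards a set `S` of cylinders, which improves the bound by
`ν(S) (-log μ(S))`. An equilibrium state leaves only bounded room for this gain, whence `ν ≪ μ` and
`ν = μ`. -/

/-- The sequences that agree with `ω` in the first `n` coordinates. -/
def cyl (n : ℕ) (ω : Subshift A) : Set (Subshift A) := {τ | ∀ i < n, τ.1 i = ω.1 i}

/-- The first `n` coordinates of a sequence. -/
def block (n : ℕ) (ω : Subshift A) : Fin n → E := fun i => ω.1 i

lemma mem_cyl_iff_block {n : ℕ} {ω τ : Subshift A} : τ ∈ cyl n ω ↔ block n τ = block n ω := by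
  simp only [cyl, block, funext_iff, Set.mem_ofPred_eq, Fin.forall_iff]

lemma cyl_eq_preimage (n : ℕ) (ω : Subshift A) : cyl n ω = block n ⁻¹' {block n ω} := by
  ext τ; exact mem_cyl_iff_block

lemma self_mem_cyl (n : ℕ) (ω : Subshift A) : ω ∈ cyl n ω := fun _ _ => rfl

lemma mem_cyl_comm {n : ℕ} {ω τ : Subshift A} : τ ∈ cyl n ω ↔ ω ∈ cyl n τ :=
  ⟨fun h i hi => (h i hi).symm, fun h i hi => (h i hi).symm⟩

lemma cylinder_eq_cyl {w : List E} {τ : Subshift A} (h : τ ∈ cylinder A w) :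
    cylinder A w = cyl w.length τ := by
  ext ω
  exact ⟨fun h' i hi => (h' i hi).trans (h i hi).symm, fun h' i hi => (h' i hi).trans (h i hi)⟩

lemma admissible_ofFn (n : ℕ) (ω : Subshift A) : Admissible A (List.ofFn (block n ω)) := by
  unfold Admissible
  rw [List.isChain_iff_getElem]
  intro i hi
  simpa [block] using ω.2 i

lemma mem_cylinder_ofFn (n : ℕ) (ω : Subshift A) : ω ∈ cylinder A (List.ofFn (block n ω)) := by
  intro i hi
  simp [block]

lemma iterate_shift_apply (n i : ℕ) (ω : Subshift A) : (shift^[n] ω).1 i = ω.1 (i + n) := by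
  induction n generalizing ω with
  | zero => rfl
  | succ n ih =>
    rw [Function.iterate_succ_apply, ih]
    rfl

lemma shift_cons (e : E) (ω : Subshift A) (h : A e (ω.1 0) = 1) : shift (cons e ω h) = ω := rfl

lemma cons_shift (ω : Subshift A) : cons (ω.1 0) (shift ω) (ω.2 0) = ω := by
  apply Subtype.ext
  funext n
  cases n <;> rfl

lemma exists_prepend (w : List E) (τ : Subshift A)
    (h : (w ++ [τ.1 0]).IsChain (fun a b => A a b = 1)) :
    ∃ ω, shift^[w.length] ω = τ ∧ ω ∈ cylinder A w := by
  induction w with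
  | nil => exact ⟨τ, rfl, fun i hi => by simp at hi⟩
  | cons e w ih =>
    rw [List.cons_append] at h
    obtain ⟨ω, h1, h2⟩ := ih h.tail
    have he : A e (ω.1 0) = 1 := by
      cases w with
      | nil =>
        have : ω = τ := h1
        subst this
        simpa using h
      | cons a w =>
        have : ω.1 0 = a := h2 0 (by simp)
        rw [this]
        exact (List.isChain_cons_cons.1 h).1
    refine ⟨cons e ω he, ?_, ?_⟩
    · rw [List.length_cons, Function.iterate_succ_apply, shift_cons, h1]
    · intro i hi
      cases i with
      | zero => rfl
      | succ i => exact h2 i (by simpa using hi)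

/-- Any two letters are connected by one of finitely many words, of length divisible by `d`. -/
def Connecting (A : E → E → Fin 2) (d : ℕ) : Prop :=
  ∃ Φ : Finset (List E), ∀ i j : E, ∃ w ∈ Φ, d ∣ w.length ∧ Admissible A (i :: (w ++ [j]))

lemma FinitelyIrreducible.connecting (hA : FinitelyIrreducible A) : Connecting A 1 := by
  obtain ⟨Φ, -, h⟩ := hA
  exact ⟨Φ, fun i j => (h i j).imp fun w hw => ⟨hw.1, one_dvd _, hw.2⟩⟩

end Words

/-! ### Bounded distortion and the gluing estimate. -/

section Distortion

variable {E : Type*} {A : E → E → Fin 2} {f : Subshift A → ℝ}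

/-- After `k` shifts the sequences still agree in `n - k` places, so the `k`-th terms differ by at
most a multiple of `exp(-α)^(n-1-k)`; the geometric series bounds the total independently of `n`. -/
lemma IsHolder.distortion (hf : IsHolder f) : ∃ K : ℝ, 0 ≤ K ∧ ∀ (n : ℕ) (ω τ : Subshift A),
    τ ∈ cyl n ω → birkhoffSum shift f n ω ≤ birkhoffSum shift f n τ + K := by
  obtain ⟨α, hα, V, hV⟩ := hf
  set r := Real.exp (-α) with hr
  have hr0 : 0 ≤ r := (Real.exp_pos _).le
  have hr1 : r < 1 := by rw [hr, Real.exp_lt_one_iff]; linarith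
  refine ⟨max V 0 * (1 - r)⁻¹, by have := le_max_right V 0; have : 0 < 1 - r := by linarith
                                  positivity, fun n ω τ h => ?_⟩
  rw [← sub_le_iff_le_add', birkhoffSum, birkhoffSum, ← Finset.sum_sub_distrib]
  have hterm : ∀ k ∈ Finset.range n, f (shift^[k] ω) - f (shift^[k] τ) ≤
      max V 0 * r ^ (n - 1 - k) := by
    intro k hk
    rw [Finset.mem_range] at hk
    have h1 := hV (n - k) (by omega) (shift^[k] ω) (shift^[k] τ) (fun i hi => by
      rw [iterate_shift_apply, iterate_shift_apply]; exact (h _ (by omega)).symm)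
    have h2 : r ^ (n - 1 - k) = (Real.exp (α * (((n - k : ℕ) : ℝ) - 1)))⁻¹ := by
      rw [hr, ← Real.exp_nat_mul, ← Real.exp_neg]
      congr 1
      rw [Nat.cast_sub (by omega), Nat.cast_sub (by omega), Nat.cast_sub (by omega)]
      push_cast; ring
    rw [h2, ← div_eq_mul_inv, le_div_iff₀ (Real.exp_pos _)]
    refine le_trans ?_ (h1.trans (le_max_left _ _))
    gcongr
    exact le_abs_self _
  refine (Finset.sum_le_sum hterm).trans ?_
  rw [Finset.sum_range_reflect (fun k => max V 0 * r ^ k) n, ← Finset.mul_sum]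
  gcongr
  exact (Summable.sum_le_tsum _ (fun _ _ => by positivity)
    (summable_geometric_of_lt_one hr0 hr1)).trans (tsum_geometric_of_lt_one hr0 hr1).le

/-- The connecting word is inserted between the first `n` letters of `ω` and `τ`. Distortion
controls the first `n` terms of the Birkhoff sum, and the finitely many connecting words contribute
a bounded loss. -/
lemma IsHolder.exists_glue (hf : IsHolder f) {d : ℕ} (hd : Connecting A d) :
    ∃ (q : ℕ) (C : ℝ), 0 ≤ C ∧ ∀ (n : ℕ) (ω τ : Subshift A), ∃ j ≤ q, d ∣ j ∧ ∃ ω' ∈ cyl n ω,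
      shift^[n + j] ω' = τ ∧ birkhoffSum shift f n ω ≤ birkhoffSum shift f (n + j) ω' + C := by
  obtain ⟨K, hK0, hK⟩ := hf.distortion
  obtain ⟨Φ, hΦ⟩ := hd
  -- One point of `[w]` and distortion bound the sum below on all of `[w]`; an empty cylinder
  -- imposes nothing.
  have hw : ∀ w : List E, ∃ C : ℝ, 0 ≤ C ∧ ∀ τ ∈ cylinder A w,
      -C ≤ birkhoffSum shift f w.length τ := by
    intro w
    by_cases h : ∃ τ, τ ∈ cylinder A w
    · obtain ⟨τ, hτ⟩ := h
      refine ⟨|birkhoffSum shift f w.length τ| + K, by positivity, fun ω hω => ?_⟩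
      rw [cylinder_eq_cyl hτ] at hω
      have := hK _ _ _ hω
      have := neg_abs_le (birkhoffSum shift f w.length τ)
      linarith
    · exact ⟨0, le_rfl, fun τ hτ => (h ⟨τ, hτ⟩).elim⟩
  choose C hC0 hC using hw
  refine ⟨∑ w ∈ Φ, w.length, K + ∑ w ∈ Φ, C w,
    add_nonneg hK0 (Finset.sum_nonneg fun w _ => hC0 w), fun n ω τ => ?_⟩
  cases n with
  | zero =>
    -- An empty block has no last letter to connect from, and none is needed: `τ` itself works.
    refine ⟨0, Nat.zero_le _, dvd_zero d, τ, fun i hi => by omega, rfl, ?_⟩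
    simpa using add_nonneg hK0 (Finset.sum_nonneg fun w _ => hC0 w)
  | succ n =>
    obtain ⟨w, hwΦ, hdw, hadm⟩ := hΦ (ω.1 n) (τ.1 0)
    have hchain : ((List.ofFn (block (n + 1) ω) ++ w) ++ [τ.1 0]).IsChain
        (fun a b => A a b = 1) := by
      have h1 := admissible_ofFn (n + 1) ω
      have h2 : List.ofFn (block (n + 1) ω) = List.ofFn (block n ω) ++ [ω.1 n] := by
        rw [List.ofFn_succ_last]; rfl
      rw [h2] at h1 ⊢
      rw [List.append_assoc, List.append_assoc, List.singleton_append]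
      exact List.isChain_split.2 ⟨h1, hadm⟩
    obtain ⟨ω', h1, h2⟩ := exists_prepend _ τ hchain
    have hlen : (List.ofFn (block (n + 1) ω) ++ w).length = n + 1 + w.length := by
      rw [List.length_append, List.length_ofFn]
    have hmem : ω' ∈ cyl (n + 1) ω := by
      intro i hi
      rw [h2 i (by rw [hlen]; omega), List.getElem_append_left (by simpa using hi),
        List.getElem_ofFn]
      rfl
    refine ⟨w.length, Finset.single_le_sum (f := fun w : List E => w.length)
      (fun _ _ => Nat.zero_le _) hwΦ, hdw, ω', hmem, by rw [← hlen]; exact h1, ?_⟩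
    rw [birkhoffSum_add _ _ (n + 1)]
    have h3 := hK _ _ _ hmem
    have h4 := hC w (shift^[n + 1] ω') (fun i hi => by
      rw [iterate_shift_apply, h2 _ (by rw [hlen]; omega), List.getElem_append_right (by simp)]
      simp)
    have h5 := Finset.single_le_sum (f := C) (fun w _ => hC0 w) hwΦ
    linarith

end Distortion

/-! ### The transfer operator on functions with values in `[0, ∞]`. -/

section Transfer

variable {E : Type*} {A : E → E → Fin 2} (f : Subshift A → ℝ)

/-- The number `exp (S_n f ω)`. -/
def weight (n : ℕ) (ω : Subshift A) : ℝ≥0∞ := ENNReal.ofReal (Real.exp (birkhoffSum shift f n ω))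

lemma weight_ne_top (n : ℕ) (ω : Subshift A) : weight f n ω ≠ ⊤ := ENNReal.ofReal_ne_top

lemma weight_pos (n : ℕ) (ω : Subshift A) : 0 < weight f n ω :=
  ENNReal.ofReal_pos.2 (Real.exp_pos _)

lemma weight_add (m n : ℕ) (ω : Subshift A) :
    weight f (m + n) ω = weight f m ω * weight f n (shift^[m] ω) := by
  rw [weight, birkhoffSum_add, Real.exp_add, ENNReal.ofReal_mul (Real.exp_pos _).le]
  rfl

open Classical in
/-- The `n`-th iterate of the Perron–Frobenius operator, on functions with values in `[0, ∞]`. -/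
def tr (n : ℕ) (g : Subshift A → ℝ≥0∞) (τ : Subshift A) : ℝ≥0∞ :=
  ∑' ω, if shift^[n] ω = τ then weight f n ω * g ω else 0

variable {f}

lemma tr_zero (g : Subshift A → ℝ≥0∞) : tr f 0 g = g := by
  funext τ
  rw [tr, tsum_eq_single τ]
  · simp [weight]
  · exact fun ω hω => if_neg hω

lemma tr_mono {n : ℕ} {g g' : Subshift A → ℝ≥0∞} (h : g ≤ g') : tr f n g ≤ tr f n g' := by
  intro τ
  refine ENNReal.tsum_le_tsum fun ω => ?_
  split_ifs
  · exact mul_le_mul_right (h ω) _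
  · rfl

lemma tr_tsum {ι : Type*} (n : ℕ) (g : ι → Subshift A → ℝ≥0∞) (τ : Subshift A) :
    tr f n (fun ω => ∑' i, g i ω) τ = ∑' i, tr f n (g i) τ := by
  unfold tr
  rw [ENNReal.tsum_comm]
  refine tsum_congr fun ω => ?_
  split_ifs
  · rw [ENNReal.tsum_mul_left]
  · simp

/-- The factor `h ∘ σ^n` is constant on the fibre over `τ`. Through this identity invariant sets,
preimages and later coordinates are handled. -/
lemma tr_comp_mul (n : ℕ) (h g : Subshift A → ℝ≥0∞) (τ : Subshift A) :
    tr f n (fun ω => h (shift^[n] ω) * g ω) τ = h τ * tr f n g τ := by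
  unfold tr
  rw [← ENNReal.tsum_mul_left]
  refine tsum_congr fun ω => ?_
  split_ifs with hω
  · change weight f n ω * (h (shift^[n] ω) * g ω) = _
    rw [hω]; ring
  · simp

lemma tr_const_mul (n : ℕ) (c : ℝ≥0∞) (g : Subshift A → ℝ≥0∞) (τ : Subshift A) :
    tr f n (fun ω => c * g ω) τ = c * tr f n g τ := tr_comp_mul n (fun _ => c) g τ

lemma tr_add (m n : ℕ) (g : Subshift A → ℝ≥0∞) : tr f (m + n) g = tr f n (tr f m g) := by
  classical
  funext τ
  have h : ∀ ω, (if shift^[n] ω = τ then weight f n ω * tr f m g ω else 0) =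
      ∑' ω', if shift^[m] ω' = ω then
        (if shift^[n] ω = τ then weight f n ω * (weight f m ω' * g ω') else 0) else 0 := by
    intro ω
    split_ifs with h
    · rw [tr, ← ENNReal.tsum_mul_left]
      refine tsum_congr fun ω' => ?_
      split_ifs <;> first | rfl | simp
    · simp
  conv_rhs => rw [tr]
  rw [tsum_congr h]
  rw [ENNReal.tsum_comm, tr]
  refine tsum_congr fun ω' => ?_
  rw [tsum_eq_single (shift^[m] ω') (fun ω hω => if_neg (Ne.symm hω)), if_pos rfl,
    add_comm m n, Function.iterate_add_apply, add_comm n m, weight_add]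
  refine if_congr Iff.rfl (by ring) rfl

lemma le_tr {n : ℕ} {g : Subshift A → ℝ≥0∞} {ω τ : Subshift A} (h : shift^[n] ω = τ) :
    weight f n ω * g ω ≤ tr f n g τ := by
  refine le_trans ?_ (ENNReal.le_tsum ω)
  rw [if_pos h]

/-- Preimages of `τ` are indexed by their first letter. This turns the formally uncountable sum into
a countable one and matches `transferTerm`. -/
lemma tr_one_eq (g : Subshift A → ℝ≥0∞) (τ : Subshift A) :
    tr f 1 g τ = ∑' e, if h : A e (τ.1 0) = 1 then weight f 1 (cons e τ h) * g (cons e τ h)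
      else 0 := by
  classical
  have h : ∀ ω : Subshift A, (if shift^[1] ω = τ then weight f 1 ω * g ω else 0) =
      ∑' e, if ω.1 0 = e then (if shift^[1] ω = τ then weight f 1 ω * g ω else 0) else 0 := by
    intro ω
    rw [tsum_eq_single (ω.1 0) (fun e he => if_neg (Ne.symm he)), if_pos rfl]
  rw [tr]
  rw [tsum_congr h, ENNReal.tsum_comm]
  refine tsum_congr fun e => ?_
  split_ifs with he
  · rw [tsum_eq_single (cons e τ he)]
    · exact (if_pos (rfl : (cons e τ he).1 0 = e)).trans (if_pos (shift_cons e τ he))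
    · intro ω hω
      split_ifs with h1 h2
      · refine (hω ?_).elim
        subst h1
        have h3 : shift ω = τ := h2
        subst h3
        exact (cons_shift ω).symm
      · rfl
      · rfl
  · rw [ENNReal.tsum_eq_zero]
    intro ω
    split_ifs with h1 h2
    · refine (he ?_).elim
      rw [← h1, ← h2]
      exact ω.2 0
    · rfl
    · rfl

/-- The number `exp (sup f|_[e])`, as an extended nonnegative real. -/
def theta (f : Subshift A → ℝ) (e : E) : ℝ≥0∞ := EReal.exp (⨆ ω ∈ cylinder A [e], (f ω : EReal))

lemma weight_one_le_theta (ω : Subshift A) : weight f 1 ω ≤ theta f (ω.1 0) := by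
  have hmem : ω ∈ cylinder A [ω.1 0] := by
    intro i hi
    have hi0 : i = 0 := by simpa using hi
    subst hi0
    rfl
  rw [weight, birkhoffSum_one, ← EReal.exp_coe]
  exact EReal.exp_monotone
    (le_iSup₂ (f := fun τ (_ : τ ∈ cylinder A [ω.1 0]) => (f τ : EReal)) _ hmem)

/-- The bound is uniform in `τ`; with `F` the complement of a large finite set, its right side is a
tail of the summability series, and this is the source of tightness. -/
lemma tr_one_indicator_le (F : Set E) (τ : Subshift A) :
    tr f 1 ({ω : Subshift A | ω.1 0 ∈ F}.indicator 1) τ ≤ ∑' e : F, theta f e := by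
  rw [tr_one_eq, tsum_subtype F (theta f)]
  refine ENNReal.tsum_le_tsum fun e => ?_
  split_ifs with h
  · by_cases he : e ∈ F
    · have : cons e τ h ∈ {ω : Subshift A | ω.1 0 ∈ F} := he
      rw [Set.indicator_of_mem this, Set.indicator_of_mem he, Pi.one_apply, mul_one]
      exact weight_one_le_theta (cons e τ h)
    · have : cons e τ h ∉ {ω : Subshift A | ω.1 0 ∈ F} := he
      rw [Set.indicator_of_notMem this, mul_zero]
      exact zero_le
  · exact zero_le

lemma tr_one_le (τ : Subshift A) : tr f 1 1 τ ≤ ∑' e, theta f e := by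
  have := tr_one_indicator_le (f := f) Set.univ τ
  simpa using this

lemma tr_le_const_mul {n : ℕ} {g : Subshift A → ℝ≥0∞} {c : ℝ≥0∞} (h : ∀ ω, g ω ≤ c)
    (τ : Subshift A) : tr f n g τ ≤ c * tr f n 1 τ := by
  rw [← tr_const_mul]
  exact tr_mono (fun ω => by simpa using h ω) τ

lemma tr_iterate_le (n : ℕ) (τ : Subshift A) : tr f n 1 τ ≤ (∑' e, theta f e) ^ n := by
  induction n generalizing τ with
  | zero => simp [tr_zero]
  | succ n ih =>
    rw [tr_add, pow_succ]
    exact (tr_le_const_mul ih τ).trans (mul_le_mul_right (tr_one_le τ) _)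

/-- The glued sequence is a preimage of `τ` in the cylinder, and this single term suffices. The sum
over `j` appears because the length of the connecting word depends on the letters to be joined. -/
lemma exists_weight_le_tr_cyl (hf : IsHolder f) {d : ℕ} (hd : Connecting A d) :
    ∃ (q : ℕ) (M : ℝ≥0∞), M ≠ ⊤ ∧ ∀ (n : ℕ) (ω τ : Subshift A),
      weight f n ω ≤ M * ∑ j ∈ (Finset.range (q + 1)).filter (d ∣ ·),
        tr f (n + j) ((cyl n ω).indicator 1) τ := by
  obtain ⟨q, C, hC, h⟩ := hf.exists_glue hd
  refine ⟨q, ENNReal.ofReal (Real.exp C), ENNReal.ofReal_ne_top, fun n ω τ => ?_⟩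
  obtain ⟨j, hj, hdj, ω', hω', h1, h2⟩ := h n ω τ
  have h3 : weight f n ω ≤ ENNReal.ofReal (Real.exp C) * weight f (n + j) ω' := by
    rw [weight, weight, ← ENNReal.ofReal_mul (Real.exp_pos _).le, ← Real.exp_add]
    gcongr
    linarith
  refine h3.trans (mul_le_mul_right ?_ _)
  have h4 := le_tr (f := f) (g := (cyl n ω).indicator 1) h1
  rw [Set.indicator_of_mem hω', Pi.one_apply, mul_one] at h4
  exact h4.trans (Finset.single_le_sum (f := fun j => tr f (n + j) ((cyl n ω).indicator 1) τ)
    (fun _ _ => zero_le) (by simp; omega))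

/-- A cylinder of length `n` contains at most one preimage of `τ` under `σ^n`, and distortion
compares its weight with that of `ω`. -/
lemma exists_tr_cyl_le (hf : IsHolder f) : ∃ K : ℝ≥0∞, K ≠ ⊤ ∧ ∀ (n : ℕ) (ω τ : Subshift A),
    tr f n ((cyl n ω).indicator 1) τ ≤ K * weight f n ω := by
  obtain ⟨K, hK0, hK⟩ := hf.distortion
  refine ⟨ENNReal.ofReal (Real.exp K), ENNReal.ofReal_ne_top, fun n ω τ => ?_⟩
  by_cases h : ∃ ω', ω' ∈ cyl n ω ∧ shift^[n] ω' = τ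
  · obtain ⟨ω', h1, h2⟩ := h
    rw [tr, tsum_eq_single ω']
    · rw [if_pos h2, Set.indicator_of_mem h1, Pi.one_apply, mul_one, weight, weight,
        ← ENNReal.ofReal_mul (Real.exp_pos _).le, ← Real.exp_add]
      gcongr
      have := hK n ω' ω (mem_cyl_comm.1 h1)
      linarith
    · intro ω'' hne
      split_ifs with h3
      · by_cases h4 : ω'' ∈ cyl n ω
        · refine (hne ?_).elim
          apply Subtype.ext
          funext i
          by_cases hi : i < n
          · rw [h4 i hi, h1 i hi]
          · obtain ⟨k, rfl⟩ := Nat.exists_eq_add_of_le' (not_lt.1 hi)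
            rw [← iterate_shift_apply, ← iterate_shift_apply, h2, h3]
        · rw [Set.indicator_of_notMem h4, mul_zero]
      · rfl
  · rw [tr]
    refine le_of_eq_of_le (ENNReal.tsum_eq_zero.2 fun ω' => ?_) zero_le
    split_ifs with h3
    · rw [Set.indicator_of_notMem (fun h4 => h ⟨ω', h4, h3⟩), mul_zero]
    · rfl

/-- The iterates of the transfer operator at two points are comparable. -/
lemma tr_le_sum_tr {q : ℕ} {M : ℝ≥0∞} {d : ℕ}
    (hM : ∀ (n : ℕ) (ω τ : Subshift A), weight f n ω ≤
      M * ∑ j ∈ (Finset.range (q + 1)).filter (d ∣ ·), tr f (n + j) ((cyl n ω).indicator 1) τ)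
    (n : ℕ) (ω τ : Subshift A) :
    tr f n 1 ω ≤ M * ∑ j ∈ Finset.range (q + 1), tr f (n + j) 1 τ := by
  classical
  have h1 : tr f n 1 ω ≤ ∑' ω', M * ∑ j ∈ Finset.range (q + 1),
      tr f (n + j) (fun x => if shift^[n] ω' = ω then (cyl n ω').indicator 1 x else 0) τ := by
    refine ENNReal.tsum_le_tsum fun ω' => ?_
    split_ifs with h
    · rw [Pi.one_apply, mul_one]
      refine (hM n ω' τ).trans (mul_le_mul_right ?_ _)
      exact Finset.sum_le_sum_of_subset (Finset.filter_subset _ _)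
    · exact zero_le
  refine h1.trans ?_
  rw [ENNReal.tsum_mul_left, Summable.tsum_finsetSum (fun _ _ => ENNReal.summable)]
  refine mul_le_mul_right (Finset.sum_le_sum fun j _ => ?_) _
  rw [← tr_tsum]
  -- Distinct preimages of `ω` under `σ^n` have disjoint `n`-cylinders, so the indicators add up to
  -- at most `1`.
  refine tr_mono (fun x => ?_) τ
  by_cases hx : ∃ ω', shift^[n] ω' = ω ∧ x ∈ cyl n ω'
  · obtain ⟨ω', h2, h3⟩ := hx
    rw [tsum_eq_single ω']
    · rw [if_pos h2, Set.indicator_of_mem h3]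
    · intro ω'' hne
      split_ifs with h4
      · refine Set.indicator_of_notMem (fun h5 => hne ?_) _
        apply Subtype.ext
        funext i
        by_cases hi : i < n
        · rw [← h5 i hi, ← h3 i hi]
        · obtain ⟨k, rfl⟩ := Nat.exists_eq_add_of_le' (not_lt.1 hi)
          rw [← iterate_shift_apply, ← iterate_shift_apply, h2, h4]
      · rfl
  · refine le_of_eq_of_le (ENNReal.tsum_eq_zero.2 fun ω' => ?_) zero_le
    split_ifs with h4
    · exact Set.indicator_of_notMem (fun h5 => hx ⟨ω', h4, h5⟩) _
    · rfl

end Transfer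

end MarkovShift

namespace MarkovShift

/-! ### Topology, measurability and comparison of measures on cylinders. -/

section Cylinders

variable {E : Type*} {A : E → E → Fin 2} [TopologicalSpace E] [DiscreteTopology E]

lemma continuous_coord (n : ℕ) : Continuous fun ω : Subshift A => ω.1 n :=
  (continuous_apply n).comp continuous_subtype_val

lemma continuous_block (n : ℕ) : Continuous (block n : Subshift A → _) :=
  continuous_pi fun i => continuous_coord i

lemma continuous_shift : Continuous (shift : Subshift A → Subshift A) :=
  Continuous.subtype_mk (continuous_pi fun n => continuous_coord (n + 1)) _

lemma isClopen_cyl (n : ℕ) (ω : Subshift A) : IsClopen (cyl n ω) := by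
  rw [cyl_eq_preimage]
  exact (isClopen_discrete _).preimage (continuous_block n)

lemma exists_cyl_subset {U : Set (Subshift A)} (hU : IsOpen U) {ω : Subshift A} (hω : ω ∈ U) :
    ∃ n, cyl n ω ⊆ U := by
  obtain ⟨V, hV, rfl⟩ := isOpen_induced_iff.1 hU
  obtain ⟨I, u, h1, h2⟩ := isOpen_pi_iff.1 hV ω.1 hω
  refine ⟨I.sup id + 1, fun τ hτ => h2 fun i hi => ?_⟩
  rw [hτ i (Nat.lt_succ_of_le (Finset.le_sup (f := id) hi))]
  exact (h1 i hi).2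

lemma isClosedEmbedding_val : IsClosedEmbedding (Subtype.val : Subshift A → ℕ → E) := by
  refine ⟨IsEmbedding.subtypeVal, ?_⟩
  rw [Subtype.range_val_subtype]
  have : {ω : ℕ → E | ∀ n, A (ω n) (ω (n + 1)) = 1} =
      ⋂ n, (fun ω : ℕ → E => (ω n, ω (n + 1))) ⁻¹' {p | A p.1 p.2 = 1} := by
    ext ω; simp
  rw [this]
  exact isClosed_iInter fun n => (isClosed_discrete _).preimage
    ((continuous_apply n).prodMk (continuous_apply (n + 1)))

instance [Countable E] : PolishSpace (Subshift A) := by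
  have : PolishSpace (ℕ → E) := {}
  exact isClosedEmbedding_val.polishSpace

lemma cyl_anti {m n : ℕ} (h : m ≤ n) (ω : Subshift A) : cyl n ω ⊆ cyl m ω :=
  fun _ hτ i hi => hτ i (hi.trans_le h)

variable [Countable E] [MeasurableSpace E] [BorelSpace E]

lemma measurable_coord (n : ℕ) : Measurable fun ω : Subshift A => ω.1 n :=
  (measurable_pi_apply n).comp measurable_subtype_coe

lemma measurable_shift : Measurable (shift : Subshift A → Subshift A) :=
  continuous_shift.measurable

lemma measurableSet_cyl (n : ℕ) (ω : Subshift A) : MeasurableSet (cyl n ω) :=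
  (isClopen_cyl n ω).isOpen.measurableSet

lemma measurableSet_preimage_block (n : ℕ) (S : Set (Fin n → E)) :
    MeasurableSet (block n ⁻¹' S : Set (Subshift A)) :=
  ((isOpen_discrete S).preimage (continuous_block n)).measurableSet

lemma measure_preimage_block (μ : Measure (Subshift A)) (n : ℕ) (S : Set (Fin n → E)) :
    μ (block n ⁻¹' S) = ∑' b : S, μ (block n ⁻¹' {b.1}) := by
  rw [← measure_biUnion (f := fun b => block n ⁻¹' {b}) S.to_countable]
  · congr 1
    ext ω; simp
  · intro a _ b _ hab
    exact Disjoint.preimage _ (by simpa using hab)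
  · exact fun b _ => measurableSet_preimage_block n {b}

/-- An inequality of measures can be checked on cylinders. -/
lemma le_of_cyl_le {d : ℕ} (hd : 1 ≤ d) {μ ν : Measure (Subshift A)} [IsFiniteMeasure ν]
    (h : ∀ n, d ∣ n → ∀ ω, μ (cyl n ω) ≤ ν (cyl n ω)) : μ ≤ ν := by
  refine Measure.le_iff'.2 fun B => ?_
  rw [B.measure_eq_iInf_isOpen ν]
  refine le_iInf₂ fun U hBU => le_iInf fun hU => (measure_mono hBU).trans ?_
  -- By outer regularity of `ν` open sets suffice; `V k` is the union of the cylinders of length `k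
  -- * d` inside `U`, and these unions increase to `U`.
  let V : ℕ → Set (Subshift A) := fun k => {ω | cyl (k * d) ω ⊆ U}
  have hVmono : Monotone V := fun k l hkl ω hω =>
    (cyl_anti (Nat.mul_le_mul_right d hkl) ω).trans hω
  have hVU : ⋃ k, V k = U := by
    refine Set.Subset.antisymm (Set.iUnion_subset fun k ω hω => hω (self_mem_cyl _ ω)) ?_
    intro ω hω
    obtain ⟨n, hn⟩ := exists_cyl_subset hU hω
    exact Set.mem_iUnion.2 ⟨n, (cyl_anti (Nat.le_mul_of_pos_right n hd) ω).trans hn⟩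
  have hV : ∀ k, V k = block (k * d) ⁻¹' (block (k * d) '' V k) := by
    intro k
    refine Set.Subset.antisymm (Set.subset_preimage_image _ _) ?_
    rintro ω ⟨τ, hτ, hτω⟩
    have : cyl (k * d) ω = cyl (k * d) τ := by
      rw [cyl_eq_preimage, cyl_eq_preimage, hτω]
    exact this.subset.trans hτ
  have hle : ∀ k, μ (V k) ≤ ν (V k) := by
    intro k
    rw [hV k, measure_preimage_block, measure_preimage_block]
    refine ENNReal.tsum_le_tsum ?_
    rintro ⟨b, τ, -, rfl⟩
    rw [← cyl_eq_preimage]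
    exact h _ (dvd_mul_left d k) τ
  rw [← hVU, hVmono.measure_iUnion, hVmono.measure_iUnion]
  exact iSup_mono hle

end Cylinders

/-! ### Conformal measures: bounds on cylinders, uniqueness, ergodicity. -/

section Dual

variable {E : Type*} {A : E → E → Fin 2} [TopologicalSpace E] [DiscreteTopology E]
  [Countable E] [MeasurableSpace E] [BorelSpace E] {f : Subshift A → ℝ}

lemma measurable_weight (hf : Measurable f) (n : ℕ) : Measurable (weight f n) := by
  refine (Real.measurable_exp.comp ?_).ennreal_ofReal
  unfold birkhoffSum
  exact Finset.measurable_fun_sum _ fun k _ => hf.comp (measurable_shift.iterate k)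

/-- The defining sum runs over uncountably many points, so measurability is obtained by induction
from the one-letter formula, a countable sum. -/
lemma measurable_tr (hf : Measurable f) (n : ℕ) {g : Subshift A → ℝ≥0∞} (hg : Measurable g) :
    Measurable (tr f n g) := by
  induction n with
  | zero => rwa [tr_zero]
  | succ n ih =>
    rw [tr_add]
    have : tr f 1 (tr f n g) = fun τ => ∑' e, if h : A e (τ.1 0) = 1 then
        weight f 1 (cons e τ h) * tr f n g (cons e τ h) else 0 := funext fun τ => tr_one_eq _ τ
    rw [this]
    refine Measurable.tsum fun e => ?_
    have hc : Measurable (fun u : {ω : Subshift A | A e (ω.1 0) = 1} => cons e u.1 u.2) := by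
      refine Measurable.subtype_mk (measurable_pi_lambda _ fun n => ?_)
      cases n with
      | zero => exact measurable_const
      | succ n => exact (measurable_coord n).comp measurable_subtype_coe
    exact Measurable.dite (s := {ω : Subshift A | A e (ω.1 0) = 1})
      (f := fun u => weight f 1 (cons e u.1 u.2) * tr f n g (cons e u.1 u.2))
      (((measurable_weight hf 1).comp hc).mul (ih.comp hc))
      (g := fun _ => 0) measurable_const
      (((isOpen_discrete {a | A e a = 1}).preimage (continuous_coord 0)).measurableSet)

open Classical in
/-- The measure `(ℒ_f^*)^n δ_τ`. -/
def trKernel (f : Subshift A → ℝ) (n : ℕ) (τ : Subshift A) : Measure (Subshift A) :=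
  Measure.sum fun ω => (if shift^[n] ω = τ then weight f n ω else 0) • Measure.dirac ω

lemma lintegral_trKernel (n : ℕ) (τ : Subshift A) {g : Subshift A → ℝ≥0∞} (hg : Measurable g) :
    ∫⁻ ω, g ω ∂(trKernel f n τ) = tr f n g τ := by
  rw [trKernel, lintegral_sum_measure, tr]
  refine tsum_congr fun ω => ?_
  rw [lintegral_smul_measure, lintegral_dirac' _ hg]
  split_ifs <;> simp

lemma trKernel_apply (n : ℕ) (τ : Subshift A) {B : Set (Subshift A)} (hB : MeasurableSet B) :
    trKernel f n τ B = tr f n (B.indicator 1) τ := by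
  rw [← lintegral_trKernel n τ (measurable_one.indicator hB), lintegral_indicator_one hB]

lemma measurable_trKernel (hf : Measurable f) (n : ℕ) : Measurable (trKernel f n) := by
  refine Measure.measurable_of_measurable_coe _ fun B hB => ?_
  have : (fun τ => trKernel f n τ B) = tr f n (B.indicator 1) :=
    funext fun τ => trKernel_apply n τ hB
  rw [this]
  exact measurable_tr hf n (measurable_one.indicator hB)

/-- `ν` is an eigenmeasure, with eigenvalue `c`, of the conjugate of the `d`-th iterate of the
Perron–Frobenius operator. -/
def IsConformal (f : Subshift A → ℝ) (d : ℕ) (c : ℝ≥0∞) (ν : Measure (Subshift A)) : Prop :=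
  ∀ g : Subshift A → ℝ≥0∞, Measurable g → ∫⁻ ω, tr f d g ω ∂ν = c * ∫⁻ ω, g ω ∂ν

lemma lintegral_bind_trKernel (hf : Measurable f) (d : ℕ) (ν : Measure (Subshift A))
    {g : Subshift A → ℝ≥0∞} (hg : Measurable g) :
    ∫⁻ ω, g ω ∂(ν.bind (trKernel f d)) = ∫⁻ ω, tr f d g ω ∂ν := by
  rw [Measure.lintegral_bind (measurable_trKernel hf d).aemeasurable hg.aemeasurable]
  exact lintegral_congr fun τ => lintegral_trKernel d τ hg

lemma isConformal_of_bind_eq (hf : Measurable f) {d : ℕ} {c : ℝ≥0∞} {ν : Measure (Subshift A)}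
    (h : ν.bind (trKernel f d) = c • ν) : IsConformal f d c ν := by
  intro g hg
  rw [← lintegral_bind_trKernel hf d ν hg, h, lintegral_smul_measure, smul_eq_mul]

lemma isConformal_of_sets (hf : Measurable f) {d : ℕ} {c : ℝ≥0∞} {ν : Measure (Subshift A)}
    (h : ∀ B, MeasurableSet B → ∫⁻ ω, tr f d (B.indicator 1) ω ∂ν = c * ν B) :
    IsConformal f d c ν := by
  refine isConformal_of_bind_eq hf (Measure.ext fun B hB => ?_)
  rw [← lintegral_indicator_one hB, lintegral_bind_trKernel hf d ν (measurable_one.indicator hB),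
    h B hB]
  rfl

lemma IsConformal.pow (hf : Measurable f) {d : ℕ} {c : ℝ≥0∞} {ν : Measure (Subshift A)}
    (h : IsConformal f d c ν) (k : ℕ) : IsConformal f (d * k) (c ^ k) ν := by
  induction k with
  | zero => intro g _; simp [tr_zero]
  | succ k ih =>
    intro g hg
    rw [Nat.mul_succ, tr_add, h _ (measurable_tr hf _ hg), ih g hg, pow_succ]
    ring

lemma IsConformal.of_dvd (hf : Measurable f) {d : ℕ} {c : ℝ≥0∞} {ν : Measure (Subshift A)}
    (h : IsConformal f d (c ^ d) ν) {n : ℕ} (hn : d ∣ n) : IsConformal f n (c ^ n) ν := by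
  obtain ⟨k, rfl⟩ := hn
  rw [pow_mul]
  exact h.pow hf k

lemma IsConformal.lintegral_indicator {d : ℕ} {c : ℝ≥0∞} {ν : Measure (Subshift A)}
    (h : IsConformal f d c ν) {B : Set (Subshift A)} (hB : MeasurableSet B) :
    ∫⁻ ω, tr f d (B.indicator 1) ω ∂ν = c * ν B := by
  rw [h _ (measurable_one.indicator hB), lintegral_indicator_one hB]

/-- Upper Gibbs bound. -/
lemma IsHolder.exists_measure_cyl_le (hf : IsHolder f) : ∃ K : ℝ≥0∞, K ≠ ⊤ ∧
    ∀ (ν : Measure (Subshift A)) (n : ℕ) (c : ℝ≥0∞), IsConformal f n c ν → ∀ ω,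
      c * ν (cyl n ω) ≤ K * weight f n ω * ν Set.univ := by
  obtain ⟨K, hK, h⟩ := exists_tr_cyl_le hf
  refine ⟨K, hK, fun ν n c hν ω => ?_⟩
  rw [← hν.lintegral_indicator (measurableSet_cyl n ω), ← lintegral_const]
  exact lintegral_mono fun τ => h n ω τ

/-- Lower Gibbs bound. -/
lemma IsHolder.exists_le_measure_cyl (hf : IsHolder f) {d : ℕ} (hd : Connecting A d) {c : ℝ≥0∞}
    (hc : c ≠ ⊤) : ∃ M : ℝ≥0∞, M ≠ ⊤ ∧ ∀ ν : Measure (Subshift A), IsConformal f d (c ^ d) ν →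
      ∀ n, d ∣ n → ∀ ω, weight f n ω * ν Set.univ ≤ M * (c ^ n * ν (cyl n ω)) := by
  obtain ⟨q, M, hM, h⟩ := exists_weight_le_tr_cyl hf hd
  have hfm := hf.continuous.measurable
  refine ⟨M * ∑ j ∈ (Finset.range (q + 1)).filter (d ∣ ·), c ^ j,
    ENNReal.mul_ne_top hM (ENNReal.sum_ne_top.2 fun j _ => ENNReal.pow_ne_top hc),
    fun ν hν n hn ω => ?_⟩
  have hmeas : ∀ j, Measurable (tr f (n + j) ((cyl n ω).indicator 1)) := fun j =>
    measurable_tr hfm _ (measurable_one.indicator (measurableSet_cyl n ω))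
  rw [← lintegral_const]
  refine (lintegral_mono fun τ => h n ω τ).trans ?_
  rw [lintegral_const_mul _ (Finset.measurable_fun_sum _ fun j _ => hmeas j),
    lintegral_finsetSum _ (fun j _ => hmeas j), mul_assoc, Finset.sum_mul]
  refine mul_le_mul_right (Finset.sum_le_sum fun j hj => le_of_eq ?_) _
  rw [(hν.of_dvd hfm (dvd_add hn (Finset.mem_filter.1 hj).2)).lintegral_indicator
    (measurableSet_cyl n ω), pow_add]
  ring

/-- A conformal measure dominates any other one of the same eigenvalue. -/
lemma IsHolder.exists_conformal_le (hf : IsHolder f) {d : ℕ} (hd1 : 1 ≤ d) (hd : Connecting A d)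
    {c : ℝ≥0∞} (hc0 : c ≠ 0) (hc : c ≠ ⊤) : ∃ C : ℝ≥0∞, C ≠ ⊤ ∧
    ∀ (m ν : Measure (Subshift A)) [IsProbabilityMeasure m] [IsFiniteMeasure ν],
      IsConformal f d (c ^ d) m → IsConformal f d (c ^ d) ν → ν Set.univ • m ≤ C • ν := by
  obtain ⟨K, hK, h1⟩ := hf.exists_measure_cyl_le
  obtain ⟨M, hM, h2⟩ := hf.exists_le_measure_cyl hd hc
  have hfm := hf.continuous.measurable
  refine ⟨K * M, ENNReal.mul_ne_top hK hM, fun m ν _ _ hm hν => ?_⟩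
  have : IsFiniteMeasure ((K * M) • ν) := ν.smul_finite (ENNReal.mul_ne_top hK hM)
  refine le_of_cyl_le hd1 fun n hn ω => ?_
  rw [Measure.smul_apply, Measure.smul_apply, smul_eq_mul, smul_eq_mul]
  have h3 := h1 m n _ (hm.of_dvd hfm hn) ω
  have h4 := h2 ν hν n hn ω
  rw [measure_univ, mul_one] at h3
  have hcn : c ^ n ≠ ⊤ := ENNReal.pow_ne_top hc
  rw [← ENNReal.mul_le_mul_iff_right (pow_ne_zero n hc0) hcn]
  calc c ^ n * (ν Set.univ * m (cyl n ω)) = (c ^ n * m (cyl n ω)) * ν Set.univ := by ring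
    _ ≤ (K * weight f n ω) * ν Set.univ := by gcongr
    _ = K * (weight f n ω * ν Set.univ) := by ring
    _ ≤ K * (M * (c ^ n * ν (cyl n ω))) := by gcongr
    _ = c ^ n * (K * M * ν (cyl n ω)) := by ring

/-- Let `t` be the largest number with `t • m ≤ m'`. The remainder `m' - t • m` is again conformal,
hence dominates a multiple of `m` proportional to its own mass; maximality of `t` forces this mass
to vanish. -/
lemma IsHolder.conformal_unique (hf : IsHolder f) (hd : Connecting A 1)
    {c : ℝ≥0∞} (hc0 : c ≠ 0) (hc : c ≠ ⊤) {m m' : Measure (Subshift A)} [IsProbabilityMeasure m]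
    [IsProbabilityMeasure m'] (hm : IsConformal f 1 c m) (hm' : IsConformal f 1 c m') :
    m' = m := by
  obtain ⟨C, hC, h⟩ := hf.exists_conformal_le le_rfl hd hc0 hc
  have hfm := hf.continuous.measurable
  rw [pow_one] at h
  set T : Set ℝ≥0∞ := {t | t • m ≤ m'} with hT
  set t := sSup T with ht
  have htT : t • m ≤ m' := by
    refine Measure.le_iff'.2 fun B => ?_
    rw [Measure.smul_apply, smul_eq_mul]
    by_cases hB : m B = 0
    · simp [hB]
    · rw [← ENNReal.le_div_iff_mul_le (Or.inl hB) (Or.inl (measure_ne_top _ _))]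
      refine sSup_le fun s hs => ?_
      rw [ENNReal.le_div_iff_mul_le (Or.inl hB) (Or.inl (measure_ne_top _ _))]
      exact hs B
  have ht1 : t ≤ 1 := by simpa using htT Set.univ
  have htop : t ≠ ⊤ := (ht1.trans_lt ENNReal.one_lt_top).ne
  have : IsFiniteMeasure (t • m) := m.smul_finite htop
  set ν := m' - t • m with hν
  have hsum : ν + t • m = m' := Measure.sub_add_cancel_of_le htT
  have hνc : IsConformal f 1 c ν := by
    refine isConformal_of_sets hfm fun B hB => ?_
    have h1 := hm'.lintegral_indicator hB
    rw [← hsum, lintegral_add_measure, lintegral_smul_measure, hm.lintegral_indicator hB,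
      Measure.add_apply, Measure.smul_apply, smul_eq_mul, smul_eq_mul, mul_add,
      mul_left_comm c t] at h1
    exact (ENNReal.add_left_inj (ENNReal.mul_ne_top htop
      (ENNReal.mul_ne_top hc (measure_ne_top _ _)))).1 h1
  have h2 := h m ν hm hνc
  have hC0 : C ≠ 0 := by
    rintro rfl
    have h3 := h m m hm hm Set.univ
    simp at h3
  have h3 : t + C⁻¹ * ν Set.univ ∈ T := by
    change _ • m ≤ m'
    rw [← hsum, add_smul, add_comm ν]
    gcongr
    refine Measure.le_iff'.2 fun B => ?_
    rw [Measure.smul_apply, smul_eq_mul, mul_assoc]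
    refine (mul_le_mul_right (h2 B) _).trans ?_
    rw [Measure.smul_apply, smul_eq_mul, ← mul_assoc, ENNReal.inv_mul_cancel hC0 hC, one_mul]
  have h4 : t + C⁻¹ * ν Set.univ ≤ t := le_sSup h3
  have h5 : C⁻¹ * ν Set.univ = 0 := by
    have : t + C⁻¹ * ν Set.univ ≤ t + 0 := by simpa using h4
    exact nonpos_iff_eq_zero.1 ((ENNReal.add_le_add_iff_left htop).1 this)
  have h6 : ν Set.univ = 0 := (mul_eq_zero.1 h5).resolve_left (ENNReal.inv_ne_zero.2 hC)
  have h7 : ν = 0 := Measure.measure_univ_eq_zero.1 h6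
  rw [h7, zero_add] at hsum
  refine Measure.eq_of_le_of_isProbabilityMeasure ?_
  rw [← hsum]
  refine Measure.le_iff'.2 fun B => ?_
  rw [Measure.smul_apply, smul_eq_mul]
  exact mul_le_of_le_one_left zero_le ht1

/-- The indicator of an invariant set is a function of `σ^d ω` and therefore factors out of the
`d`-th iterate. -/
lemma IsConformal.restrict (hf : Measurable f) {d : ℕ} {c : ℝ≥0∞} {m : Measure (Subshift A)}
    (hm : IsConformal f d c m) {B : Set (Subshift A)} (hB : MeasurableSet B)
    (hinv : shift^[d] ⁻¹' B = B) : IsConformal f d c (m.restrict B) := by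
  refine isConformal_of_sets hf fun S hS => ?_
  rw [Measure.restrict_apply hS, ← hm.lintegral_indicator (hS.inter hB),
    ← MeasureTheory.lintegral_indicator hB]
  refine lintegral_congr fun τ => ?_
  have h1 : (S ∩ B).indicator (1 : Subshift A → ℝ≥0∞) =
      fun ω => B.indicator 1 (shift^[d] ω) * S.indicator 1 ω := by
    funext ω
    have h2 : shift^[d] ω ∈ B ↔ ω ∈ B := by
      rw [← Set.mem_preimage, hinv]
    by_cases hω : ω ∈ B <;> by_cases hω' : ω ∈ S <;> simp [h2, hω, hω']
  rw [h1, tr_comp_mul]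
  by_cases hτ : τ ∈ B <;> simp [hτ]

/-- The domination applied to `m` and `m.restrict B`, evaluated at `Bᶜ`, reads `m(B) m(Bᶜ) ≤ 0`.
Since `B` is only `σ^d`-invariant, only iterates of order divisible by `d` are available; hence
`Connecting A d`. -/
lemma IsHolder.preErgodic_iterate (hf : IsHolder f) {d : ℕ} (hd1 : 1 ≤ d) (hd : Connecting A d)
    {c : ℝ≥0∞} (hc0 : c ≠ 0) (hc : c ≠ ⊤) {m : Measure (Subshift A)} [IsProbabilityMeasure m]
    (hm : IsConformal f d (c ^ d) m) : PreErgodic (shift^[d]) m := by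
  refine ⟨fun B hB hinv => ?_⟩
  obtain ⟨C, hC, h⟩ := hf.exists_conformal_le hd1 hd hc0 hc
  have h1 := h m (m.restrict B) hm (hm.restrict hf.continuous.measurable hB hinv) Bᶜ
  rw [Measure.smul_apply, Measure.smul_apply, Measure.restrict_apply hB.compl] at h1
  simp only [Measure.restrict_apply, MeasurableSet.univ, Set.univ_inter, smul_eq_mul,
    Set.compl_inter_self, measure_empty, mul_zero, nonpos_iff_eq_zero, mul_eq_zero] at h1
  rw [eventuallyConst_set']
  refine h1.imp (fun h2 => ae_eq_empty.2 h2) (fun h2 => ae_eq_univ.2 h2)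

end Dual

end MarkovShift

namespace MarkovShift

/-! ### Power series with almost submultiplicative coefficients. -/

section Series

/-- With `n = r + N k`, submultiplicativity bounds the terms by a geometric series in `k` for each
of the `N` residues `r`. -/
lemma tsum_pow_mul_ne_top_of_submultiplicative {b : ℕ → ℝ≥0∞}
    (hsub : ∀ m n, b (m + n) ≤ b m * b n) (hb : ∀ n, b n ≠ ⊤) {s : ℝ≥0∞} (hs : s ≠ ⊤)
    {N : ℕ} (hN : N ≠ 0) (hlt : s ^ N * b N < 1) : ∑' n, s ^ n * b n ≠ ⊤ := by
  have : NeZero N := ⟨hN⟩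
  have h1 : ∀ k r, s ^ (r + N * k) * b (r + N * k) ≤ (s ^ r * b r) * (s ^ N * b N) ^ k := by
    intro k r
    induction k with
    | zero => simp
    | succ k ih =>
      calc s ^ (r + N * (k + 1)) * b (r + N * (k + 1))
          ≤ s ^ (r + N * (k + 1)) * (b (r + N * k) * b N) := by
            refine mul_le_mul_right ?_ _
            rw [show r + N * (k + 1) = r + N * k + N by ring]
            exact hsub (r + N * k) N
        _ = (s ^ (r + N * k) * b (r + N * k)) * (s ^ N * b N) := by ring
        _ ≤ ((s ^ r * b r) * (s ^ N * b N) ^ k) * (s ^ N * b N) := by gcongr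
        _ = _ := by ring
  rw [← (Nat.divModEquiv N).symm.tsum_eq, ENNReal.tsum_prod']
  have h2 : ∑' k : ℕ, ∑' r : Fin N, (s ^ (r : ℕ) * b r) * (s ^ N * b N) ^ k ≠ ⊤ := by
    simp_rw [ENNReal.tsum_mul_right]
    rw [ENNReal.tsum_mul_left, ENNReal.tsum_geometric, tsum_fintype]
    refine ENNReal.mul_ne_top ?_ (ENNReal.inv_ne_top.2 (tsub_pos_of_lt hlt).ne')
    exact ENNReal.sum_ne_top.2 fun r _ => ENNReal.mul_ne_top (ENNReal.pow_ne_top hs) (hb _)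
  refine ne_top_of_le_ne_top h2 (ENNReal.tsum_le_tsum fun k => ENNReal.tsum_le_tsum fun r => ?_)
  have h3 : (Nat.divModEquiv N).symm (k, r) = r + N * k := by
    simp [Nat.divModEquiv, mul_comm, add_comm]
  rw [h3]
  exact h1 k r

/-- `R` is the radius of convergence. Were the series finite at `R`, so would be the one with
coefficients `b`, hence `R^N b_N < 1` for some `N ≥ 1`. This persists for some `s > R`, where
submultiplicativity yields convergence, a contradiction. -/
lemma exists_critical_exponent {a b : ℕ → ℝ≥0∞} (hab : ∀ n, a n ≤ b n)
    (hsub : ∀ m n, b (m + n) ≤ b m * b n) {θ : ℝ≥0∞} (hθ : θ ≠ ⊤) (hb : ∀ n, b n ≤ θ ^ n)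
    {q : ℕ} {M : ℝ≥0∞} (hM : M ≠ ⊤) (hba : ∀ n, b n ≤ M * ∑ j ∈ Finset.range (q + 1), a (n + j))
    {c : ℝ≥0∞} (hc : c ≠ 0) (hca : ∀ n, c ^ n ≤ a n) :
    ∃ R : ℝ≥0∞, R ≠ 0 ∧ R ≠ ⊤ ∧ (∀ s < R, ∑' n, s ^ n * a n ≠ ⊤) ∧ ∑' n, R ^ n * a n = ⊤ := by
  have hbt : ∀ n, b n ≠ ⊤ := fun n => ne_top_of_le_ne_top (ENNReal.pow_ne_top hθ) (hb n)
  set S : Set ℝ≥0∞ := {s | ∑' n, s ^ n * a n ≠ ⊤} with hS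
  set R := sSup S with hR
  have hRc : R ≤ c⁻¹ := by
    refine sSup_le fun s hs => ?_
    rw [ENNReal.le_inv_iff_mul_le]
    by_contra! hlt
    refine hs (top_le_iff.1 ?_)
    rw [← ENNReal.tsum_const_eq_top_of_ne_zero (α := ℕ) one_ne_zero]
    refine ENNReal.tsum_le_tsum fun n => ?_
    calc 1 ≤ (s * c) ^ n := one_le_pow₀ hlt.le
      _ = s ^ n * c ^ n := mul_pow _ _ _
      _ ≤ s ^ n * a n := by gcongr; exact hca n
  have hRtop : R ≠ ⊤ := ne_top_of_le_ne_top (ENNReal.inv_ne_top.2 hc) hRc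
  have hR0 : R ≠ 0 := by
    -- At this point the terms are at most `2⁻¹ ^ n`; the summand `1` keeps the base finite when `θ
    -- = 0`.
    have h1 : (2 * (θ + 1))⁻¹ ∈ S := by
      have h2 : (2 * (θ + 1))⁻¹ * θ ≤ 2⁻¹ := by
        rw [ENNReal.mul_inv (Or.inl two_ne_zero) (Or.inl ENNReal.ofNat_ne_top), mul_assoc]
        refine mul_le_of_le_one_right zero_le ?_
        rw [mul_comm, ← div_eq_mul_inv]
        exact ENNReal.div_le_of_le_mul (by rw [one_mul]; exact le_self_add)
      have h3 : ∑' n : ℕ, (2⁻¹ : ℝ≥0∞) ^ n ≠ ⊤ := by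
        rw [ENNReal.tsum_geometric]
        simp
      refine ne_top_of_le_ne_top h3 (ENNReal.tsum_le_tsum fun n => ?_)
      calc _ ≤ (2 * (θ + 1))⁻¹ ^ n * θ ^ n := by gcongr; exact (hab n).trans (hb n)
        _ = ((2 * (θ + 1))⁻¹ * θ) ^ n := (mul_pow _ _ _).symm
        _ ≤ 2⁻¹ ^ n := by gcongr
    have h4 : (2 * (θ + 1))⁻¹ ≤ R := le_sSup h1
    intro h0
    rw [h0, nonpos_iff_eq_zero, ENNReal.inv_eq_zero] at h4
    exact ENNReal.mul_ne_top ENNReal.ofNat_ne_top (ENNReal.add_ne_top.2 ⟨hθ, ENNReal.one_ne_top⟩) h4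
  refine ⟨R, hR0, hRtop, fun s hs => ?_, ?_⟩
  · obtain ⟨t, ht, hst⟩ := lt_sSup_iff.1 hs
    refine ne_top_of_le_ne_top ht (ENNReal.tsum_le_tsum fun n => ?_)
    gcongr
  by_contra hD
  -- Each of the `q + 1` shifted series is a tail of the series for `a`, rescaled by `R⁻¹ ^ j`.
  have hDb : ∑' n, R ^ n * b n ≠ ⊤ := by
    have h1 : ∀ n, R ^ n * b n ≤ ∑ j ∈ Finset.range (q + 1),
        M * (R⁻¹ ^ j * (R ^ (n + j) * a (n + j))) := by
      intro n
      refine (mul_le_mul_right (hba n) _).trans (le_of_eq ?_)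
      rw [mul_left_comm, Finset.mul_sum, Finset.mul_sum]
      refine Finset.sum_congr rfl fun j _ => ?_
      have : R⁻¹ ^ j * R ^ j = 1 := by
        rw [← mul_pow, ENNReal.inv_mul_cancel hR0 hRtop, one_pow]
      rw [pow_add, show R⁻¹ ^ j * (R ^ n * R ^ j * a (n + j)) =
        (R⁻¹ ^ j * R ^ j) * (R ^ n * a (n + j)) by ring, this, one_mul]
    refine ne_top_of_le_ne_top ?_ (ENNReal.tsum_le_tsum h1)
    rw [Summable.tsum_finsetSum (fun _ _ => ENNReal.summable)]
    refine ENNReal.sum_ne_top.2 fun j _ => ?_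
    rw [ENNReal.tsum_mul_left, ENNReal.tsum_mul_left]
    refine ENNReal.mul_ne_top hM (ENNReal.mul_ne_top
      (ENNReal.pow_ne_top (ENNReal.inv_ne_top.2 hR0)) (ne_top_of_le_ne_top hD ?_))
    exact ENNReal.tsum_comp_le_tsum_of_injective (add_left_injective j) (fun n => R ^ n * a n)
  have h1 := ENNReal.tendsto_cofinite_zero_of_tsum_ne_top hDb
  rw [Nat.cofinite_eq_atTop] at h1
  obtain ⟨N, hN, hN1⟩ := ((h1.eventually_lt_const one_pos).and (eventually_ge_atTop 1)).exists
  have h2 : Tendsto (fun s : ℝ≥0∞ => s ^ N * b N) (𝓝 R) (𝓝 (R ^ N * b N)) :=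
    ENNReal.Tendsto.mul_const ((ENNReal.continuous_pow N).tendsto R) (Or.inr (hbt N))
  have : (𝓝[>] R).NeBot := nhdsGT_neBot_of_exists_gt ⟨⊤, hRtop.lt_top⟩
  obtain ⟨s, ⟨hs1, hs2⟩, hs3⟩ := ((((h2.eventually_lt_const hN).and
    (Iio_mem_nhds hRtop.lt_top)).filter_mono nhdsWithin_le_nhds).and
      (self_mem_nhdsWithin (s := Set.Ioi R))).exists
  have h3 := tsum_pow_mul_ne_top_of_submultiplicative hsub hbt (ne_of_lt hs2) (by omega) hs1
  have h4 : s ∈ S := ne_top_of_le_ne_top h3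
    (ENNReal.tsum_le_tsum fun n => mul_le_mul_right (hab n) _)
  exact absurd (le_sSup h4) (not_le.2 hs3)

/-- A finite partial sum at `R` already exceeds any given bound, and it is continuous in the
variable. -/
lemma tendsto_tsum_pow_mul {a : ℕ → ℝ≥0∞} {R : ℝ≥0∞} (ha : ∀ n, a n ≠ ⊤)
    (h : ∑' n, R ^ n * a n = ⊤) {u : ℕ → ℝ≥0∞} (hu : Tendsto u atTop (𝓝 R)) :
    Tendsto (fun k => ∑' n, u k ^ n * a n) atTop (𝓝 ⊤) := by
  rw [ENNReal.tendsto_nhds_top_iff_nnreal]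
  intro C
  have h1 : (C : ℝ≥0∞) < ∑' n, R ^ n * a n := by rw [h]; exact ENNReal.coe_lt_top
  rw [ENNReal.tsum_eq_iSup_sum, lt_iSup_iff] at h1
  obtain ⟨s, hs⟩ := h1
  have h2 : Tendsto (fun k => ∑ n ∈ s, u k ^ n * a n) atTop (𝓝 (∑ n ∈ s, R ^ n * a n)) :=
    tendsto_finsetSum _ fun n _ => ENNReal.Tendsto.mul_const
      (((ENNReal.continuous_pow n).tendsto R).comp hu) (Or.inr (ha n))
  filter_upwards [h2.eventually_const_lt hs] with k hk
  exact hk.trans_le (ENNReal.sum_le_tsum s)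

end Series

/-! ### Tightness, and the dictionary between eigenmeasures and conformal measures. -/

section Existence

variable {E : Type*} {A : E → E → Fin 2} [TopologicalSpace E] [DiscreteTopology E]
  [Countable E] [MeasurableSpace E] [BorelSpace E] {f : Subshift A → ℝ}

lemma nonempty_subshift [Nonempty E] {d : ℕ} (hd : Connecting A d) : Nonempty (Subshift A) := by
  have hsucc : ∀ i : E, ∃ j, A i j = 1 := by
    intro i
    obtain ⟨Φ, hΦ⟩ := hd
    obtain ⟨w, -, -, hw⟩ := hΦ i i
    cases w with
    | nil => exact ⟨i, (List.isChain_cons_cons.1 hw).1⟩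
    | cons a w => exact ⟨a, (List.isChain_cons_cons.1 hw).1⟩
  choose g hg using hsucc
  refine ⟨⟨fun n => g^[n] (Classical.arbitrary E), fun n => ?_⟩⟩
  change A _ (g^[n + 1] _) = 1
  rw [Function.iterate_succ_apply']
  exact hg _

/-- Prokhorov's theorem; convergence along an ultrafilter replaces the extraction of a subsequence.
-/
lemma exists_tendsto_of_isTight {u : ℕ → ProbabilityMeasure (Subshift A)}
    (hu : IsTightMeasureSet (Set.range fun n => (u n : Measure (Subshift A)))) :
    ∃ m : ProbabilityMeasure (Subshift A), Tendsto u (hyperfilter ℕ) (𝓝 m) := by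
  have h : IsCompact (closure (Set.range u)) := by
    refine isCompact_closure_of_isTightMeasureSet (hu.subset ?_)
    rintro _ ⟨_, ⟨n, rfl⟩, rfl⟩
    exact ⟨n, rfl⟩
  obtain ⟨m, -, hm⟩ := h.ultrafilter_le_nhds ((hyperfilter ℕ).map u) (by
    rw [Ultrafilter.coe_map, le_principal_iff, mem_map]
    exact univ_mem' fun n => subset_closure ⟨n, rfl⟩)
  exact ⟨m, hm⟩

/-- A family of measures is tight if each coordinate is uniformly concentrated on finite sets. -/
lemma isTight_of_coord {S : Set (Measure (Subshift A))}
    (h : ∀ (k : ℕ) (ε : ℝ≥0∞), 0 < ε → ∃ F : Finset E, ∀ μ ∈ S, μ {ω | ω.1 k ∉ F} ≤ ε) :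
    IsTightMeasureSet S := by
  rw [isTightMeasureSet_iff_exists_isCompact_measure_compl_le]
  intro ε hε
  obtain ⟨δ, hδ, hδε⟩ := ENNReal.exists_pos_sum_of_countable' hε.ne' ℕ
  choose F hF using fun k => h k (δ k) (hδ k)
  refine ⟨Subtype.val ⁻¹' Set.univ.pi fun k => (F k : Set E),
    isClosedEmbedding_val.isCompact_preimage
      (isCompact_univ_pi fun k => (F k).finite_toSet.isCompact), fun μ hμ => ?_⟩
  refine le_trans ?_ hδε.le
  refine le_trans (measure_mono ?_) ((measure_iUnion_le fun k => {ω : Subshift A | ω.1 k ∉ F k}).trans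
    (ENNReal.tsum_le_tsum fun k => hF k μ hμ))
  intro ω hω
  simpa using hω

lemma transferTerm_nonneg {g : Subshift A → ℝ} (hg : ∀ ω, 0 ≤ g ω) (e : E) (ω : Subshift A) :
    0 ≤ transferTerm f g e ω := by
  unfold transferTerm
  split_ifs
  · exact mul_nonneg (Real.exp_pos _).le (hg _)
  · rfl

/-- The bridge between the operator on `C_b` and `tr`; it also shows that `tr f 1` sends bounded
continuous functions to such functions, as weak convergence requires. -/
lemma ofReal_perronFrobenius (hf : IsHolder f) (hs : IsSummable f) {g : Subshift A →ᵇ ℝ}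
    (hg : ∀ ω, 0 ≤ g ω) (ω : Subshift A) :
    ENNReal.ofReal (perronFrobenius f hf hs g ω) = tr f 1 (fun τ => ENNReal.ofReal (g τ)) ω := by
  rw [perronFrobenius_apply, tr_one_eq, ENNReal.ofReal_tsum_of_nonneg
    (fun e => transferTerm_nonneg hg e ω) (hs.summable_transferTerm g ω)]
  refine tsum_congr fun e => ?_
  unfold transferTerm
  split_ifs with h
  · rw [ENNReal.ofReal_mul (Real.exp_pos _).le, weight, birkhoffSum_one]
  · exact ENNReal.ofReal_zero

/-- A bounded continuous function with values in `ℝ≥0`, as a real function. -/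
def toRealFun (g : Subshift A →ᵇ NNReal) : Subshift A →ᵇ ℝ :=
  BoundedContinuousFunction.comp (fun x : NNReal => (x : ℝ)) isometry_subtype_coe.lipschitz g

lemma ofReal_toRealFun (g : Subshift A →ᵇ NNReal) (ω : Subshift A) :
    ENNReal.ofReal (toRealFun g ω) = g ω := ENNReal.ofReal_coe_nnreal

lemma toRealFun_nonneg (g : Subshift A →ᵇ NNReal) (ω : Subshift A) : 0 ≤ toRealFun g ω :=
  (g ω).2

lemma coe_nnrealPart_perronFrobenius (hf : IsHolder f) (hs : IsSummable f)
    (g : Subshift A →ᵇ NNReal) (ω : Subshift A) :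
    ((perronFrobenius f hf hs (toRealFun g)).nnrealPart ω : ℝ≥0∞) =
      tr f 1 (fun τ => (g τ : ℝ≥0∞)) ω := by
  have := ofReal_perronFrobenius hf hs (toRealFun_nonneg g) ω
  simp_rw [ofReal_toRealFun] at this
  exact this

/-- Both sides are integrals against measures, and a finite measure is determined by its integrals
of bounded continuous functions. -/
lemma isConformal_of_boundedContinuous (hf : IsHolder f) {c : ℝ≥0∞} (hc : c ≠ ⊤)
    {ν : Measure (Subshift A)} [IsFiniteMeasure ν]
    (h : ∀ g : Subshift A →ᵇ NNReal,
      ∫⁻ ω, tr f 1 (fun τ => (g τ : ℝ≥0∞)) ω ∂ν = c * ∫⁻ ω, g ω ∂ν) : IsConformal f 1 c ν := by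
  have hfm := hf.continuous.measurable
  refine isConformal_of_bind_eq hfm (Eq.symm ?_)
  have : IsFiniteMeasure (c • ν) := ν.smul_finite hc
  refine ext_of_forall_lintegral_eq_of_IsFiniteMeasure fun g => ?_
  have hg : Measurable fun τ => (g τ : ℝ≥0∞) :=
    measurable_coe_nnreal_ennreal.comp g.continuous.measurable
  rw [lintegral_bind_trKernel hfm 1 ν hg, h g, lintegral_smul_measure, smul_eq_mul]

lemma lintegral_toRealFun (g : Subshift A →ᵇ NNReal) (ν : Measure (Subshift A))
    [IsFiniteMeasure ν] :
    ∫⁻ ω, (g ω : ℝ≥0∞) ∂ν = ENNReal.ofReal (∫ ω, toRealFun g ω ∂ν) := by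
  rw [ofReal_integral_eq_lintegral_ofReal ((toRealFun g).integrable ν)
    (ae_of_all _ (toRealFun_nonneg g))]
  simp_rw [ofReal_toRealFun]

lemma IsEigenmeasure.integral_eq {hf : IsHolder f} {hs : IsSummable f}
    {m : ProbabilityMeasure (Subshift A)} {c : ℝ} (h : IsEigenmeasure f hf hs m c)
    (g : Subshift A →ᵇ ℝ) : ∫ ω, perronFrobenius f hf hs g ω ∂(m : Measure (Subshift A)) =
      c * ∫ ω, g ω ∂(m : Measure (Subshift A)) := congrArg (fun φ => φ g) h

/-- The eigenvalue is an arbitrary real a priori; testing against the constant `1` shows that it is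
nonnegative. -/
lemma IsEigenmeasure.isConformal {hf : IsHolder f} {hs : IsSummable f}
    {m : ProbabilityMeasure (Subshift A)} {c : ℝ} (h : IsEigenmeasure f hf hs m c) :
    0 ≤ c ∧ IsConformal f 1 (ENNReal.ofReal c) (m : Measure (Subshift A)) := by
  have hpos : ∀ g : Subshift A →ᵇ ℝ, (∀ ω, 0 ≤ g ω) → ∀ ω, 0 ≤ perronFrobenius f hf hs g ω :=
    fun g hg ω => tsum_nonneg fun e => transferTerm_nonneg hg e ω
  have hc : 0 ≤ c := by
    have h1 := h.integral_eq (BoundedContinuousFunction.const _ 1)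
    have h2 : 0 ≤ ∫ ω, perronFrobenius f hf hs (BoundedContinuousFunction.const _ 1) ω
        ∂(m : Measure (Subshift A)) :=
      integral_nonneg (hpos _ fun _ => zero_le_one)
    rw [h1] at h2
    simpa using h2
  refine ⟨hc, isConformal_of_boundedContinuous hf ENNReal.ofReal_ne_top fun g => ?_⟩
  rw [lintegral_toRealFun, ← ENNReal.ofReal_mul hc, ← h.integral_eq,
    ofReal_integral_eq_lintegral_ofReal ((perronFrobenius f hf hs (toRealFun g)).integrable _)
      (ae_of_all _ (hpos _ (toRealFun_nonneg g)))]
  refine lintegral_congr fun ω => ?_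
  rw [ofReal_perronFrobenius hf hs (toRealFun_nonneg g)]
  simp_rw [ofReal_toRealFun]

lemma IsConformal.isEigenmeasure {hf : IsHolder f} {hs : IsSummable f}
    {m : ProbabilityMeasure (Subshift A)} {c : ℝ} (hc : 0 ≤ c)
    (h : IsConformal f 1 (ENNReal.ofReal c) (m : Measure (Subshift A))) :
    IsEigenmeasure f hf hs m c := by
  set φ := conjPerronFrobenius f hf hs (integralFunctional m) with hφ
  set ψ := c • integralFunctional m with hψ
  have hpos : ∀ g : Subshift A →ᵇ ℝ, (∀ ω, 0 ≤ g ω) → φ g = ψ g := by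
    intro g hg
    have hgm : Measurable fun ω => ENNReal.ofReal (g ω) := g.continuous.measurable.ennreal_ofReal
    have h1 := h _ hgm
    change ∫ ω, perronFrobenius f hf hs g ω ∂(m : Measure (Subshift A)) =
      c * ∫ ω, g ω ∂(m : Measure (Subshift A))
    have h2 : ∀ ω, 0 ≤ perronFrobenius f hf hs g ω :=
      fun ω => tsum_nonneg fun e => transferTerm_nonneg hg e ω
    rw [integral_eq_lintegral_of_nonneg_ae (ae_of_all _ h2)
      (perronFrobenius f hf hs g).continuous.aestronglyMeasurable,
      integral_eq_lintegral_of_nonneg_ae (ae_of_all _ hg) g.continuous.aestronglyMeasurable]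
    simp_rw [ofReal_perronFrobenius hf hs hg]
    rw [h1, ENNReal.toReal_mul, ENNReal.toReal_ofReal hc]
  refine ContinuousLinearMap.ext fun g => ?_
  -- Adding the constant `‖g‖` makes `g` nonnegative, and linearity removes it again.
  have h1 := hpos (g + BoundedContinuousFunction.const _ ‖g‖) fun ω => by
    have := neg_abs_le (g ω)
    have := g.norm_coe_le_norm ω
    rw [Real.norm_eq_abs] at this
    simp only [BoundedContinuousFunction.add_apply, BoundedContinuousFunction.const_apply]
    linarith
  have h2 := hpos (BoundedContinuousFunction.const _ ‖g‖) fun ω => norm_nonneg g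
  rw [map_add, map_add, h2] at h1
  exact add_right_cancel h1

end Existence

end MarkovShift

namespace MarkovShift

/-! ### Construction of the eigenmeasure from Abel sums. -/

section Existence

variable {E : Type*} {A : E → E → Fin 2} [TopologicalSpace E] [DiscreteTopology E]
  [Countable E] [MeasurableSpace E] [BorelSpace E] {f : Subshift A → ℝ}

/-- The Abel sum `∑ s^n (ℒ_f^*)^n δ_τ`. -/
def abelSum (f : Subshift A → ℝ) (τ : Subshift A) (s : ℝ≥0∞) : Measure (Subshift A) :=
  Measure.sum fun n : ℕ => s ^ n • trKernel f n τ

lemma lintegral_abelSum (τ : Subshift A) (s : ℝ≥0∞) {g : Subshift A → ℝ≥0∞}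
    (hg : Measurable g) : ∫⁻ ω, g ω ∂(abelSum f τ s) = ∑' n, s ^ n * tr f n g τ := by
  rw [abelSum, lintegral_sum_measure]
  refine tsum_congr fun n => ?_
  rw [lintegral_smul_measure, lintegral_trKernel n τ hg, smul_eq_mul]

lemma abelSum_univ (τ : Subshift A) (s : ℝ≥0∞) :
    abelSum f τ s Set.univ = ∑' n, s ^ n * tr f n 1 τ := by
  rw [← lintegral_abelSum τ s measurable_one]
  simp

/-- Applying `s ℒ^*` to the geometric series drops its term of index `0`, which is `δ_τ`; so the
Abel sum is conformal up to one point mass. -/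
lemma lintegral_tr_abelSum (hf : Measurable f) (τ : Subshift A) (s : ℝ≥0∞)
    {g : Subshift A → ℝ≥0∞} (hg : Measurable g) :
    s * ∫⁻ ω, tr f 1 g ω ∂(abelSum f τ s) + g τ = ∫⁻ ω, g ω ∂(abelSum f τ s) := by
  rw [lintegral_abelSum τ s hg, lintegral_abelSum τ s (measurable_tr hf 1 hg),
    tsum_eq_zero_add' (f := fun n => s ^ n * tr f n g τ) ENNReal.summable, tr_zero, pow_zero, one_mul, add_comm,
    ← ENNReal.tsum_mul_left]
  congr 1
  refine tsum_congr fun n => ?_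
  rw [add_comm n 1, tr_add, pow_add, pow_one, mul_assoc]

/-- After `k` applications of the operator the `k`-th coordinate has become the first, where the
one-step bound applies. -/
lemma tr_coord_le (F : Set E) (k : ℕ) (τ : Subshift A) :
    tr f (k + 1) ({ω : Subshift A | ω.1 k ∈ F}.indicator 1) τ ≤
      (∑' e, theta f e) ^ k * ∑' e : F, theta f e := by
  set h : Subshift A → ℝ≥0∞ := {ω : Subshift A | ω.1 0 ∈ F}.indicator 1
  have h1 : ({ω : Subshift A | ω.1 k ∈ F}.indicator 1 : Subshift A → ℝ≥0∞) =
      fun ω => h (shift^[k] ω) * (1 : Subshift A → ℝ≥0∞) ω := by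
    funext ω
    have h2 : (shift^[k] ω).1 0 = ω.1 k := by rw [iterate_shift_apply, zero_add]
    by_cases hω : ω.1 k ∈ F <;> simp [h, Set.indicator, h2, hω]
  have h3 : tr f k ({ω : Subshift A | ω.1 k ∈ F}.indicator 1) ≤
      fun ω => (∑' e, theta f e) ^ k * h ω := by
    intro ω
    rw [h1, tr_comp_mul, mul_comm]
    exact mul_le_mul_left (tr_iterate_le k ω) _
  rw [tr_add]
  refine (tr_mono h3 τ).trans ?_
  rw [tr_const_mul]
  exact mul_le_mul_right (tr_one_indicator_le F τ) _

/-- The terms with `n > k` gain the tail factor from `tr_coord_le`. The factor `abelSum f τ s univ`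
disappears on normalisation, so the resulting bound is uniform for bounded `s`. -/
lemma abelSum_coord_le (τ : Subshift A) (s : ℝ≥0∞) (F : Set E) (k : ℕ)
    (hF : ∀ i ≤ k, τ.1 i ∉ F) :
    abelSum f τ s {ω | ω.1 k ∈ F} ≤
      s ^ (k + 1) * ((∑' e, theta f e) ^ k * ∑' e : F, theta f e) * abelSum f τ s Set.univ := by
  have hmeas : MeasurableSet {ω : Subshift A | ω.1 k ∈ F} :=
    ((isOpen_discrete F).preimage (continuous_coord k)).measurableSet
  rw [← lintegral_indicator_one hmeas, lintegral_abelSum τ s (measurable_one.indicator hmeas),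
    abelSum_univ, ← ENNReal.summable.sum_add_tsum_nat_add' (k := k + 1),
    Finset.sum_eq_zero, zero_add, ← ENNReal.tsum_mul_left]
  · refine ENNReal.tsum_le_tsum fun n => ?_
    rw [add_comm n (k + 1), tr_add, pow_add]
    calc _ ≤ s ^ (k + 1) * s ^ n *
          ((∑' e, theta f e) ^ k * (∑' e : F, theta f e) * tr f n 1 τ) := by
          gcongr
          exact tr_le_const_mul (fun ω => tr_coord_le F k ω) τ
      _ = _ := by ring
  -- For `n ≤ k` the `k`-th coordinate of a preimage is `τ.1 (k - n)`, which is outside `F` by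
  -- assumption; these terms vanish.
  · intro n hn
    rw [Finset.mem_range] at hn
    have h1 : ({ω : Subshift A | ω.1 k ∈ F}.indicator 1 : Subshift A → ℝ≥0∞) = fun ω =>
        {ω : Subshift A | ω.1 (k - n) ∈ F}.indicator 1 (shift^[n] ω) *
          (1 : Subshift A → ℝ≥0∞) ω := by
      funext ω
      have h2 : (shift^[n] ω).1 (k - n) = ω.1 k := by
        rw [iterate_shift_apply, Nat.sub_add_cancel (by omega)]
      by_cases hω : ω.1 k ∈ F <;> simp [Set.indicator, h2, hω]
    have h3 : τ ∉ {ω : Subshift A | ω.1 (k - n) ∈ F} := hF _ (Nat.sub_le _ _)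
    rw [h1, tr_comp_mul, Set.indicator_of_notMem h3]
    simp

lemma theta_tsum_ne_top (hs : IsSummable f) : ∑' e, theta f e ≠ ⊤ := hs.ne

/-- Comparability and the upper bound `θ^j` for `ℒ^j 1` bound `ℒ 1` below by a positive constant;
iteration does the rest. This keeps the radius of convergence finite. -/
lemma exists_pow_le_tr (hs : IsSummable f) [Nonempty (Subshift A)] {q : ℕ} {M : ℝ≥0∞}
    (hM : M ≠ ⊤) (h : ∀ (n : ℕ) (ω τ : Subshift A),
      tr f n 1 ω ≤ M * ∑ j ∈ Finset.range (q + 1), tr f (n + j) 1 τ) :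
    ∃ c : ℝ≥0∞, c ≠ 0 ∧ ∀ n (τ : Subshift A), c ^ n ≤ tr f n 1 τ := by
  obtain ⟨ω⟩ := ‹Nonempty (Subshift A)›
  set θ := ∑' e, theta f e with hθ
  set C := M * ∑ j ∈ Finset.range (q + 1), θ ^ j with hC
  have hCt : C ≠ ⊤ := ENNReal.mul_ne_top hM
    (ENNReal.sum_ne_top.2 fun j _ => ENNReal.pow_ne_top (theta_tsum_ne_top hs))
  have h1 : ∀ τ, weight f 1 ω ≤ C * tr f 1 1 τ := by
    intro τ
    have h2 := le_tr (f := f) (g := 1) (rfl : shift^[1] ω = shift^[1] ω)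
    rw [Pi.one_apply, mul_one] at h2
    refine h2.trans ((h 1 _ τ).trans ?_)
    rw [hC, mul_assoc, Finset.sum_mul]
    refine mul_le_mul_right (Finset.sum_le_sum fun j _ => ?_) _
    rw [add_comm 1 j, tr_add]
    exact tr_le_const_mul (fun ω => tr_iterate_le j ω) τ
  refine ⟨weight f 1 ω / C, ENNReal.div_ne_zero.2 ⟨(weight_pos f 1 ω).ne', hCt⟩, fun n => ?_⟩
  have h2 : ∀ τ, weight f 1 ω / C ≤ tr f 1 1 τ := fun τ =>
    ENNReal.div_le_of_le_mul (by rw [mul_comm]; exact h1 τ)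
  induction n with
  | zero => intro τ; simp [tr_zero]
  | succ n ih =>
    intro τ
    rw [tr_add, pow_succ]
    refine (mul_le_mul_right (h2 τ) _).trans ?_
    rw [← tr_const_mul]
    exact tr_mono (fun ω' => by simpa using ih ω') τ

/-- The conjugate of the Perron–Frobenius operator has a probability eigenmeasure. -/
lemma exists_isConformal (hf : IsHolder f) (hs : IsSummable f) (hd : Connecting A 1)
    [Nonempty (Subshift A)] : ∃ (m : ProbabilityMeasure (Subshift A)) (c : ℝ≥0∞), c ≠ 0 ∧ c ≠ ⊤ ∧
      IsConformal f 1 c (m : Measure (Subshift A)) := by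
  have hfm := hf.continuous.measurable
  obtain ⟨q, M, hM, hq⟩ := exists_weight_le_tr_cyl hf hd
  have hcomp := tr_le_sum_tr hq
  obtain ⟨c, hc0, hc⟩ := exists_pow_le_tr hs hM hcomp
  obtain ⟨τ⟩ := ‹Nonempty (Subshift A)›
  set θ := ∑' e, theta f e with hθ
  have hθt : θ ≠ ⊤ := theta_tsum_ne_top hs
  obtain ⟨R, hR0, hRt, hRlt, hReq⟩ := exists_critical_exponent (a := fun n => tr f n 1 τ)
    (b := fun n => ⨆ ω, tr f n 1 ω) (fun n => le_iSup (fun ω => tr f n 1 ω) τ)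
    (fun m n => iSup_le fun ω => by
      rw [tr_add]
      refine (tr_le_const_mul (fun ω' => le_iSup (fun ω => tr f m 1 ω) ω') ω).trans ?_
      exact mul_le_mul_right (le_iSup (fun ω => tr f n 1 ω) ω) _)
    hθt (fun n => iSup_le fun ω => tr_iterate_le n ω) hM
    (fun n => iSup_le fun ω => hcomp n ω τ) hc0 (fun n => hc n τ)
  have hat : ∀ n, tr f n 1 τ ≠ ⊤ := fun n =>
    ne_top_of_le_ne_top (ENNReal.pow_ne_top hθt) (tr_iterate_le n τ)
  obtain ⟨s, -, hsR, hslim⟩ := exists_seq_strictMono_tendsto' (pos_iff_ne_zero.2 hR0)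
  set D : ℕ → ℝ≥0∞ := fun k => abelSum f τ (s k) Set.univ with hD
  have hDt : ∀ k, D k ≠ ⊤ := fun k => by
    rw [hD]
    simp only [abelSum_univ]
    exact hRlt _ (hsR k).2
  have hD1 : ∀ k, D k ≠ 0 := fun k => by
    have h1 : (s k) ^ 0 * tr f 0 1 τ ≤ D k := by
      rw [hD]
      simp only [abelSum_univ]
      exact ENNReal.le_tsum (f := fun n => (s k) ^ n * tr f n 1 τ) 0
    intro h0
    rw [h0, tr_zero] at h1
    simp at h1
  have hDlim : Tendsto D atTop (𝓝 ⊤) := by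
    have := tendsto_tsum_pow_mul hat hReq hslim
    simpa only [hD, abelSum_univ] using this
  have hprob : ∀ k, IsProbabilityMeasure ((D k)⁻¹ • abelSum f τ (s k)) := fun k => ⟨by
    rw [Measure.smul_apply, smul_eq_mul, ENNReal.inv_mul_cancel (hD1 k) (hDt k)]⟩
  set u : ℕ → ProbabilityMeasure (Subshift A) :=
    fun k => ⟨(D k)⁻¹ • abelSum f τ (s k), hprob k⟩ with hu
  have htight : IsTightMeasureSet (Set.range fun n => (u n : Measure (Subshift A))) := by
    refine isTight_of_coord fun k ε hε => ?_
    have h1 := ENNReal.tendsto_tsum_compl_atTop_zero hθt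
    have h2 : Tendsto (fun F : Finset E => R ^ (k + 1) * (θ ^ k *
        ∑' e : {e // e ∉ F}, theta f e)) atTop (𝓝 (R ^ (k + 1) * (θ ^ k * 0))) :=
      ENNReal.Tendsto.const_mul (ENNReal.Tendsto.const_mul h1
        (Or.inr (ENNReal.pow_ne_top hθt))) (Or.inr (ENNReal.pow_ne_top hRt))
    rw [mul_zero, mul_zero] at h2
    classical
    -- `F` must also contain the first `k + 1` letters of `τ`, so that the terms of index at most
    -- `k` contribute nothing outside `F`.
    obtain ⟨F, hF1, hF2⟩ := ((h2.eventually_lt_const hε).and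
      (eventually_ge_atTop ((Finset.range (k + 1)).image τ.1))).exists
    refine ⟨F, ?_⟩
    rintro _ ⟨n, rfl⟩
    have h3 := abelSum_coord_le (f := f) τ (s n) {e | e ∉ F} k fun i hi => by
      have : τ.1 i ∈ F := hF2 (Finset.mem_image_of_mem _ (Finset.mem_range.2 (by omega)))
      simpa using this
    change ((D n)⁻¹ • abelSum f τ (s n)) {ω | ω.1 k ∈ {e | e ∉ F}} ≤ ε
    rw [Measure.smul_apply, smul_eq_mul]
    calc _ ≤ (D n)⁻¹ * (R ^ (k + 1) * (θ ^ k * ∑' e : {e // e ∉ F}, theta f e) * D n) := by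
          refine mul_le_mul_right (h3.trans ?_) _
          refine mul_le_mul_left (mul_le_mul_left ?_ _) _
          exact pow_le_pow_left' (hsR n).2.le _
      _ = ((D n)⁻¹ * D n) * (R ^ (k + 1) * (θ ^ k * ∑' e : {e // e ∉ F}, theta f e)) := by ring
      _ ≤ ε := by
          rw [ENNReal.inv_mul_cancel (hD1 n) (hDt n), one_mul]
          exact hF1.le
  obtain ⟨m, hm⟩ := exists_tendsto_of_isTight htight
  refine ⟨m, R⁻¹, ENNReal.inv_ne_zero.2 hRt, ENNReal.inv_ne_top.2 hR0,
    isConformal_of_boundedContinuous hf (ENNReal.inv_ne_top.2 hR0) fun g => ?_⟩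
  have hgm : Measurable fun τ => (g τ : ℝ≥0∞) :=
    measurable_coe_nnreal_ennreal.comp g.continuous.measurable
  have hlim := (ProbabilityMeasure.tendsto_iff_forall_lintegral_tendsto.1 hm)
  have h1 := hlim g
  have h2 := hlim (perronFrobenius f hf hs (toRealFun g)).nnrealPart
  have h2t := (BoundedContinuousFunction.lintegral_lt_top_of_nnreal (m : Measure (Subshift A))
    (perronFrobenius f hf hs (toRealFun g)).nnrealPart).ne
  simp_rw [coe_nnrealPart_perronFrobenius] at h2 h2t
  -- The point mass at `τ` enters with the factor `(D k)⁻¹`, which tends to `0` because the series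
  -- diverges at `R`.
  have h3 : ∀ k, s k * ∫⁻ ω, tr f 1 (fun τ => (g τ : ℝ≥0∞)) ω ∂(u k : Measure (Subshift A)) +
      (D k)⁻¹ * g τ = ∫⁻ ω, g ω ∂(u k : Measure (Subshift A)) := by
    intro k
    have h4 := lintegral_tr_abelSum hfm τ (s k) hgm
    change s k * ∫⁻ ω, tr f 1 (fun τ => (g τ : ℝ≥0∞)) ω ∂((D k)⁻¹ • abelSum f τ (s k)) +
      (D k)⁻¹ * g τ = ∫⁻ ω, g ω ∂((D k)⁻¹ • abelSum f τ (s k))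
    rw [lintegral_smul_measure, lintegral_smul_measure, ← h4, smul_eq_mul, smul_eq_mul]
    ring
  have hle := Nat.hyperfilter_le_atTop
  have h5 : Tendsto (fun k => (D k)⁻¹ * (g τ : ℝ≥0∞)) atTop (𝓝 (⊤⁻¹ * g τ)) :=
    ENNReal.Tendsto.mul_const (tendsto_inv_iff.2 hDlim) (Or.inr ENNReal.coe_ne_top)
  have h6 := (ENNReal.Tendsto.mul (hslim.mono_left hle) (Or.inl hR0) h2 (Or.inr hRt)).add
    (h5.mono_left hle)
  simp_rw [h3] at h6
  have h7 := tendsto_nhds_unique h1 h6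
  rw [ENNReal.inv_top, zero_mul, add_zero] at h7
  rw [h7, ← mul_assoc, ENNReal.inv_mul_cancel hR0 hRt, one_mul]

end Existence

end MarkovShift

namespace MarkovShift

/-! ### Gibbs states and the pressure. -/

section Gibbs

variable {E : Type*} {A : E → E → Fin 2} [TopologicalSpace E] [DiscreteTopology E]
  [Countable E] [MeasurableSpace E] [BorelSpace E] {f : Subshift A → ℝ}

/-- The Gibbs property with given constants, in terms of the cylinders around points. -/
def GibbsBounds (f : Subshift A → ℝ) (μ : Measure (Subshift A)) (Q P : ℝ) : Prop :=
  1 ≤ Q ∧ ∀ (n : ℕ) (τ : Subshift A),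
    Q⁻¹ * Real.exp (birkhoffSum shift f n τ - P * n) ≤ μ.real (cyl n τ) ∧
      μ.real (cyl n τ) ≤ Q * Real.exp (birkhoffSum shift f n τ - P * n)

/-- A nonempty cylinder is the cylinder around any of its points, and words with empty cylinder
carry no condition, so indexing by points loses nothing. -/
lemma isGibbs_iff {m : ProbabilityMeasure (Subshift A)} :
    IsGibbs f m ↔ ∃ Q P, GibbsBounds f (m : Measure (Subshift A)) Q P := by
  constructor
  · rintro ⟨Q, hQ, P, h⟩
    refine ⟨Q, P, hQ, fun n τ => ?_⟩
    have h1 := h _ (admissible_ofFn n τ) τ (mem_cylinder_ofFn n τ)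
    rw [cylinder_eq_cyl (mem_cylinder_ofFn n τ), List.length_ofFn] at h1
    rwa [le_div_iff₀ (Real.exp_pos _), div_le_iff₀ (Real.exp_pos _)] at h1
  · rintro ⟨Q, P, hQ, h⟩
    refine ⟨Q, hQ, P, fun w _ τ hτ => ?_⟩
    rw [cylinder_eq_cyl hτ, le_div_iff₀ (Real.exp_pos _), div_le_iff₀ (Real.exp_pos _)]
    exact h _ τ

lemma GibbsBounds.mono_of_le {m μ : Measure (Subshift A)} [IsFiniteMeasure m] [IsFiniteMeasure μ]
    {Q P : ℝ} (h : GibbsBounds f m Q P) {C : ℝ≥0∞} (hC : C ≠ ⊤) (h1 : μ ≤ C • m)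
    (h2 : m ≤ C • μ) : ∃ Q', GibbsBounds f μ Q' P := by
  obtain ⟨hQ, h⟩ := h
  have h1' : ∀ n τ, μ.real (cyl n τ) ≤ C.toReal * m.real (cyl n τ) := by
    intro n τ
    rw [measureReal_def, measureReal_def, ← ENNReal.toReal_mul]
    exact ENNReal.toReal_mono (ENNReal.mul_ne_top hC (measure_ne_top _ _)) (h1 _)
  have h2' : ∀ n τ, m.real (cyl n τ) ≤ C.toReal * μ.real (cyl n τ) := by
    intro n τ
    rw [measureReal_def, measureReal_def, ← ENNReal.toReal_mul]
    exact ENNReal.toReal_mono (ENNReal.mul_ne_top hC (measure_ne_top _ _)) (h2 _)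
  have hQ0 : 0 < Q := by linarith
  set D := max 1 C.toReal
  have hD : 1 ≤ D := le_max_left _ _
  have hCD : C.toReal ≤ D := le_max_right _ _
  refine ⟨D * Q, by nlinarith, fun n τ => ⟨?_, ?_⟩⟩
  · rw [mul_inv, mul_assoc, inv_mul_le_iff₀ (by linarith)]
    refine (h n τ).1.trans ((h2' n τ).trans ?_)
    gcongr
  · rw [mul_assoc]
    refine (h1' n τ).trans ?_
    gcongr
    exact (h n τ).2

/-- The two pointwise estimates for `ℒ^n` on cylinders, integrated against `m`, where `ℒ^n`
contributes the factor `c^n`. -/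
lemma IsConformal.gibbsBounds (hf : IsHolder f) (hd : Connecting A 1) {c : ℝ≥0∞} (hc0 : c ≠ 0)
    (hc : c ≠ ⊤) {m : Measure (Subshift A)} [IsProbabilityMeasure m] (hm : IsConformal f 1 c m) :
    ∃ Q, GibbsBounds f m Q (Real.log c.toReal) := by
  obtain ⟨K, hK, h1⟩ := hf.exists_measure_cyl_le
  obtain ⟨M, hM, h2⟩ := hf.exists_le_measure_cyl hd hc
  have hcr : 0 < c.toReal := ENNReal.toReal_pos hc0 hc
  rw [← pow_one c] at hm
  have hexp : ∀ (n : ℕ) (τ : Subshift A), Real.exp (birkhoffSum shift f n τ -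
      Real.log c.toReal * n) = Real.exp (birkhoffSum shift f n τ) / c.toReal ^ n := by
    intro n τ
    rw [Real.exp_sub, mul_comm, Real.exp_nat_mul, Real.exp_log hcr]
  set Q := max 1 (max K.toReal M.toReal)
  have hQ1 : 1 ≤ Q := le_max_left _ _
  have hKQ : K.toReal ≤ Q := (le_max_left _ _).trans (le_max_right _ _)
  have hMQ : M.toReal ≤ Q := (le_max_right _ _).trans (le_max_right _ _)
  refine ⟨Q, hQ1, fun n τ => ?_⟩
  rw [hexp]
  constructor
  · have h3 := h2 m hm n (one_dvd n) τ
    rw [measure_univ, mul_one] at h3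
    have h4 := ENNReal.toReal_mono (ENNReal.mul_ne_top hM (ENNReal.mul_ne_top
      (ENNReal.pow_ne_top hc) (measure_ne_top _ _))) h3
    rw [weight, ENNReal.toReal_ofReal (Real.exp_pos _).le, ENNReal.toReal_mul,
      ENNReal.toReal_mul, ENNReal.toReal_pow] at h4
    rw [inv_mul_le_iff₀ (by linarith), div_le_iff₀ (by positivity)]
    refine h4.trans (le_of_le_of_eq (mul_le_mul_of_nonneg_right hMQ (by positivity)) ?_)
    rw [measureReal_def]; ring
  · have h3 := h1 m n _ (hm.of_dvd hf.continuous.measurable (one_dvd n)) τ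
    rw [measure_univ, mul_one] at h3
    have h4 := ENNReal.toReal_mono (ENNReal.mul_ne_top hK (weight_ne_top f n τ)) h3
    rw [weight, ENNReal.toReal_mul, ENNReal.toReal_mul, ENNReal.toReal_pow,
      ENNReal.toReal_ofReal (Real.exp_pos _).le] at h4
    rw [mul_div_assoc', le_div_iff₀ (by positivity), mul_comm, measureReal_def]
    exact h4.trans (mul_le_mul_of_nonneg_right hKQ (Real.exp_pos _).le)

/-- With eigenvalue `0` the lower Gibbs bound would force `exp (f ω) = 0`. -/
lemma IsConformal.ne_zero (hf : IsHolder f) (hd : Connecting A 1) {c : ℝ≥0∞}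
    (hc : c ≠ ⊤) {m : Measure (Subshift A)} [IsProbabilityMeasure m] [Nonempty (Subshift A)]
    (hm : IsConformal f 1 c m) : c ≠ 0 := by
  rintro rfl
  obtain ⟨ω⟩ := ‹Nonempty (Subshift A)›
  obtain ⟨M, hM, h⟩ := hf.exists_le_measure_cyl hd hc
  have h1 := h m (by rwa [pow_one]) 1 (one_dvd 1) ω
  simp only [measure_univ, mul_one, pow_one, zero_mul, mul_zero, nonpos_iff_eq_zero] at h1
  exact (weight_pos f 1 ω).ne' h1

lemma tsum_measure_cylinder (m : Measure (Subshift A)) [IsProbabilityMeasure m] (n : ℕ) :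
    ∑' w : AdmissibleWord A n, m (cylinder A w.1) = 1 := by
  have hmeas : ∀ w : AdmissibleWord A n, MeasurableSet (cylinder A w.1) := by
    intro w
    have : cylinder A w.1 = ⋂ (i : ℕ) (hi : i < w.1.length), {τ | τ.1 i = w.1[i]} := by
      ext τ; simp [cylinder]
    rw [this]
    exact MeasurableSet.iInter fun i => MeasurableSet.iInter fun hi =>
      measurable_coord i (measurableSet_singleton _)
  rw [← measure_iUnion _ hmeas]
  · have : ⋃ w : AdmissibleWord A n, cylinder A w.1 = Set.univ := by
      refine Set.eq_univ_of_forall fun τ => Set.mem_iUnion.2 ?_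
      exact ⟨⟨List.ofFn (block n τ), List.length_ofFn, admissible_ofFn n τ⟩, mem_cylinder_ofFn n τ⟩
    rw [this, measure_univ]
  · intro w w' hne
    refine Set.disjoint_left.2 fun τ h1 h2 => hne (Subtype.ext ?_)
    refine List.ext_getElem (w.2.1.trans w'.2.1.symm) fun i hi hi' => ?_
    exact (h1 i hi).symm.trans (h2 i hi')

/-- Term by term `Z_n` agrees with `exp (P n) m([w])` up to the factor `Q`, and the masses of the
cylinders sum to one. -/
lemma GibbsBounds.partitionFunction_bounds {m : Measure (Subshift A)} [IsProbabilityMeasure m]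
    {Q P : ℝ} (h : GibbsBounds f m Q P) (n : ℕ) :
    ENNReal.ofReal (Real.exp (P * n - Real.log Q)) ≤ partitionFunction f n ∧
      partitionFunction f n ≤ ENNReal.ofReal (Real.exp (P * n + Real.log Q)) := by
  obtain ⟨hQ, h⟩ := h
  have hQ0 : 0 < Q := by linarith
  set z : AdmissibleWord A n → ℝ≥0∞ := fun w =>
    EReal.exp (⨆ τ ∈ cylinder A w.1, ((birkhoffSum shift f n τ : ℝ) : EReal)) with hz
  have hcyl : ∀ (w : AdmissibleWord A n) τ, τ ∈ cylinder A w.1 → cylinder A w.1 = cyl n τ := by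
    intro w τ hτ
    rw [cylinder_eq_cyl hτ, w.2.1]
  constructor
  · have h1 : ∀ w, ENNReal.ofReal (Real.exp (P * n - Real.log Q)) * m (cylinder A w.1) ≤ z w := by
      intro w
      rcases (cylinder A w.1).eq_empty_or_nonempty with h0 | ⟨τ, hτ⟩
      · rw [h0]; simp
      · have h2 : ENNReal.ofReal (Real.exp (birkhoffSum shift f n τ)) ≤ z w := by
          rw [← EReal.exp_coe]
          exact EReal.exp_monotone (le_iSup₂
            (f := fun τ (_ : τ ∈ cylinder A w.1) => ((birkhoffSum shift f n τ : ℝ) : EReal)) τ hτ)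
        refine le_trans ?_ h2
        rw [hcyl w τ hτ, ← ofReal_measureReal (measure_ne_top m _),
          ← ENNReal.ofReal_mul (Real.exp_pos _).le]
        refine ENNReal.ofReal_le_ofReal ?_
        refine (mul_le_mul_of_nonneg_left (h n τ).2 (Real.exp_pos _).le).trans (le_of_eq ?_)
        rw [Real.exp_sub, Real.exp_sub, Real.exp_log hQ0]
        field_simp
    have h2 := ENNReal.tsum_le_tsum h1
    rwa [ENNReal.tsum_mul_left, tsum_measure_cylinder, mul_one] at h2
  · have h1 : ∀ w, z w ≤ ENNReal.ofReal (Real.exp (P * n + Real.log Q)) * m (cylinder A w.1) := by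
      intro w
      -- The bound is written as the exponential of its logarithm, so that the supremum is estimated
      -- inside; empty cylinders, with supremum `⊥`, are covered vacuously.
      refine le_of_le_of_eq (EReal.exp_monotone (iSup₂_le fun τ hτ => ?_))
        (ENNReal.exp_log (ENNReal.ofReal (Real.exp (P * n + Real.log Q)) * m (cylinder A w.1)))
      rw [← EReal.log_exp ((birkhoffSum shift f n τ : ℝ) : EReal)]
      refine ENNReal.log_monotone ?_
      rw [EReal.exp_coe, hcyl w τ hτ, ← ofReal_measureReal (measure_ne_top m _),
        ← ENNReal.ofReal_mul (Real.exp_pos _).le]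
      refine ENNReal.ofReal_le_ofReal ?_
      refine le_trans (le_of_eq ?_) (mul_le_mul_of_nonneg_left (h n τ).1 (Real.exp_pos _).le)
      rw [Real.exp_add, Real.exp_sub, Real.exp_log hQ0]
      field_simp
    have h2 := ENNReal.tsum_le_tsum h1
    rwa [ENNReal.tsum_mul_left, tsum_measure_cylinder, mul_one] at h2

lemma GibbsBounds.tendsto_pressure {m : Measure (Subshift A)} [IsProbabilityMeasure m]
    {Q P : ℝ} (h : GibbsBounds f m Q P) :
    Tendsto (fun n : ℕ => ENNReal.log (partitionFunction f n) / (n : EReal))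
      atTop (𝓝 (P : EReal)) := by
  have hlim : ∀ a : ℝ, Tendsto (fun n : ℕ => (((P * n + a) / n : ℝ) : EReal)) atTop
      (𝓝 (P : EReal)) := by
    intro a
    refine (continuous_coe_real_ereal.tendsto P).comp ?_
    have h1 : Tendsto (fun n : ℕ => P + a / n) atTop (𝓝 (P + 0)) :=
      tendsto_const_nhds.add (tendsto_const_div_atTop_nhds_zero_nat a)
    rw [add_zero] at h1
    refine h1.congr' ?_
    filter_upwards [eventually_ge_atTop 1] with n hn
    have : (n : ℝ) ≠ 0 := by positivity
    field_simp
  have hlog : ∀ x : ℝ, ENNReal.log (ENNReal.ofReal (Real.exp x)) = (x : EReal) := by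
    intro x
    rw [← EReal.exp_coe, EReal.log_exp]
  refine tendsto_of_tendsto_of_tendsto_of_le_of_le (hlim (-Real.log Q)) (hlim (Real.log Q))
    (fun n => ?_) (fun n => ?_)
  · have h1 := ENNReal.log_monotone (h.partitionFunction_bounds n).1
    rw [hlog] at h1
    have h2 := EReal.div_le_div_right_of_nonneg (c := (n : EReal)) (by positivity) h1
    refine le_trans (le_of_eq ?_) h2
    rw [EReal.coe_div, ← sub_eq_add_neg]
    rfl
  · have h1 := ENNReal.log_monotone (h.partitionFunction_bounds n).2
    rw [hlog] at h1
    have h2 := EReal.div_le_div_right_of_nonneg (c := (n : EReal)) (by positivity) h1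
    refine le_trans h2 (le_of_eq ?_)
    rw [EReal.coe_div]
    rfl

lemma GibbsBounds.pressure_eq {m : Measure (Subshift A)} [IsProbabilityMeasure m]
    {Q P : ℝ} (h : GibbsBounds f m Q P) : pressure f = (P : EReal) :=
  h.tendsto_pressure.limsup_eq

/-- Both constants equal the pressure, which depends on `f` alone. -/
lemma GibbsBounds.unique {m m' : Measure (Subshift A)} [IsProbabilityMeasure m]
    [IsProbabilityMeasure m'] {Q P Q' P' : ℝ} (h : GibbsBounds f m Q P)
    (h' : GibbsBounds f m' Q' P') : P' = P :=
  EReal.coe_injective (h'.pressure_eq.symm.trans h.pressure_eq)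

lemma GibbsBounds.le {m m' : Measure (Subshift A)} [IsProbabilityMeasure m]
    [IsProbabilityMeasure m'] {Q Q' P : ℝ} (h : GibbsBounds f m Q P)
    (h' : GibbsBounds f m' Q' P) : m' ≤ ENNReal.ofReal (Q' * Q) • m := by
  have hQ := h.1
  have hQ' := h'.1
  have : IsFiniteMeasure (ENNReal.ofReal (Q' * Q) • m) := m.smul_finite ENNReal.ofReal_ne_top
  refine le_of_cyl_le le_rfl fun n _ τ => ?_
  rw [Measure.smul_apply, smul_eq_mul, ← ofReal_measureReal (measure_ne_top m _),
    ← ofReal_measureReal (measure_ne_top m' _), ← ENNReal.ofReal_mul (by positivity)]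
  refine ENNReal.ofReal_le_ofReal ((h'.2 n τ).2.trans ?_)
  have h1 := (h.2 n τ).1
  rw [inv_mul_le_iff₀ (by linarith)] at h1
  rw [mul_assoc]
  gcongr

end Gibbs

end MarkovShift

namespace MarkovShift

/-! ### The invariant Gibbs state, its density, and primitivity. -/

section Invariant

variable {E : Type*} {A : E → E → Fin 2} [TopologicalSpace E] [DiscreteTopology E]
  [Countable E] [MeasurableSpace E] [BorelSpace E] {f : Subshift A → ℝ}

lemma IsConformal.pow_mul_measure_preimage {c : ℝ≥0∞} {m : Measure (Subshift A)} {k : ℕ}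
    (hm : IsConformal f k (c ^ k) m) {B : Set (Subshift A)} (hB : MeasurableSet B) :
    c ^ k * m (shift^[k] ⁻¹' B) = ∫⁻ ω in B, tr f k 1 ω ∂m := by
  rw [← hm.lintegral_indicator (hB.preimage (measurable_shift.iterate k)),
    ← MeasureTheory.lintegral_indicator hB]
  refine lintegral_congr fun τ => ?_
  have h1 : ((shift^[k] ⁻¹' B).indicator 1 : Subshift A → ℝ≥0∞) =
      fun ω => B.indicator 1 (shift^[k] ω) * (1 : Subshift A → ℝ≥0∞) ω := by
    funext ω
    by_cases hω : shift^[k] ω ∈ B <;> simp [Set.indicator, hω]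
  rw [h1, tr_comp_mul]
  by_cases hτ : τ ∈ B <;> simp [hτ]

/-- By `pow_mul_measure_preimage` the density of `m ∘ σ^(-k)` is `c^(-k) ℒ^k 1`, so `ℒ^k 1` has to
be compared with `c^k`. The lower bound involves a sum over `j`, inherited from the varying lengths
of connecting words. -/
lemma IsConformal.exists_preimage_bounds (hf : IsHolder f) (hd : Connecting A 1) {c : ℝ≥0∞}
    (hc0 : c ≠ 0) (hc : c ≠ ⊤) {m : Measure (Subshift A)} [IsProbabilityMeasure m]
    (hm : IsConformal f 1 c m) : ∃ (q : ℕ) (C : ℝ≥0∞), C ≠ ⊤ ∧ ∀ B, MeasurableSet B → ∀ k : ℕ,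
      m (shift^[k] ⁻¹' B) ≤ C * m B ∧
        m B ≤ C * ∑ j ∈ Finset.range (q + 1), m (shift^[k + j] ⁻¹' B) := by
  have hfm := hf.continuous.measurable
  obtain ⟨q, M, hM, hq⟩ := exists_weight_le_tr_cyl hf hd
  have hcomp := tr_le_sum_tr hq
  have hm' : ∀ k, IsConformal f k (c ^ k) m := fun k =>
    IsConformal.of_dvd hfm (by rwa [pow_one]) (one_dvd k)
  set S := ∑ j ∈ Finset.range (q + 1), c ^ j
  have hmass : ∀ k, ∫⁻ ω, tr f k 1 ω ∂m = c ^ k := fun k => by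
    rw [hm' k 1 measurable_one]; simp
  have hmeas : ∀ k, Measurable (tr f k 1) := fun k => measurable_tr hfm k measurable_one
  refine ⟨q, M * S, ENNReal.mul_ne_top hM (ENNReal.sum_ne_top.2 fun j _ => ENNReal.pow_ne_top hc),
    fun B hB k => ?_⟩
  have hk0 : c ^ k ≠ 0 := pow_ne_zero k hc0
  have hkt : c ^ k ≠ ⊤ := ENNReal.pow_ne_top hc
  constructor
  -- The comparison of `ℒ^k 1(ω)` with values at `τ`, integrated in `τ`.
  · have h1 : ∀ ω, tr f k 1 ω ≤ c ^ k * (M * S) := by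
      intro ω
      have h2 : ∫⁻ _, tr f k 1 ω ∂m ≤ _ := lintegral_mono (μ := m) fun τ => hcomp k ω τ
      rw [lintegral_const, measure_univ, mul_one,
        lintegral_const_mul _ (Finset.measurable_fun_sum _ fun j _ => hmeas _),
        lintegral_finsetSum _ (fun j _ => hmeas _)] at h2
      simp_rw [hmass, pow_add] at h2
      rw [← Finset.mul_sum, mul_left_comm] at h2
      exact h2
    rw [← ENNReal.mul_le_mul_iff_right hk0 hkt, (hm' k).pow_mul_measure_preimage hB]
    refine (lintegral_mono h1).trans (le_of_eq ?_)
    rw [lintegral_const, Measure.restrict_apply MeasurableSet.univ, Set.univ_inter, mul_assoc]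
  -- The same comparison, integrated in `ω`.
  · have h1 : ∀ τ, c ^ k ≤ M * ∑ j ∈ Finset.range (q + 1), tr f (k + j) 1 τ := by
      intro τ
      rw [← hmass k]
      refine (lintegral_mono fun ω => hcomp k ω τ).trans (le_of_eq ?_)
      rw [lintegral_const, measure_univ, mul_one]
    have h2 : ∫⁻ _ in B, c ^ k ∂m ≤ _ := lintegral_mono (μ := m.restrict B) h1
    rw [lintegral_const, Measure.restrict_apply MeasurableSet.univ, Set.univ_inter,
      lintegral_const_mul _ (Finset.measurable_fun_sum _ fun j _ => hmeas _),
      lintegral_finsetSum _ (fun j _ => hmeas _)] at h2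
    simp_rw [← fun j => (hm' j).pow_mul_measure_preimage hB] at h2
    rw [← ENNReal.mul_le_mul_iff_right hk0 hkt]
    refine h2.trans ?_
    rw [Finset.mul_sum, Finset.mul_sum, Finset.mul_sum]
    refine Finset.sum_le_sum fun j hj => ?_
    have h3 : c ^ j ≤ S := Finset.single_le_sum (f := fun j => c ^ j) (fun _ _ => zero_le) hj
    calc _ = c ^ k * (M * c ^ j * m (shift^[k + j] ⁻¹' B)) := by ring
      _ ≤ _ := by gcongr

/-- The Cesàro averages of the images of `m` under the shift. -/
def cesaro (m : Measure (Subshift A)) (N : ℕ) : Measure (Subshift A) :=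
  ((N : ℝ≥0∞) + 1)⁻¹ • ∑ k ∈ Finset.range (N + 1), m.map shift^[k]

lemma cesaro_apply (m : Measure (Subshift A)) (N : ℕ) {B : Set (Subshift A)}
    (hB : MeasurableSet B) : cesaro m N B =
      ((N : ℝ≥0∞) + 1)⁻¹ * ∑ k ∈ Finset.range (N + 1), m (shift^[k] ⁻¹' B) := by
  rw [cesaro, Measure.smul_apply, Measure.finsetSum_apply, smul_eq_mul]
  congr 1
  exact Finset.sum_congr rfl fun k _ => Measure.map_apply (measurable_shift.iterate k) hB

lemma inv_succ_mul_sum_const (N : ℕ) (x : ℝ≥0∞) :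
    ((N : ℝ≥0∞) + 1)⁻¹ * ∑ _k ∈ Finset.range (N + 1), x = x := by
  rw [Finset.sum_const, Finset.card_range, nsmul_eq_mul, ← mul_assoc, Nat.cast_succ,
    ENNReal.inv_mul_cancel (by positivity) (by finiteness), one_mul]

/-- Telescoping: both sides are the normalised sum of the integrals of `g ∘ σ^k` over `0 ≤ k ≤ N +
1`. Stated with sums, since subtraction in `ℝ≥0∞` truncates. -/
lemma lintegral_cesaro_shift (m : Measure (Subshift A)) (N : ℕ) {g : Subshift A → ℝ≥0∞}
    (hg : Measurable g) :
    ∫⁻ ω, g (shift ω) ∂(cesaro m N) + ((N : ℝ≥0∞) + 1)⁻¹ * ∫⁻ ω, g ω ∂m =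
      ∫⁻ ω, g ω ∂(cesaro m N) + ((N : ℝ≥0∞) + 1)⁻¹ * ∫⁻ ω, g (shift^[N + 1] ω) ∂m := by
  have h1 : ∀ g : Subshift A → ℝ≥0∞, Measurable g → ∫⁻ ω, g ω ∂(cesaro m N) =
      ((N : ℝ≥0∞) + 1)⁻¹ * ∑ k ∈ Finset.range (N + 1), ∫⁻ ω, g (shift^[k] ω) ∂m := by
    intro g hg
    rw [cesaro, lintegral_smul_measure, lintegral_finsetSum_measure, smul_eq_mul]
    congr 1
    exact Finset.sum_congr rfl fun k _ => lintegral_map hg (measurable_shift.iterate k)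
  rw [h1 (fun ω => g (shift ω)) (hg.comp measurable_shift), h1 g hg, ← mul_add, ← mul_add,
    ← Finset.sum_range_succ (fun k => ∫⁻ ω, g (shift^[k] ω) ∂m),
    Finset.sum_range_succ' _ (N + 1)]
  simp_rw [← Function.iterate_succ_apply' shift]
  rfl

/-- Krylov–Bogoliubov for measures whose shifted images stay comparable to a fixed measure. -/
lemma exists_invariant {m m₁ : Measure (Subshift A)} [IsProbabilityMeasure m]
    [IsProbabilityMeasure m₁] {C : ℝ≥0∞} (hC : C ≠ ⊤)
    (h1 : ∀ B, MeasurableSet B → ∀ k : ℕ, m₁ (shift^[k] ⁻¹' B) ≤ C * m B)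
    (h2 : ∀ B, MeasurableSet B → ∀ k : ℕ, m B ≤ C * m₁ (shift^[k] ⁻¹' B)) :
    ∃ μ : ProbabilityMeasure (Subshift A), MeasurePreserving shift (μ : Measure (Subshift A)) μ ∧
      (μ : Measure (Subshift A)) ≤ C • m ∧ m ≤ C • (μ : Measure (Subshift A)) := by
  have h1' : ∀ N B, MeasurableSet B → cesaro m₁ N B ≤ C * m B := by
    intro N B hB
    rw [cesaro_apply _ _ hB]
    refine (mul_le_mul_right (Finset.sum_le_sum fun k _ => h1 B hB k) _).trans ?_
    rw [inv_succ_mul_sum_const]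
  have h2' : ∀ N B, MeasurableSet B → m B ≤ C * cesaro m₁ N B := by
    intro N B hB
    rw [cesaro_apply _ _ hB, mul_left_comm, Finset.mul_sum]
    refine le_trans ?_ (mul_le_mul_right (Finset.sum_le_sum fun k _ => h2 B hB k) _)
    rw [inv_succ_mul_sum_const]
  have hprob : ∀ N, IsProbabilityMeasure (cesaro m₁ N) := fun N => ⟨by
    rw [cesaro_apply _ _ MeasurableSet.univ]
    simp only [Set.preimage_univ, measure_univ]
    exact inv_succ_mul_sum_const N 1⟩
  set u : ℕ → ProbabilityMeasure (Subshift A) := fun N => ⟨cesaro m₁ N, hprob N⟩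
  have htight : IsTightMeasureSet (Set.range fun n => (u n : Measure (Subshift A))) := by
    have h3 := isTightMeasureSet_singleton (μ := m)
    rw [isTightMeasureSet_iff_exists_isCompact_measure_compl_le] at h3 ⊢
    intro ε hε
    obtain ⟨K, hK, hKm⟩ := h3 (ε / (C + 1)) (ENNReal.div_pos hε.ne' (by finiteness))
    refine ⟨K, hK, ?_⟩
    rintro _ ⟨N, rfl⟩
    refine (h1' N _ hK.isClosed.measurableSet.compl).trans ?_
    calc C * m Kᶜ ≤ (C + 1) * (ε / (C + 1)) := by
          gcongr
          · exact le_self_add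
          · exact hKm m rfl
      _ ≤ ε := ENNReal.mul_div_le
  obtain ⟨μ, hμ⟩ := exists_tendsto_of_isTight htight
  have hcyl : ∀ n ω, Tendsto (fun N => cesaro m₁ N (cyl n ω)) (hyperfilter ℕ)
      (𝓝 ((μ : Measure (Subshift A)) (cyl n ω))) := fun n ω =>
    ProbabilityMeasure.tendsto_measure_of_null_frontier_of_tendsto' hμ (by
      rw [(isClopen_cyl n ω).frontier_eq, measure_empty])
  refine ⟨μ, ⟨measurable_shift, ?_⟩, ?_, ?_⟩
  · have : IsProbabilityMeasure ((μ : Measure (Subshift A)).map shift) :=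
      Measure.isProbabilityMeasure_map measurable_shift.aemeasurable
    refine ext_of_forall_lintegral_eq_of_IsFiniteMeasure fun g => ?_
    have hgm : Measurable fun τ => (g τ : ℝ≥0∞) :=
      measurable_coe_nnreal_ennreal.comp g.continuous.measurable
    rw [lintegral_map hgm measurable_shift]
    have hlim := ProbabilityMeasure.tendsto_iff_forall_lintegral_tendsto.1 hμ
    have h3 := hlim g
    have h4 := hlim (g.compContinuous ⟨shift, continuous_shift⟩)
    obtain ⟨b, hb⟩ : ∃ b : NNReal, ∀ ω, (g ω : ℝ≥0∞) ≤ b :=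
      ⟨nndist g 0, fun ω => by
        rw [ENNReal.coe_le_coe, ← NNReal.coe_le_coe]
        simpa [NNReal.dist_eq] using g.dist_coe_le_dist (g := 0) ω⟩
    -- The telescoping errors are at most `b / (N + 1)`, whichever map is composed with `g`.
    have h5 : ∀ F : ℕ → Subshift A → Subshift A, Tendsto (fun N : ℕ => ((N : ℝ≥0∞) + 1)⁻¹ *
        ∫⁻ ω, g (F N ω) ∂m₁) (hyperfilter ℕ) (𝓝 0) := by
      intro F
      have h6 : Tendsto (fun N : ℕ => ((N : ℝ≥0∞) + 1)⁻¹ * b) atTop (𝓝 (0 * b)) := by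
        refine ENNReal.Tendsto.mul_const ?_ (Or.inr ENNReal.coe_ne_top)
        have := (tendsto_add_atTop_iff_nat 1).2 ENNReal.tendsto_inv_nat_nhds_zero
        simpa using this
      rw [zero_mul] at h6
      refine tendsto_of_tendsto_of_tendsto_of_le_of_le tendsto_const_nhds
        (h6.mono_left Nat.hyperfilter_le_atTop) (fun _ => zero_le) fun N => ?_
      refine mul_le_mul_right ((lintegral_mono fun ω => hb (F N ω)).trans ?_) _
      rw [lintegral_const, measure_univ, mul_one]
    have h6 := h4.add (h5 fun _ => id)
    have h7 := h3.add (h5 fun N => shift^[N + 1])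
    rw [add_zero] at h6 h7
    refine tendsto_nhds_unique h6 (h7.congr fun N => ?_)
    exact (lintegral_cesaro_shift m₁ N hgm).symm
  · have : IsFiniteMeasure (C • m) := m.smul_finite hC
    refine le_of_cyl_le le_rfl fun n _ ω => ?_
    exact le_of_tendsto (hcyl n ω) (Eventually.of_forall fun N => h1' N _ (measurableSet_cyl n ω))
  · have : IsFiniteMeasure (C • (μ : Measure (Subshift A))) :=
      (μ : Measure (Subshift A)).smul_finite hC
    refine le_of_cyl_le le_rfl fun n _ ω => ?_
    exact ge_of_tendsto (ENNReal.Tendsto.const_mul (hcyl n ω) (Or.inr hC))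
      (Eventually.of_forall fun N => h2' N _ (measurableSet_cyl n ω))

/-- Krylov–Bogoliubov starts from `cesaro m q` instead of `m`: averaging over `q + 1` shifts turns
the lower bound by a sum into one valid for each single `k`. -/
lemma IsConformal.exists_invariant (hf : IsHolder f) (hd : Connecting A 1) {c : ℝ≥0∞}
    (hc0 : c ≠ 0) (hc : c ≠ ⊤) {m : Measure (Subshift A)} [IsProbabilityMeasure m]
    (hm : IsConformal f 1 c m) : ∃ (C : ℝ≥0∞) (μ : ProbabilityMeasure (Subshift A)), C ≠ ⊤ ∧
      MeasurePreserving shift (μ : Measure (Subshift A)) μ ∧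
      (μ : Measure (Subshift A)) ≤ C • m ∧ m ≤ C • (μ : Measure (Subshift A)) := by
  obtain ⟨q, C, hC, h⟩ := hm.exists_preimage_bounds hf hd hc0 hc
  have hprob : IsProbabilityMeasure (cesaro m q) := ⟨by
    rw [cesaro_apply _ _ MeasurableSet.univ]
    simp only [Set.preimage_univ, measure_univ]
    exact inv_succ_mul_sum_const q 1⟩
  have hpre : ∀ (B : Set (Subshift A)) (j k : ℕ), shift^[j] ⁻¹' (shift^[k] ⁻¹' B) =
      shift^[k + j] ⁻¹' B := by
    intro B j k
    rw [← Set.preimage_comp, ← Function.iterate_add]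
  have hq : (1 : ℝ≥0∞) ≤ (q : ℝ≥0∞) + 1 := le_add_self
  have hC' : C * ((q : ℝ≥0∞) + 1) ≠ ⊤ := ENNReal.mul_ne_top hC (by finiteness)
  refine ⟨C * ((q : ℝ≥0∞) + 1), ?_⟩
  have h1 : ∀ B, MeasurableSet B → ∀ k : ℕ,
      cesaro m q (shift^[k] ⁻¹' B) ≤ C * ((q : ℝ≥0∞) + 1) * m B := by
    intro B hB k
    rw [cesaro_apply _ _ (hB.preimage (measurable_shift.iterate k))]
    calc _ ≤ ((q : ℝ≥0∞) + 1)⁻¹ * ∑ j ∈ Finset.range (q + 1), C * m B := by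
          refine mul_le_mul_right (Finset.sum_le_sum fun j _ => ?_) _
          rw [hpre]
          exact (h B hB _).1
      _ = C * m B := inv_succ_mul_sum_const q _
      _ ≤ C * ((q : ℝ≥0∞) + 1) * m B := by
          gcongr
          exact le_mul_of_one_le_right zero_le hq
  have h2 : ∀ B, MeasurableSet B → ∀ k : ℕ,
      m B ≤ C * ((q : ℝ≥0∞) + 1) * cesaro m q (shift^[k] ⁻¹' B) := by
    intro B hB k
    rw [cesaro_apply _ _ (hB.preimage (measurable_shift.iterate k)), mul_assoc C,
      ← mul_assoc ((q : ℝ≥0∞) + 1), ENNReal.mul_inv_cancel (by positivity) (by finiteness), one_mul]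
    simp_rw [hpre]
    exact (h B hB k).2
  obtain ⟨μ, hμ⟩ := MarkovShift.exists_invariant hC' h1 h2
  exact ⟨μ, hC', hμ⟩

/-- The two dominations place the density between `1/C` and `C` almost everywhere. -/
lemma abs_log_rnDeriv_le {m μ : Measure (Subshift A)} [IsFiniteMeasure m] [IsFiniteMeasure μ]
    {C : ℝ≥0∞} (hC : C ≠ ⊤) (h1 : μ ≤ C • m) (h2 : m ≤ C • μ) :
    ∃ K : ℝ, ∀ᵐ ω ∂m, |Real.log (μ.rnDeriv m ω).toReal| ≤ K := by
  have hac : μ ≪ m := Measure.absolutelyContinuous_of_le_smul h1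
  have hmeas := Measure.measurable_rnDeriv μ m
  have hup : μ.rnDeriv m ≤ᵐ[m] fun _ => C := by
    refine ae_le_of_forall_setLIntegral_le_of_sigmaFinite hmeas fun s hs _ => ?_
    rw [Measure.setLIntegral_rnDeriv hac, lintegral_const, Measure.restrict_apply MeasurableSet.univ,
      Set.univ_inter]
    exact h1 s
  have hlow : (fun _ => 1) ≤ᵐ[m] fun ω => C * μ.rnDeriv m ω := by
    refine ae_le_of_forall_setLIntegral_le_of_sigmaFinite measurable_const fun s hs _ => ?_
    rw [lintegral_const_mul _ hmeas, Measure.setLIntegral_rnDeriv hac, lintegral_const,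
      Measure.restrict_apply MeasurableSet.univ, Set.univ_inter, one_mul]
    exact h2 s
  refine ⟨|Real.log C.toReal|, ?_⟩
  filter_upwards [hup, hlow] with ω hω1 hω2
  have hx : (μ.rnDeriv m ω).toReal ≤ C.toReal := ENNReal.toReal_mono hC hω1
  have hy := ENNReal.toReal_mono (ENNReal.mul_ne_top hC (ne_top_of_le_ne_top hC hω1)) hω2
  rw [ENNReal.toReal_mul, ENNReal.toReal_one] at hy
  have hC0 : 0 ≤ C.toReal := ENNReal.toReal_nonneg
  have hx0 : 0 < (μ.rnDeriv m ω).toReal := by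
    by_contra! h
    nlinarith
  have hC1 : 0 < C.toReal := hx0.trans_le hx
  have h3 := Real.log_le_log hx0 hx
  have h4 := Real.log_le_log one_pos hy
  rw [Real.log_one, Real.log_mul hC1.ne' hx0.ne'] at h4
  have h5 : 0 ≤ Real.log C.toReal := by linarith
  rw [abs_of_nonneg h5, abs_le]
  exact ⟨by linarith, h3⟩

lemma PreErgodic.of_absolutelyContinuous {Ω : Type*} [MeasurableSpace Ω] {T : Ω → Ω}
    {m μ : Measure Ω} (h : PreErgodic T m) (hac : μ ≪ m) : PreErgodic T μ :=
  ⟨fun _ hs hinv => (h.aeconst_set hs hinv).anti hac.ae_le⟩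

/-- Finite primitivity provides connecting words of length divisible by any given `d ≥ 1`. -/
lemma FinitelyPrimitive.connecting [Nonempty E] (hA : FinitelyPrimitive A) {d : ℕ} (hd : 1 ≤ d) :
    Connecting A d := by
  classical
  obtain ⟨q, Φ, hΦ, h⟩ := hA
  let e : E := Classical.arbitrary E
  have hne : Nonempty (Subshift A) := nonempty_subshift (d := 1)
    ⟨Φ, fun i j => (h i j).imp fun w hw => ⟨hw.1, one_dvd _, hw.2⟩⟩
  obtain ⟨τ⟩ := hne
  -- A block `x` of length `r` taken from `τ` is placed between two connecting words of length `q`;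
  -- the total length `2 * q + r` is a multiple of `d`, and `r ≥ 1` leaves letters of `x` to connect
  -- to.
  set r := d * (2 * q + 1) - 2 * q with hr
  have hr1 : 1 ≤ r := by
    have : 1 * (2 * q + 1) ≤ d * (2 * q + 1) := Nat.mul_le_mul_right _ hd
    omega
  obtain ⟨s, hs⟩ : ∃ s, r = s + 1 := ⟨r - 1, by omega⟩
  set x := List.ofFn (block (s + 1) τ) with hx
  have hxlen : x.length = r := by rw [hx, List.length_ofFn, hs]
  refine ⟨(Φ ×ˢ Φ).image fun p => p.1 ++ (x ++ p.2), fun i j => ?_⟩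
  obtain ⟨w, hw, hiw⟩ := h i (τ.1 0)
  obtain ⟨v, hv, hvj⟩ := h (τ.1 s) j
  refine ⟨w ++ (x ++ v), Finset.mem_image.2 ⟨(w, v), Finset.mem_product.2 ⟨hw, hv⟩, rfl⟩, ?_, ?_⟩
  · rw [List.length_append, List.length_append, hxlen, (hΦ w hw).2, (hΦ v hv).2]
    refine ⟨2 * q + 1, ?_⟩
    omega
  · have hx1 : x = τ.1 0 :: List.ofFn (fun i : Fin s => τ.1 (i + 1)) := by
      rw [hx, List.ofFn_succ]; rfl
    have hx2 : x = List.ofFn (block s τ) ++ [τ.1 s] := by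
      rw [hx, List.ofFn_succ_last]; rfl
    have hxadm : Admissible A x := admissible_ofFn (s + 1) τ
    have h1 : Admissible A (x ++ (v ++ [j])) := by
      rw [hx2, List.append_assoc, List.singleton_append]
      exact List.isChain_split.2 ⟨by rw [← hx2]; exact hxadm, hvj⟩
    rw [hx1, List.cons_append] at h1
    have h2 : i :: ((w ++ (x ++ v)) ++ [j]) = (i :: w) ++ τ.1 0 ::
        (List.ofFn (fun i : Fin s => τ.1 (i + 1)) ++ (v ++ [j])) := by
      rw [hx1]; simp
    rw [h2]
    exact List.isChain_split.2 ⟨hiw, h1⟩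

end Invariant

end MarkovShift

namespace MarkovShift

/-! ### Shannon entropy of countable partitions. -/

section ShannonEntropy

variable {Ω : Type*} [MeasurableSpace Ω] {ι κ κ' : Type*}

/-- Shannon entropy of the partition into the fibres of a map with countably many values. -/
def shannon (μ : Measure Ω) (ξ : Ω → ι) : ℝ≥0∞ :=
  ∑' i, ENNReal.ofReal (Real.negMulLog (μ.real (ξ ⁻¹' {i})))

/-- All fibres of `ξ` are measurable. -/
def FibreMeasurable (ξ : Ω → ι) : Prop := ∀ i, MeasurableSet (ξ ⁻¹' {i})

lemma partitionEntropy_eq_shannon [Fintype ι] (μ : Measure Ω) (ξ : Ω → ι) :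
    partitionEntropy μ ξ = shannon μ ξ := (tsum_fintype _).symm

lemma FibreMeasurable.preimage [Countable ι] {ξ : Ω → ι} (h : FibreMeasurable ξ) (S : Set ι) :
    MeasurableSet (ξ ⁻¹' S) := by
  rw [← Set.biUnion_preimage_singleton]
  exact MeasurableSet.biUnion S.to_countable fun i _ => h i

lemma FibreMeasurable.comp [Countable ι] {ξ : Ω → ι} (h : FibreMeasurable ξ) (φ : ι → κ) :
    FibreMeasurable (φ ∘ ξ) := fun j => h.preimage (φ ⁻¹' {j})

lemma FibreMeasurable.comp_measurable {ξ : Ω → ι} (h : FibreMeasurable ξ) {T : Ω → Ω}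
    (hT : Measurable T) : FibreMeasurable (ξ ∘ T) := fun i => (h i).preimage hT

lemma FibreMeasurable.prodMk {ξ : Ω → ι} {η : Ω → κ} (hξ : FibreMeasurable ξ)
    (hη : FibreMeasurable η) : FibreMeasurable fun ω => (ξ ω, η ω) := by
  rintro ⟨i, j⟩
  convert (hξ i).inter (hη j) using 1
  ext ω; simp

lemma FibreMeasurable.itinerary {ξ : Ω → ι} (h : FibreMeasurable ξ) {T : Ω → Ω}
    (hT : Measurable T) (n : ℕ) : FibreMeasurable (itinerary T ξ n) := by
  intro w
  have : MarkovShift.itinerary T ξ n ⁻¹' {w} = ⋂ k : Fin n, T^[k] ⁻¹' (ξ ⁻¹' {w k}) := by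
    ext ω; simp [MarkovShift.itinerary, funext_iff]
  rw [this]
  exact MeasurableSet.iInter fun k => (h _).preimage (hT.iterate k)

lemma FibreMeasurable.measure_preimage [Countable ι] {ξ : Ω → ι} (h : FibreMeasurable ξ)
    (μ : Measure Ω) (S : Set ι) : μ (ξ ⁻¹' S) = ∑' i, S.indicator (fun i => μ (ξ ⁻¹' {i})) i := by
  rw [← tsum_subtype, ← measure_biUnion (f := fun b => ξ ⁻¹' {b}) S.to_countable]
  · congr 1
    ext ω; simp
  · intro a _ b _ hab
    exact Disjoint.preimage _ (by simpa using hab)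
  · exact fun b _ => h b

lemma FibreMeasurable.tsum_measure [Countable ι] {ξ : Ω → ι} (h : FibreMeasurable ξ)
    (μ : Measure Ω) [IsProbabilityMeasure μ] : ∑' i, μ (ξ ⁻¹' {i}) = 1 := by
  have := h.measure_preimage μ Set.univ
  simpa using this.symm

variable {μ : Measure Ω} [IsProbabilityMeasure μ]

lemma ofReal_negMulLog (s : Set Ω) : ENNReal.ofReal (Real.negMulLog (μ.real s)) =
    μ s * ENNReal.ofReal (-Real.log (μ.real s)) := by
  rw [Real.negMulLog, neg_mul, ← mul_neg, ENNReal.ofReal_mul measureReal_nonneg,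
    ofReal_measureReal (measure_ne_top μ s)]

/-- Gibbs' inequality. -/
lemma shannon_le_cross [Countable ι] {ξ : Ω → ι} (h : FibreMeasurable ξ) {q : ι → ℝ}
    (hq0 : ∀ i, 0 ≤ q i) (hpq : ∀ i, μ (ξ ⁻¹' {i}) ≠ 0 → q i ≠ 0)
    (hq : ∑' i, ENNReal.ofReal (q i) ≤ 1) :
    shannon μ ξ ≤ ∑' i, μ (ξ ⁻¹' {i}) * ENNReal.ofReal (-Real.log (q i)) := by
  have hq1 : ∀ i, q i ≤ 1 := fun i => by
    have := (ENNReal.le_tsum i).trans hq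
    rwa [ENNReal.ofReal_le_one] at this
  -- The masses `p i` and `q i` are added to opposite sides so that the inequality holds termwise
  -- without subtraction; after summation they cancel, as `∑ q ≤ 1 = ∑ p`.
  have h1 : ∀ i, ENNReal.ofReal (Real.negMulLog (μ.real (ξ ⁻¹' {i}))) + μ (ξ ⁻¹' {i}) ≤
      μ (ξ ⁻¹' {i}) * ENNReal.ofReal (-Real.log (q i)) + ENNReal.ofReal (q i) := by
    intro i
    by_cases h0 : μ (ξ ⁻¹' {i}) = 0
    · simp [measureReal_def, h0]
    have hp : 0 < μ.real (ξ ⁻¹' {i}) := ENNReal.toReal_pos h0 (measure_ne_top _ _)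
    have hq' : 0 < q i := lt_of_le_of_ne (hq0 i) (Ne.symm (hpq i h0))
    rw [← ofReal_measureReal (measure_ne_top μ (ξ ⁻¹' {i}))]
    set p := μ.real (ξ ⁻¹' {i})
    have hp1 : p ≤ 1 := measureReal_le_one
    rw [← ENNReal.ofReal_mul hp.le, ← ENNReal.ofReal_add (Real.negMulLog_nonneg hp.le hp1) hp.le,
      ← ENNReal.ofReal_add (mul_nonneg hp.le (neg_nonneg.2 (Real.log_nonpos hq'.le (hq1 i))))
        hq'.le]
    refine ENNReal.ofReal_le_ofReal ?_
    have h2 := Real.log_le_sub_one_of_pos (div_pos hq' hp)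
    rw [Real.log_div hq'.ne' hp.ne'] at h2
    have h3 : p * (Real.log (q i) - Real.log p) ≤ q i - p := by
      refine (mul_le_mul_of_nonneg_left h2 hp.le).trans (le_of_eq ?_)
      field_simp
    rw [Real.negMulLog]
    linarith
  have h2 := ENNReal.tsum_le_tsum h1
  rw [ENNReal.tsum_add, ENNReal.tsum_add, h.tsum_measure μ] at h2
  exact (ENNReal.add_le_add_iff_right ENNReal.one_ne_top).1 (h2.trans (by gcongr))

/-- Each fibre of `ξ` lies in a fibre of `φ ∘ ξ`, so merging fibres only lowers the information
`-log μ`. -/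
lemma shannon_comp_le [Countable ι] {ξ : Ω → ι} (h : FibreMeasurable ξ) (φ : ι → κ) :
    shannon μ (φ ∘ ξ) ≤ shannon μ ξ := by
  classical
  have h1 : ∀ j, ENNReal.ofReal (Real.negMulLog (μ.real ((φ ∘ ξ) ⁻¹' {j}))) ≤
      ∑' i, if φ i = j then ENNReal.ofReal (Real.negMulLog (μ.real (ξ ⁻¹' {i}))) else 0 := by
    intro j
    rw [ofReal_negMulLog, Set.preimage_comp, h.measure_preimage μ, ← ENNReal.tsum_mul_right]
    refine ENNReal.tsum_le_tsum fun i => ?_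
    by_cases hi : φ i = j
    · have hi' : i ∈ φ ⁻¹' {j} := hi
      rw [if_pos hi, Set.indicator_of_mem hi', ofReal_negMulLog]
      by_cases h0 : μ (ξ ⁻¹' {i}) = 0
      · rw [h0, zero_mul, zero_mul]
      · gcongr
        · exact ENNReal.toReal_pos h0 (measure_ne_top _ _)
        · exact measure_ne_top _ _
        · exact Set.singleton_subset_iff.2 hi'
    · have hi' : i ∉ φ ⁻¹' {j} := hi
      rw [if_neg hi, Set.indicator_of_notMem hi', zero_mul]
  refine (ENNReal.tsum_le_tsum h1).trans (le_of_eq ?_)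
  rw [ENNReal.tsum_comm]
  refine tsum_congr fun i => ?_
  rw [tsum_eq_single (φ i) (fun j hj => if_neg (Ne.symm hj)), if_pos rfl]

/-- Gibbs' inequality against the product of the two marginals. -/
lemma shannon_prodMk_le [Countable ι] [Countable κ] {ξ : Ω → ι} {η : Ω → κ}
    (hξ : FibreMeasurable ξ) (hη : FibreMeasurable η) :
    shannon μ (fun ω => (ξ ω, η ω)) ≤ shannon μ ξ + shannon μ η := by
  have hsub1 : ∀ i j, (fun ω => (ξ ω, η ω)) ⁻¹' {(i, j)} ⊆ ξ ⁻¹' {i} := by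
    intro i j ω hω
    simp only [Set.mem_preimage, Set.mem_singleton_iff, Prod.mk.injEq] at hω
    exact hω.1
  have hsub2 : ∀ i j, (fun ω => (ξ ω, η ω)) ⁻¹' {(i, j)} ⊆ η ⁻¹' {j} := by
    intro i j ω hω
    simp only [Set.mem_preimage, Set.mem_singleton_iff, Prod.mk.injEq] at hω
    exact hω.2
  have hpos : ∀ i j, μ ((fun ω => (ξ ω, η ω)) ⁻¹' {(i, j)}) ≠ 0 →
      μ.real (ξ ⁻¹' {i}) ≠ 0 ∧ μ.real (η ⁻¹' {j}) ≠ 0 := by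
    intro i j h0
    rw [measureReal_ne_zero_iff, measureReal_ne_zero_iff]
    exact ⟨fun h => h0 (measure_mono_null (hsub1 i j) h),
      fun h => h0 (measure_mono_null (hsub2 i j) h)⟩
  refine (shannon_le_cross (hξ.prodMk hη)
    (q := fun p => μ.real (ξ ⁻¹' {p.1}) * μ.real (η ⁻¹' {p.2}))
    (fun p => mul_nonneg measureReal_nonneg measureReal_nonneg)
    (fun p h0 => mul_ne_zero (hpos _ _ h0).1 (hpos _ _ h0).2) ?_).trans ?_
  · rw [ENNReal.tsum_prod']
    simp_rw [ENNReal.ofReal_mul measureReal_nonneg, ofReal_measureReal (measure_ne_top μ _),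
      ENNReal.tsum_mul_left, hη.tsum_measure μ, mul_one]
    exact (hξ.tsum_measure μ).le
  · have h1 : ∀ i j, μ ((fun ω => (ξ ω, η ω)) ⁻¹' {(i, j)}) *
        ENNReal.ofReal (-Real.log (μ.real (ξ ⁻¹' {i}) * μ.real (η ⁻¹' {j}))) =
        μ ((fun ω => (ξ ω, η ω)) ⁻¹' {(i, j)}) * ENNReal.ofReal (-Real.log (μ.real (ξ ⁻¹' {i}))) +
        μ ((fun ω => (ξ ω, η ω)) ⁻¹' {(i, j)}) *
          ENNReal.ofReal (-Real.log (μ.real (η ⁻¹' {j}))) := by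
      intro i j
      by_cases h0 : μ ((fun ω => (ξ ω, η ω)) ⁻¹' {(i, j)}) = 0
      · simp [h0]
      · rw [Real.log_mul (hpos _ _ h0).1 (hpos _ _ h0).2, neg_add, ENNReal.ofReal_add, mul_add]
        · exact neg_nonneg.2 (Real.log_nonpos measureReal_nonneg measureReal_le_one)
        · exact neg_nonneg.2 (Real.log_nonpos measureReal_nonneg measureReal_le_one)
    have h2 : ∀ i, ∑' j, μ ((fun ω => (ξ ω, η ω)) ⁻¹' {(i, j)}) = μ (ξ ⁻¹' {i}) := by
      intro i
      rw [← measure_iUnion]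
      · congr 1
        ext ω; simp
      · intro j j' hj
        exact Disjoint.preimage _ (by simpa using hj)
      · exact fun j => (hξ.prodMk hη) (i, j)
    have h3 : ∀ j, ∑' i, μ ((fun ω => (ξ ω, η ω)) ⁻¹' {(i, j)}) = μ (η ⁻¹' {j}) := by
      intro j
      rw [← measure_iUnion]
      · congr 1
        ext ω; simp
      · intro i i' hi
        exact Disjoint.preimage _ (by simpa using hi)
      · exact fun i => (hξ.prodMk hη) (i, j)
    rw [ENNReal.tsum_prod']
    simp_rw [h1, ENNReal.tsum_add]
    refine le_of_eq (congrArg₂ _ ?_ ?_)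
    · simp_rw [ENNReal.tsum_mul_right, h2, ← ofReal_negMulLog]
      rfl
    · rw [ENNReal.tsum_comm]
      simp_rw [ENNReal.tsum_mul_right, h3, ← ofReal_negMulLog]
      rfl

lemma shannon_comp_of_measurePreserving {ξ : Ω → ι} (h : FibreMeasurable ξ) {T : Ω → Ω}
    (hT : MeasurePreserving T μ μ) : shannon μ (ξ ∘ T) = shannon μ ξ := by
  unfold shannon
  refine tsum_congr fun i => ?_
  rw [Set.preimage_comp, measureReal_def, hT.measure_preimage (h i).nullMeasurableSet,
    measureReal_def]

variable {T : Ω → Ω} [Countable ι] [Countable κ] [Countable κ']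

lemma shannon_itinerary_add_le (hT : MeasurePreserving T μ μ) {ξ : Ω → ι} (h : FibreMeasurable ξ)
    (m n : ℕ) : shannon μ (itinerary T ξ (m + n)) ≤
      shannon μ (itinerary T ξ m) + shannon μ (itinerary T ξ n) := by
  have h1 : itinerary T ξ (m + n) = (fun p : (Fin m → ι) × (Fin n → ι) => Fin.append p.1 p.2) ∘
      fun ω => (itinerary T ξ m ω, (itinerary T ξ n ∘ T^[m]) ω) := by
    funext ω k
    refine Fin.addCases (fun i => ?_) (fun i => ?_) k
    · simp [itinerary]
    · simp [itinerary, ← Function.iterate_add_apply, add_comm]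
  have hm := h.itinerary hT.measurable m
  have hn := (h.itinerary hT.measurable n).comp_measurable (hT.measurable.iterate m)
  rw [h1]
  refine (shannon_comp_le (hm.prodMk hn) _).trans ((shannon_prodMk_le hm hn).trans (le_of_eq ?_))
  rw [shannon_comp_of_measurePreserving (h.itinerary hT.measurable n) (hT.iterate m)]

lemma shannon_itinerary_zero (ξ : Ω → ι) : shannon μ (itinerary T ξ 0) = 0 := by
  refine ENNReal.tsum_eq_zero.2 fun w => ?_
  have : itinerary T ξ 0 ⁻¹' {w} = Set.univ :=
    Set.eq_univ_of_forall fun ω => Subsingleton.elim _ _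
  simp [this]

lemma shannon_itinerary_mul_le (hT : MeasurePreserving T μ μ) {ξ : Ω → ι}
    (h : FibreMeasurable ξ) (k n : ℕ) :
    shannon μ (itinerary T ξ (k * n)) ≤ k * shannon μ (itinerary T ξ n) := by
  induction k with
  | zero => rw [Nat.zero_mul, shannon_itinerary_zero]; exact zero_le
  | succ k ih =>
    rw [Nat.succ_mul]
    refine (shannon_itinerary_add_le hT h _ _).trans ?_
    push_cast
    rw [add_mul, one_mul]
    gcongr

lemma shannon_itinerary_le (hT : MeasurePreserving T μ μ) {ξ : Ω → ι}
    (h : FibreMeasurable ξ) (n : ℕ) : shannon μ (itinerary T ξ n) ≤ n * shannon μ ξ := by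
  have h1 := shannon_itinerary_mul_le hT h n 1
  rw [mul_one] at h1
  refine h1.trans (mul_le_mul_right ?_ _)
  exact shannon_comp_le (φ := fun i (_ : Fin 1) => i) h |>.trans' (le_of_eq (by
    congr 1
    funext ω k
    simp [itinerary]))

lemma shannon_itinerary_mono (hT : Measurable T) {ξ : Ω → ι} (h : FibreMeasurable ξ) {m n : ℕ}
    (hmn : m ≤ n) : shannon μ (itinerary T ξ m) ≤ shannon μ (itinerary T ξ n) :=
  shannon_comp_le (φ := fun w k => w (Fin.castLE hmn k)) (h.itinerary hT n)

/-- A perturbation `η` of small entropy costs at most that entropy per unit of time. This is how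
partitions are replaced by approximations. -/
lemma shannon_itinerary_join_le (hT : MeasurePreserving T μ μ) {ξ : Ω → ι} {η : Ω → κ}
    (hξ : FibreMeasurable ξ) (hη : FibreMeasurable η) (φ : ι → κ → κ') (n : ℕ) :
    shannon μ (itinerary T (fun ω => φ (ξ ω) (η ω)) n) ≤
      shannon μ (itinerary T ξ n) + n * shannon μ η := by
  have h1 := hξ.itinerary hT.measurable n
  have h2 := hη.itinerary hT.measurable n
  refine (shannon_comp_le (φ := fun p : (Fin n → ι) × (Fin n → κ) => fun k => φ (p.1 k) (p.2 k))
    (h1.prodMk h2)).trans ((shannon_prodMk_le h1 h2).trans ?_)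
  gcongr
  exact shannon_itinerary_le hT hη n

end ShannonEntropy

end MarkovShift

namespace MarkovShift

/-! ### Partitions of small entropy. -/

section SmallEntropy

lemma exists_negMulLog_le {ε : ℝ} (hε : 0 < ε) : ∃ δ : ℝ, 0 < δ ∧
    (∀ x, 0 ≤ x → x ≤ δ → Real.negMulLog x ≤ ε) ∧
      ∀ x, 1 - δ ≤ x → x ≤ 1 → Real.negMulLog x ≤ ε := by
  have h0 := Metric.tendsto_nhds_nhds.1 (Real.continuous_negMulLog.tendsto 0) ε hε
  have h1 := Metric.tendsto_nhds_nhds.1 (Real.continuous_negMulLog.tendsto 1) ε hε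
  obtain ⟨δ₀, hδ₀, h0⟩ := h0
  obtain ⟨δ₁, hδ₁, h1⟩ := h1
  have hmin : 0 < min δ₀ δ₁ := lt_min hδ₀ hδ₁
  refine ⟨min δ₀ δ₁ / 2, by positivity, fun x hx hx' => ?_, fun x hx hx' => ?_⟩
  · have h2 := min_le_left δ₀ δ₁
    have := h0 (x := x) (by rw [Real.dist_eq, sub_zero, abs_of_nonneg hx]; linarith)
    rw [Real.dist_eq, Real.negMulLog_zero, sub_zero] at this
    exact (le_abs_self _).trans this.le
  · have h2 := min_le_right δ₀ δ₁
    have := h1 (x := x) (by rw [Real.dist_eq, abs_sub_lt_iff]; constructor <;> linarith)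
    rw [Real.dist_eq, Real.negMulLog_one, sub_zero] at this
    exact (le_abs_self _).trans this.le

variable {Ω : Type*} [MeasurableSpace Ω]

lemma shannon_option {ι : Type*} (μ : Measure Ω) (ζ : Ω → Option ι) :
    shannon μ ζ = ENNReal.ofReal (Real.negMulLog (μ.real (ζ ⁻¹' {none}))) +
      ∑' i, ENNReal.ofReal (Real.negMulLog (μ.real (ζ ⁻¹' {some i}))) := by
  rw [shannon, ← (Equiv.optionEquivSumPUnit.{0} ι).symm.tsum_eq, Summable.tsum_sum ENNReal.summable
    ENNReal.summable, add_comm]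
  congr 1
  simp

/-- A partition into few sets, one of which is almost everything, has small entropy. -/
lemma exists_shannon_option_le (r : ℕ) {ε : ℝ≥0∞} (hε : 0 < ε) : ∃ δ : ℝ≥0∞, 0 < δ ∧
    ∀ (μ : Measure Ω) [IsProbabilityMeasure μ] (ζ : Ω → Option (Fin r)), FibreMeasurable ζ →
      μ (ζ ⁻¹' {none}ᶜ) ≤ δ → shannon μ ζ ≤ ε := by
  -- The bound is shared equally among the `r + 1` fibres.
  obtain ⟨ε', hε', hlt⟩ := ENNReal.lt_iff_exists_nnreal_btwn.1
    (ENNReal.div_pos hε.ne' (by finiteness : (r : ℝ≥0∞) + 1 ≠ ⊤))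
  obtain ⟨δ, hδ, h0, h1⟩ := exists_negMulLog_le (ε := ε') (by exact_mod_cast hε')
  refine ⟨ENNReal.ofReal δ, ENNReal.ofReal_pos.2 hδ, fun μ _ ζ hζ hμ => ?_⟩
  have h2 : μ.real (ζ ⁻¹' {none}ᶜ) ≤ δ := ENNReal.toReal_le_of_le_ofReal hδ.le hμ
  have h3 : μ.real (ζ ⁻¹' {none}) = 1 - μ.real (ζ ⁻¹' {none}ᶜ) := by
    rw [Set.preimage_compl, probReal_compl_eq_one_sub (hζ none)]
    ring
  rw [shannon_option, tsum_fintype]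
  have h4 : ENNReal.ofReal (Real.negMulLog (μ.real (ζ ⁻¹' {none}))) ≤ ε' := by
    rw [← ENNReal.ofReal_coe_nnreal]
    exact ENNReal.ofReal_le_ofReal (h1 _ (by linarith) measureReal_le_one)
  have h5 : ∀ i, ENNReal.ofReal (Real.negMulLog (μ.real (ζ ⁻¹' {some i}))) ≤ ε' := by
    intro i
    rw [← ENNReal.ofReal_coe_nnreal]
    refine ENNReal.ofReal_le_ofReal (h0 _ measureReal_nonneg (le_trans ?_ h2))
    exact measureReal_mono (Set.preimage_mono (by simp))
  calc _ ≤ (ε' : ℝ≥0∞) + ∑ _i : Fin r, (ε' : ℝ≥0∞) :=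
        add_le_add h4 (Finset.sum_le_sum fun i _ => h5 i)
    _ = ((r : ℝ≥0∞) + 1) * ε' := by simp [add_mul, add_comm]
    _ ≤ ((r : ℝ≥0∞) + 1) * (ε / ((r : ℝ≥0∞) + 1)) := by gcongr
    _ ≤ ε := ENNReal.mul_div_le

end SmallEntropy

/-! ### The first-letter partition generates the Kolmogorov–Sinai entropy. -/

section Generator

variable {E : Type*} {A : E → E → Fin 2} [TopologicalSpace E] [DiscreteTopology E]
  [Countable E] [MeasurableSpace E] [BorelSpace E]

lemma block_eq_itinerary (n : ℕ) :
    (block n : Subshift A → _) = itinerary shift (fun ω => ω.1 0) n := by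
  funext ω k
  simp [block, itinerary, iterate_shift_apply]

lemma fibreMeasurable_block (n : ℕ) : FibreMeasurable (block n : Subshift A → _) :=
  fun w => measurableSet_preimage_block n {w}

lemma fibreMeasurable_coord : FibreMeasurable (fun ω : Subshift A => ω.1 0) :=
  fun e => measurable_coord 0 (measurableSet_singleton e)

lemma exists_preimage_block_eq {k l : ℕ} (hkl : k ≤ l) (S : Set (Fin k → E)) :
    ∃ S' : Set (Fin l → E), (block k ⁻¹' S : Set (Subshift A)) = block l ⁻¹' S' :=
  ⟨(fun w i => w (Fin.castLE hkl i)) ⁻¹' S, rfl⟩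

/-- Every measurable set is approximated by finite-level sets. -/
lemma exists_block_symmDiff_lt (ν : Measure (Subshift A)) [IsFiniteMeasure ν]
    {B : Set (Subshift A)} (hB : MeasurableSet B) {δ : ℝ≥0∞} (hδ : 0 < δ) :
    ∃ (k : ℕ) (S : Set (Fin k → E)), ν (symmDiff (block k ⁻¹' S) B) < δ := by
  set C : Set (Set (Subshift A)) := {t | ∃ (k : ℕ) (S : Set (Fin k → E)), t = block k ⁻¹' S}
    with hC
  have hring : IsSetRing C := by
    refine ⟨⟨0, ∅, rfl⟩, ?_, ?_⟩
    · rintro _ _ ⟨k, S, rfl⟩ ⟨l, S', rfl⟩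
      obtain ⟨S₁, h1⟩ := exists_preimage_block_eq (A := A) (le_max_left k l) S
      obtain ⟨S₂, h2⟩ := exists_preimage_block_eq (A := A) (le_max_right k l) S'
      exact ⟨max k l, S₁ ∪ S₂, by rw [h1, h2]; rfl⟩
    · rintro _ _ ⟨k, S, rfl⟩ ⟨l, S', rfl⟩
      obtain ⟨S₁, h1⟩ := exists_preimage_block_eq (A := A) (le_max_left k l) S
      obtain ⟨S₂, h2⟩ := exists_preimage_block_eq (A := A) (le_max_right k l) S'
      exact ⟨max k l, S₁ \ S₂, by rw [h1, h2]; rfl⟩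
  have hgen : (inferInstance : MeasurableSpace (Subshift A)) = MeasurableSpace.generateFrom C := by
    refine le_antisymm ?_ (MeasurableSpace.generateFrom_le ?_)
    · rw [BorelSpace.measurable_eq (α := Subshift A)]
      refine MeasurableSpace.generateFrom_le fun U hU => ?_
      have : U = ⋃ k : ℕ, block k ⁻¹' {b | (block k ⁻¹' {b} : Set (Subshift A)) ⊆ U} := by
        refine Set.Subset.antisymm (fun ω hω => ?_) (Set.iUnion_subset fun k ω hω => hω rfl)
        obtain ⟨n, hn⟩ := exists_cyl_subset hU hω
        refine Set.mem_iUnion.2 ⟨n, ?_⟩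
        rw [cyl_eq_preimage] at hn
        exact hn
      rw [this]
      exact MeasurableSet.iUnion fun k => MeasurableSpace.measurableSet_generateFrom ⟨k, _, rfl⟩
    · rintro _ ⟨k, S, rfl⟩
      exact measurableSet_preimage_block k S
  obtain ⟨t, ⟨k, S, rfl⟩, ht⟩ := exists_measure_symmDiff_lt_of_generateFrom_isSetRing (μ := ν)
    hring ⟨{Set.univ}, Set.countable_singleton _,
      Set.singleton_subset_iff.2 ⟨0, Set.univ, rfl⟩, by simp⟩ hgen hB hδ
  exact ⟨k, S, ht⟩

lemma exists_block_approx [Nonempty (Subshift A)] (ν : Measure (Subshift A)) [IsFiniteMeasure ν] {r : ℕ}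
    {ξ : Subshift A → Fin r} (hξ : Measurable ξ) {δ : ℝ≥0∞} (hδ : 0 < δ) :
    ∃ (k : ℕ) (β : (Fin k → E) → Fin r), ν {ω | ξ ω ≠ β (block k ω)} ≤ δ := by
  classical
  cases r with
  | zero => exact (ξ (Classical.arbitrary _)).elim0
  | succ r =>
  have h : ∀ i : Fin (r + 1), ∃ (k : ℕ) (S : Set (Fin k → E)),
      ν (symmDiff (block k ⁻¹' S) (ξ ⁻¹' {i})) < δ / (r + 1 : ℕ) := fun i =>
    exists_block_symmDiff_lt ν (hξ (measurableSet_singleton i))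
      (ENNReal.div_pos hδ.ne' (by finiteness))
  choose k S hS using h
  set l := Finset.univ.sup k with hl
  have h1 : ∀ i, ∃ S' : Set (Fin l → E), (block (k i) ⁻¹' S i : Set (Subshift A)) = block l ⁻¹' S' :=
    fun i => exists_preimage_block_eq (Finset.le_sup (Finset.mem_univ i)) _
  choose S' hS' using h1
  -- Outside the symmetric differences exactly one index `i` has `b ∈ S' i`, namely the value of
  -- `ξ`; elsewhere the choice is immaterial.
  refine ⟨l, fun b => if h : ∃ i, b ∈ S' i then h.choose else 0, ?_⟩
  have hsub : {ω | ξ ω ≠ (fun b => if h : ∃ i, b ∈ S' i then h.choose else 0) (block l ω)} ⊆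
      ⋃ i, symmDiff (block (k i) ⁻¹' S i) (ξ ⁻¹' {i}) := by
    intro ω hω
    by_contra hn
    rw [Set.mem_iUnion, not_exists] at hn
    have h2 : ∀ i, block l ω ∈ S' i ↔ ξ ω = i := by
      intro i
      have := hn i
      rw [hS' i, Set.mem_symmDiff] at this
      simp only [Set.mem_preimage, Set.mem_singleton_iff] at this
      tauto
    have h3 : ∃ i, block l ω ∈ S' i := ⟨ξ ω, (h2 _).2 rfl⟩
    refine hω ?_
    simp only [dif_pos h3]
    exact (h2 _).1 h3.choose_spec
  calc _ ≤ ∑ i, ν (symmDiff (block (k i) ⁻¹' S i) (ξ ⁻¹' {i})) :=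
        (measure_mono hsub).trans (measure_iUnion_fintype_le _ _)
    _ ≤ ∑ _i : Fin (r + 1), δ / (r + 1 : ℕ) := Finset.sum_le_sum fun i _ => (hS i).le
    _ = (r + 1 : ℕ) * (δ / (r + 1 : ℕ)) := by
        rw [Finset.sum_const, Finset.card_univ, Fintype.card_fin, nsmul_eq_mul]
    _ ≤ δ := ENNReal.mul_div_le

variable {ν : Measure (Subshift A)} [IsProbabilityMeasure ν]

lemma shannon_block_ne_top (hν : MeasurePreserving shift ν ν)
    (hfin : shannon ν (fun ω : Subshift A => ω.1 0) ≠ ⊤) (n : ℕ) :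
    shannon ν (block n : Subshift A → _) ≠ ⊤ := by
  rw [block_eq_itinerary]
  exact ne_top_of_le_ne_top (ENNReal.mul_ne_top (by finiteness) hfin)
    (shannon_itinerary_le hν fibreMeasurable_coord n)

lemma shannon_itinerary_comp_block_le {r : ℕ} (k : ℕ) (β : (Fin k → E) → Fin r) (N : ℕ) :
    shannon ν (itinerary shift (β ∘ block k : Subshift A → _) N) ≤
      shannon ν (block (N + k) : Subshift A → _) := by
  refine le_of_eq_of_le ?_ (shannon_comp_le (μ := ν) (fibreMeasurable_block (A := A) (N + k))
    (fun w (i : Fin N) => β fun j => w ⟨i + j, by omega⟩))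
  congr 1
  funext ω i
  simp only [itinerary, Function.comp]
  congr 1
  funext j
  rw [block, iterate_shift_apply, add_comm]
  rfl

/-- The first `N + k` coordinates are covered by `N / n + 1` blocks of length `n` and one of length
`k`; beyond the linear term only a constant independent of `N` remains. -/
lemma shannon_block_add_le (hν : MeasurePreserving shift ν ν) {n : ℕ} (hn : n ≠ 0) (k N : ℕ) :
    shannon ν (block (N + k) : Subshift A → _) ≤ N * (shannon ν (block n : Subshift A → _) / n) +
      (shannon ν (block n : Subshift A → _) + shannon ν (block k : Subshift A → _)) := by
  have h3 : N + k ≤ (N / n + 1) * n + k := by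
    have := Nat.lt_div_mul_add (a := N) (Nat.pos_of_ne_zero hn)
    rw [Nat.add_mul, one_mul]
    omega
  have hm := shannon_itinerary_mono (μ := ν) hν.measurable fibreMeasurable_coord h3
  have ha := shannon_itinerary_add_le hν fibreMeasurable_coord ((N / n + 1) * n) k
  have hb := shannon_itinerary_mul_le hν fibreMeasurable_coord (N / n + 1) n
  simp only [← block_eq_itinerary] at hm ha hb
  generalize shannon ν (block n : Subshift A → _) = H at *
  have h4 : ((N / n : ℕ) : ℝ≥0∞) * H ≤ N * (H / n) := by
    rw [← mul_div_assoc, ENNReal.le_div_iff_mul_le (Or.inl (by exact_mod_cast hn))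
      (Or.inl (by finiteness)), mul_right_comm]
    refine mul_le_mul_left ?_ _
    exact_mod_cast Nat.div_mul_le_self N n
  refine hm.trans (ha.trans ?_)
  rw [← add_assoc]
  refine add_le_add (hb.trans ?_) le_rfl
  push_cast
  rw [add_mul, one_mul]
  exact add_le_add h4 le_rfl

lemma limsup_div_le {u : ℕ → ℝ≥0∞} {a b : ℝ≥0∞} (hb : b ≠ ⊤) (h : ∀ N : ℕ, u N ≤ N * a + b) :
    limsup (fun N : ℕ => u N / (N : ℝ≥0∞)) atTop ≤ a := by
  have h0 : Tendsto (fun N : ℕ => b / N) atTop (𝓝 0) := by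
    have := ENNReal.Tendsto.const_div ENNReal.tendsto_nat_nhds_top (Or.inr hb)
    simpa using this
  have hlim : Tendsto (fun N : ℕ => a + b / N) atTop (𝓝 (a + 0)) := tendsto_const_nhds.add h0
  rw [add_zero] at hlim
  rw [← hlim.limsup_eq]
  refine limsup_le_limsup ?_
  filter_upwards [eventually_ge_atTop 1] with N hN
  have hN0 : (N : ℝ≥0∞) ≠ 0 := by positivity
  refine (ENNReal.div_le_div_right (h N) _).trans (le_of_eq ?_)
  rw [ENNReal.add_div, mul_comm, mul_div_assoc, ENNReal.div_self hN0 (by finiteness), mul_one]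

lemma le_limsup_div_add {u : ℕ → ℝ≥0∞} {L a b : ℝ≥0∞} (hb : b ≠ ⊤)
    (h : ∀ n : ℕ, n * L ≤ u n + n * a + b) :
    L ≤ limsup (fun n : ℕ => u n / (n : ℝ≥0∞)) atTop + a := by
  have hlim : Tendsto (fun N : ℕ => b / N) atTop (𝓝 0) := by
    have := ENNReal.Tendsto.const_div ENNReal.tendsto_nat_nhds_top (Or.inr hb)
    simpa using this
  refine ENNReal.le_of_forall_pos_le_add fun δ hδ _ => ?_
  have h1 : ∀ᶠ n : ℕ in atTop, L - (a + δ) ≤ u n / (n : ℝ≥0∞) := by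
    filter_upwards [hlim.eventually_lt_const (by exact_mod_cast hδ : (0 : ℝ≥0∞) < δ),
      eventually_ge_atTop 1] with n hn hn1
    have hn0 : (n : ℝ≥0∞) ≠ 0 := by positivity
    rw [tsub_le_iff_right]
    have h2 : L ≤ (u n + n * a + b) / n := by
      rw [ENNReal.le_div_iff_mul_le (Or.inl hn0) (Or.inl (by finiteness)), mul_comm]
      exact h n
    refine h2.trans ?_
    rw [ENNReal.add_div, ENNReal.add_div, mul_comm (n : ℝ≥0∞), mul_div_assoc,
      ENNReal.div_self hn0 (by finiteness), mul_one, add_assoc]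
    exact add_le_add le_rfl (add_le_add le_rfl hn.le)
  have h2 : L - (a + δ) ≤ limsup (fun n : ℕ => u n / (n : ℝ≥0∞)) atTop :=
    le_limsup_of_frequently_le h1.frequently
  rw [tsub_le_iff_right] at h2
  rwa [add_assoc]

/-- Every finite partition is, up to small entropy, coarser than a partition into cylinders. -/
lemma exists_block_factor {r : ℕ} {ξ : Subshift A → Fin r} (hξ : Measurable ξ) {ε : ℝ≥0∞}
    (hε : 0 < ε) : ∃ (k : ℕ) (β : (Fin k → E) → Fin r) (ζ : Subshift A → Option (Fin r))
      (j : Fin r → Option (Fin r) → Fin r), FibreMeasurable ζ ∧ shannon ν ζ ≤ ε ∧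
        ξ = fun ω => j ((β ∘ block k) ω) (ζ ω) := by
  classical
  have hne : Nonempty (Subshift A) := by
    by_contra h
    rw [not_nonempty_iff] at h
    exact IsProbabilityMeasure.ne_zero ν (Measure.eq_zero_of_isEmpty ν)
  obtain ⟨δ, hδ, hsmall⟩ := exists_shannon_option_le (Ω := Subshift A) r hε
  obtain ⟨k, β, hβ⟩ := exists_block_approx ν hξ hδ
  have hηm : FibreMeasurable (β ∘ block k : Subshift A → _) := (fibreMeasurable_block k).comp β
  have hξm : FibreMeasurable ξ := fun i => hξ (measurableSet_singleton i)
  -- `ζ` records the correction: `none` where the approximation is right, the true value elsewhere.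
  refine ⟨k, β, fun ω => if ξ ω = (β ∘ block k) ω then none else some (ξ ω),
    fun a o => o.getD a, ?_, ?_, ?_⟩
  · exact (hξm.prodMk hηm).comp
      (fun p : Fin r × Fin r => if p.1 = p.2 then none else some p.1)
  · refine hsmall ν _ ((hξm.prodMk hηm).comp
      (fun p : Fin r × Fin r => if p.1 = p.2 then none else some p.1))
      (le_trans (measure_mono fun ω hω => ?_) hβ)
    intro h
    exact hω (if_pos h)
  · funext ω
    beta_reduce
    by_cases h : ξ ω = (β ∘ block k) ω
    · rw [if_pos h]; exact h
    · rw [if_neg h]; rfl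

/-- The entropy of a finite partition is bounded by the entropy of the generating one. -/
lemma entropyOfPartition_le (hν : MeasurePreserving shift ν ν)
    (hfin : shannon ν (fun ω : Subshift A => ω.1 0) ≠ ⊤) {n : ℕ} (hn : n ≠ 0) {r : ℕ}
    {ξ : Subshift A → Fin r} (hξ : Measurable ξ) :
    entropyOfPartition shift ν ξ ≤ shannon ν (block n : Subshift A → _) / n := by
  refine ENNReal.le_of_forall_pos_le_add fun ε hε _ => ?_
  obtain ⟨k, β, ζ, j, hζm, hζ, hj⟩ := exists_block_factor (ν := ν) hξ (ε := ε)
    (by exact_mod_cast hε)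
  refine limsup_div_le (b := shannon ν (block n : Subshift A → _) +
    shannon ν (block k : Subshift A → _)) (ENNReal.add_ne_top.2
      ⟨shannon_block_ne_top hν hfin n, shannon_block_ne_top hν hfin k⟩) fun N => ?_
  have h1 := shannon_itinerary_join_le hν ((fibreMeasurable_block (A := A) k).comp β) hζm j N
  rw [← hj] at h1
  rw [partitionEntropy_eq_shannon]
  refine h1.trans ((add_le_add ((shannon_itinerary_comp_block_le k β N).trans
    (shannon_block_add_le hν hn k N)) (mul_le_mul_right hζ _)).trans (le_of_eq ?_))
  ring

lemma nat_mul_ksEntropy_le (hν : MeasurePreserving shift ν ν)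
    (hfin : shannon ν (fun ω : Subshift A => ω.1 0) ≠ ⊤) (n : ℕ) :
    n * ksEntropy shift ν ≤ shannon ν (block n : Subshift A → _) := by
  rcases eq_or_ne n 0 with rfl | hn
  · simp
  · refine ENNReal.mul_le_of_le_div' (iSup_le fun r => iSup_le fun ξ => iSup_le fun hξ => ?_)
    exact entropyOfPartition_le hν hfin hn hξ

/-- Merging a large finite set of letters leaves one atom of mass close to `1` and a tail of the
convergent entropy series, both of small entropy. -/
lemma exists_finset_shannon_le
    (hfin : shannon ν (fun ω : Subshift A => ω.1 0) ≠ ⊤) {ε : ℝ≥0∞} (hε : 0 < ε) :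
    ∃ F : Finset E, ∀ φ : E → Option E, (∀ e ∈ F, φ e = none) → (∀ e ∉ F, φ e = some e) →
      shannon ν (φ ∘ fun ω : Subshift A => ω.1 0) ≤ ε := by
  set α : Subshift A → E := fun ω => ω.1 0 with hα
  have hαm : FibreMeasurable α := fibreMeasurable_coord
  have h1 := ENNReal.tendsto_tsum_compl_atTop_zero hfin
  have h2 : Tendsto (fun F : Finset E => ENNReal.ofReal
      (Real.negMulLog (∑ e ∈ F, ν (α ⁻¹' {e})).toReal)) atTop (𝓝 (ENNReal.ofReal 0)) := by
    refine (ENNReal.continuous_ofReal.tendsto 0).comp ?_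
    have h3 : Tendsto (fun F : Finset E => (∑ e ∈ F, ν (α ⁻¹' {e})).toReal) atTop (𝓝 1) := by
      have h4 : HasSum (fun e => ν (α ⁻¹' {e})) 1 := by
        rw [← hαm.tsum_measure ν]
        exact ENNReal.summable.hasSum
      exact (ENNReal.tendsto_toReal ENNReal.one_ne_top).comp h4
    have h5 := (Real.continuous_negMulLog.tendsto 1).comp h3
    rwa [Real.negMulLog_one] at h5
  have h3 := h2.add h1
  rw [ENNReal.ofReal_zero, add_zero] at h3
  obtain ⟨F, hF⟩ := (h3.eventually_lt_const hε).exists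
  refine ⟨F, fun φ hφ1 hφ2 => ?_⟩
  have hnone : (φ ∘ α) ⁻¹' {none} = α ⁻¹' (F : Set E) := by
    ext ω
    by_cases h : α ω ∈ F
    · simp [h, hφ1 _ h]
    · simp [h, hφ2 _ h]
  have hsome : ∀ e, ENNReal.ofReal (Real.negMulLog (ν.real ((φ ∘ α) ⁻¹' {some e}))) ≤
      {e | e ∉ F}.indicator (fun e => ENNReal.ofReal (Real.negMulLog (ν.real (α ⁻¹' {e})))) e := by
    intro e
    by_cases h : e ∈ F
    · have : (φ ∘ α) ⁻¹' {some e} = ∅ := by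
        ext ω
        by_cases h' : α ω ∈ F
        · simp [hφ1 _ h']
        · have : α ω ≠ e := fun h'' => h' (h'' ▸ h)
          simp [hφ2 _ h', this]
      rw [this]; simp
    · have : (φ ∘ α) ⁻¹' {some e} = α ⁻¹' {e} := by
        ext ω
        by_cases h' : α ω ∈ F
        · have : α ω ≠ e := fun h'' => h (h'' ▸ h')
          simp [hφ1 _ h', this]
        · simp [hφ2 _ h']
      have h' : e ∈ {e | e ∉ F} := h
      rw [this, Set.indicator_of_mem h']
  have hmeasure : ν.real (α ⁻¹' (F : Set E)) = (∑ e ∈ F, ν (α ⁻¹' {e})).toReal := by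
    rw [measureReal_def, hαm.measure_preimage, ← tsum_subtype]
    exact congrArg ENNReal.toReal (Finset.tsum_subtype F fun e => ν (α ⁻¹' {e}))
  rw [shannon_option, hnone, hmeasure]
  refine le_trans ?_ hF.le
  gcongr
  refine (ENNReal.tsum_le_tsum hsome).trans ?_
  rw [← tsum_subtype]
  exact le_rfl

/-- The countable partition splits into a finite one, `κ`, that resolves the letters of `F`, and a
remainder `φ` of small entropy; only finite partitions enter the Kolmogorov–Sinai entropy. -/
lemma exists_finite_factor (hfin : shannon ν (fun ω : Subshift A => ω.1 0) ≠ ⊤) {ε : ℝ≥0∞}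
    (hε : 0 < ε) : ∃ (r : ℕ) (κ : E → Fin r) (φ : E → Option E) (j : Fin r → Option E → E),
      shannon ν (φ ∘ fun ω : Subshift A => ω.1 0) ≤ ε ∧
        (fun ω : Subshift A => ω.1 0) = fun ω => j (κ (ω.1 0)) (φ (ω.1 0)) := by
  classical
  obtain ⟨F, hF⟩ := exists_finset_shannon_le hfin hε
  have hne : Nonempty (Subshift A) := by
    by_contra h
    rw [not_nonempty_iff] at h
    exact IsProbabilityMeasure.ne_zero ν (Measure.eq_zero_of_isEmpty ν)
  obtain ⟨ω₀⟩ := hne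
  refine ⟨Fintype.card (Option F),
    fun e => Fintype.equivFin (Option F) (if h : e ∈ F then some ⟨e, h⟩ else none),
    fun e => if e ∈ F then none else some e,
    -- The default letter `ω₀.1 0` never matters: if `φ` gives `none`, the letter is in `F` and `κ`
    -- determines it.
    fun i o => o.getD (((Fintype.equivFin (Option F)).symm i).elim (ω₀.1 0) Subtype.val),
    hF _ (fun e he => if_pos he) (fun e he => if_neg he), ?_⟩
  funext ω
  beta_reduce
  by_cases h : ω.1 0 ∈ F
  · rw [dif_pos h, if_pos h, Equiv.symm_apply_apply]; rfl
  · rw [dif_neg h, if_neg h]; rfl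

/-- The generating partition does not have more entropy than the finite partitions together. -/
lemma le_ksEntropy (hν : MeasurePreserving shift ν ν)
    (hfin : shannon ν (fun ω : Subshift A => ω.1 0) ≠ ⊤) {L c : ℝ≥0∞} (hc : c ≠ ⊤)
    (h : ∀ n : ℕ, n * L ≤ shannon ν (block n : Subshift A → _) + c) :
    L ≤ ksEntropy shift ν := by
  refine ENNReal.le_of_forall_pos_le_add fun ε hε _ => ?_
  obtain ⟨r, κ, φ, j, hφ, hj⟩ := exists_finite_factor hfin (ε := ε) (by exact_mod_cast hε)
  have hξm : FibreMeasurable (κ ∘ fun ω : Subshift A => ω.1 0) := fibreMeasurable_coord.comp κ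
  have hζm : FibreMeasurable (φ ∘ fun ω : Subshift A => ω.1 0) := fibreMeasurable_coord.comp φ
  have hent : L ≤ entropyOfPartition shift ν (κ ∘ fun ω : Subshift A => ω.1 0) + ε := by
    refine le_limsup_div_add hc fun n => (h n).trans (add_le_add ?_ le_rfl)
    rw [partitionEntropy_eq_shannon, block_eq_itinerary]
    have h1 := shannon_itinerary_join_le hν hξm hζm j n
    simp only [Function.comp_apply] at h1
    rw [← hj] at h1
    exact h1.trans (add_le_add le_rfl (mul_le_mul_right hφ _))
  refine hent.trans (add_le_add ?_ le_rfl)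
  exact le_iSup_of_le _ (le_iSup_of_le _ (le_iSup_of_le (measurable_to_countable' hξm) le_rfl))

end Generator

end MarkovShift

namespace MarkovShift

/-! ### Integrals of Birkhoff sums. -/

section Integral

variable {Ω : Type*} [MeasurableSpace Ω] {ι : Type*}

lemma FibreMeasurable.tsum_measure_mul [Countable ι] {ξ : Ω → ι} (h : FibreMeasurable ξ)
    (ν : Measure Ω) (g : ι → ℝ≥0∞) : ∑' i, ν (ξ ⁻¹' {i}) * g i = ∫⁻ ω, g (ξ ω) ∂ν := by
  -- With the discrete σ-algebra every `g` is measurable, and the sum is an integral against the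
  -- image measure.
  let _ : MeasurableSpace ι := ⊤
  have hξ : Measurable ξ := fun S _ => h.preimage S
  rw [← lintegral_map (f := g) measurable_from_top hξ, lintegral_countable']
  refine tsum_congr fun i => ?_
  rw [Measure.map_apply hξ (measurableSet_singleton i), mul_comm]

lemma ofReal_integral_le_lintegral {ν : Measure Ω} {g : Ω → ℝ} (hg : Integrable g ν) :
    ENNReal.ofReal (∫ ω, g ω ∂ν) ≤ ∫⁻ ω, ENNReal.ofReal (g ω) ∂ν := by
  rw [integral_eq_lintegral_pos_part_sub_lintegral_neg_part hg]
  refine (ENNReal.ofReal_le_ofReal (sub_le_self _ ENNReal.toReal_nonneg)).trans ?_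
  exact ENNReal.ofReal_toReal_le

lemma integrable_of_le {ν : Measure Ω} [IsFiniteMeasure ν] {g : Ω → ℝ} (hg : Measurable g)
    {B : ℝ} (hB : ∀ ω, g ω ≤ B) (hneg : ∫⁻ ω, ENNReal.ofReal (-g ω) ∂ν < ⊤) :
    Integrable g ν := by
  refine ⟨hg.aestronglyMeasurable, ?_⟩
  have h1 : ∀ ω, ‖g ω‖ₑ ≤ ENNReal.ofReal B + ENNReal.ofReal (-g ω) := by
    intro ω
    rw [Real.enorm_eq_ofReal_abs]
    rcases le_total 0 (g ω) with h | h
    · rw [abs_of_nonneg h]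
      exact le_add_right (ENNReal.ofReal_le_ofReal (hB ω))
    · rw [abs_of_nonpos h]
      exact le_add_self
  refine (lintegral_mono h1).trans_lt ?_
  rw [lintegral_add_left measurable_const, lintegral_const]
  exact ENNReal.add_lt_top.2 ⟨by finiteness, hneg⟩

lemma integral_birkhoffSum {T : Ω → Ω} {ν : Measure Ω} (hT : MeasurePreserving T ν ν)
    {g : Ω → ℝ} (hg : Integrable g ν) (n : ℕ) : Integrable (birkhoffSum T g n) ν ∧
      ∫ ω, birkhoffSum T g n ω ∂ν = n * ∫ ω, g ω ∂ν := by
  have h1 : ∀ k, Integrable (fun ω => g (T^[k] ω)) ν := fun k =>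
    ((hT.iterate k).integrable_comp hg.aestronglyMeasurable).2 hg
  have h2 : ∀ k, ∫ ω, g (T^[k] ω) ∂ν = ∫ ω, g ω ∂ν := by
    intro k
    have h := (hT.iterate k).map_eq
    rw [← integral_map (hT.iterate k).aemeasurable (by rw [h]; exact hg.aestronglyMeasurable), h]
  unfold birkhoffSum
  refine ⟨integrable_finsetSum _ fun k _ => h1 k, ?_⟩
  rw [integral_finsetSum _ fun k _ => h1 k]
  simp [h2]

lemma integral_const_sub_birkhoffSum {T : Ω → Ω} {ν : Measure Ω} [IsProbabilityMeasure ν]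
    (hT : MeasurePreserving T ν ν) {g : Ω → ℝ} (hg : Integrable g ν) (n : ℕ) (a : ℝ) :
    Integrable (fun ω => a - birkhoffSum T g n ω) ν ∧
      ∫ ω, (a - birkhoffSum T g n ω) ∂ν = a - n * ∫ ω, g ω ∂ν := by
  obtain ⟨h1, h2⟩ := integral_birkhoffSum hT hg n
  refine ⟨(integrable_const a).sub h1, ?_⟩
  rw [integral_sub (integrable_const a) h1, h2, integral_const, probReal_univ, one_smul]

lemma le_of_forall_nat_mul_le {a b c : ℝ≥0∞} (hc : c ≠ ⊤) (h : ∀ n : ℕ, n * a ≤ n * b + c) :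
    a ≤ b := by
  have := le_limsup_div_add (u := fun _ => 0) hc (L := a) (a := b) (by simpa using h)
  simpa using this

end Integral

/-! ### The variational principle and equilibrium states. -/

section Equilibrium

variable {E : Type*} {A : E → E → Fin 2} [TopologicalSpace E] [DiscreteTopology E]
  [Countable E] [MeasurableSpace E] [BorelSpace E] {f : Subshift A → ℝ}
  {μ ν : Measure (Subshift A)} [IsProbabilityMeasure μ] [IsProbabilityMeasure ν] {Q P : ℝ}

lemma GibbsBounds.measureReal_cyl_pos (h : GibbsBounds f μ Q P) (n : ℕ) (ω : Subshift A) :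
    0 < μ.real (cyl n ω) := by
  have hQ := h.1
  exact lt_of_lt_of_le (by positivity) (h.2 n ω).1

lemma GibbsBounds.log_bounds (h : GibbsBounds f μ Q P) (n : ℕ) (ω : Subshift A) :
    n * P - birkhoffSum shift f n ω - Real.log Q ≤ -Real.log (μ.real (cyl n ω)) ∧
      -Real.log (μ.real (cyl n ω)) ≤ n * P - birkhoffSum shift f n ω + Real.log Q := by
  have hQ : 0 < Q := lt_of_lt_of_le one_pos h.1
  have hpos := h.measureReal_cyl_pos n ω
  obtain ⟨h1, h2⟩ := h.2 n ω
  have h3 := Real.log_le_log (by positivity) h1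
  have h4 := Real.log_le_log hpos h2
  rw [Real.log_mul (by positivity) (Real.exp_pos _).ne', Real.log_exp] at h3 h4
  rw [Real.log_inv] at h3
  constructor <;> linarith

/-- Cylinders have mass at most one. In particular `f` is bounded above, so only its negative part
can obstruct integrability. -/
lemma GibbsBounds.birkhoffSum_le (h : GibbsBounds f μ Q P) (n : ℕ) (ω : Subshift A) :
    birkhoffSum shift f n ω ≤ n * P + Real.log Q := by
  have h1 := (h.log_bounds n ω).2
  have h2 := Real.log_nonpos measureReal_nonneg (measureReal_le_one (μ := μ) (s := cyl n ω))
  linarith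

lemma GibbsBounds.integrable (h : GibbsBounds f μ Q P) (hf : Measurable f)
    (hneg : ∫⁻ ω, ENNReal.ofReal (-f ω) ∂ν < ⊤) : Integrable f ν :=
  integrable_of_le hf (B := P + Real.log Q)
    (fun ω => by have := h.birkhoffSum_le 1 ω; rwa [birkhoffSum_one', Nat.cast_one, one_mul] at this)
    hneg

/-- Integrating the bound on `S_n f` and letting `n` grow. It ensures that `ENNReal.ofReal (P - ∫
f)` does not truncate. -/
lemma GibbsBounds.integral_le (h : GibbsBounds f μ Q P) (hν : MeasurePreserving shift ν ν)
    (hf : Integrable f ν) : ∫ ω, f ω ∂ν ≤ P := by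
  by_contra! hlt
  obtain ⟨n, hn⟩ := exists_nat_gt (Real.log Q / (∫ ω, f ω ∂ν - P))
  rw [div_lt_iff₀ (by linarith)] at hn
  obtain ⟨h1, h2⟩ := integral_birkhoffSum hν hf n
  have h3 := integral_mono h1 (integrable_const (n * P + Real.log Q)) (h.birkhoffSum_le n)
  rw [h2, integral_const, probReal_univ, one_smul] at h3
  linarith

lemma extIntegral_eq {ν : ProbabilityMeasure (Subshift A)}
    (hf : Integrable f (ν : Measure (Subshift A))) :
    extIntegral f ν = ((∫ ω, f ω ∂(ν : Measure (Subshift A)) : ℝ) : EReal) := by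
  have h1 : ∫⁻ ω, ENNReal.ofReal (f ω) ∂(ν : Measure (Subshift A)) ≠ ⊤ := hf.lintegral_lt_top.ne
  have h2 : ∫⁻ ω, ENNReal.ofReal (-f ω) ∂(ν : Measure (Subshift A)) ≠ ⊤ :=
    hf.neg.lintegral_lt_top.ne
  rw [integral_eq_lintegral_pos_part_sub_lintegral_neg_part hf, EReal.coe_sub,
    EReal.coe_ennreal_toReal h1, EReal.coe_ennreal_toReal h2]
  rfl

/-- Gibbs' inequality with `q` equal to half of `μ` conditioned on `S` inside `S`, and to half of
`μ` outside. Its mass is at most `1`, and `-log q` is at most `-log μ + log 2`, smaller on `S` by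
exactly `-log μ(S)`; this gain is the second summand on the left. -/
lemma GibbsBounds.shannon_add_le_of_ne_zero (h : GibbsBounds f μ Q P)
    (hν : MeasurePreserving shift ν ν) (hf : Integrable f ν) (n : ℕ) {S : Set (Fin n → E)}
    (hS : μ.real (block n ⁻¹' S : Set (Subshift A)) ≠ 0) :
    shannon ν (block n : Subshift A → _) +
        ν (block n ⁻¹' S) * ENNReal.ofReal (-Real.log (μ.real (block n ⁻¹' S))) ≤
      ENNReal.ofReal (n * (P - ∫ ω, f ω ∂ν) + (Real.log Q + Real.log 2)) := by
  classical
  obtain ⟨b, hb⟩ : ∃ b, b = μ.real (block n ⁻¹' S : Set (Subshift A)) := ⟨_, rfl⟩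
  rw [← hb] at hS ⊢
  have hbpos : 0 < b := lt_of_le_of_ne (hb ▸ measureReal_nonneg) (Ne.symm hS)
  have hb1 : b ≤ 1 := hb ▸ measureReal_le_one
  obtain ⟨q, hq⟩ : ∃ q : (Fin n → E) → ℝ, ∀ w, q w =
    μ.real (block n ⁻¹' {w} : Set (Subshift A)) * (if w ∈ S then (2 * b)⁻¹ else 2⁻¹) :=
    ⟨_, fun _ => rfl⟩
  have hfib := fibreMeasurable_block (A := A) n
  have hpos : ∀ ω : Subshift A, 0 < μ.real (block n ⁻¹' {block n ω} : Set (Subshift A)) := by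
    intro ω
    rw [← cyl_eq_preimage]
    exact h.measureReal_cyl_pos n ω
  have hq0 : ∀ w, 0 ≤ q w := by
    intro w
    rw [hq]
    refine mul_nonneg measureReal_nonneg ?_
    split_ifs <;> positivity
  have hqne : ∀ w, ν (block n ⁻¹' {w} : Set (Subshift A)) ≠ 0 → q w ≠ 0 := by
    intro w hw
    obtain ⟨ω, rfl⟩ := nonempty_of_measure_ne_zero hw
    rw [hq]
    refine mul_ne_zero (hpos ω).ne' ?_
    split_ifs <;> positivity
  have hsum : ∑' w, ENNReal.ofReal (q w) ≤ 1 := by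
    have h1 : ∀ w, ENNReal.ofReal (q w) =
        S.indicator (fun w => μ (block n ⁻¹' {w} : Set (Subshift A))) w *
          ENNReal.ofReal (2 * b)⁻¹ +
        Sᶜ.indicator (fun w => μ (block n ⁻¹' {w} : Set (Subshift A))) w *
          ENNReal.ofReal 2⁻¹ := by
      intro w
      rw [hq, ENNReal.ofReal_mul measureReal_nonneg, ofReal_measureReal (measure_ne_top μ _)]
      by_cases hw : w ∈ S <;> simp [hw]
    rw [tsum_congr h1, ENNReal.tsum_add, ENNReal.tsum_mul_right, ENNReal.tsum_mul_right,
      ← hfib.measure_preimage, ← hfib.measure_preimage]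
    have h2 : μ (block n ⁻¹' S : Set (Subshift A)) * ENNReal.ofReal (2 * b)⁻¹ =
        ENNReal.ofReal 2⁻¹ := by
      rw [← ofReal_measureReal (measure_ne_top μ _), ← hb, ← ENNReal.ofReal_mul hbpos.le]
      congr 1
      field_simp
    rw [h2]
    calc _ ≤ ENNReal.ofReal 2⁻¹ + 1 * ENNReal.ofReal 2⁻¹ := by
          gcongr
          exact prob_le_one
      _ = 1 := by
          rw [one_mul, ← ENNReal.ofReal_add (by norm_num) (by norm_num)]
          norm_num
  have hcross := shannon_le_cross (μ := ν) hfib hq0 hqne hsum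
  rw [hfib.tsum_measure_mul ν fun w => ENNReal.ofReal (-Real.log (q w))] at hcross
  have hind : ν (block n ⁻¹' S : Set (Subshift A)) * ENNReal.ofReal (-Real.log b) =
      ∫⁻ ω, (block n ⁻¹' S : Set (Subshift A)).indicator
        (fun _ => ENNReal.ofReal (-Real.log b)) ω ∂ν := by
    rw [lintegral_indicator (measurableSet_preimage_block n S), lintegral_const, mul_comm,
      Measure.restrict_apply_univ]
  have hpt : ∀ ω : Subshift A, ENNReal.ofReal (-Real.log (q (block n ω))) +
      (block n ⁻¹' S : Set (Subshift A)).indicator (fun _ => ENNReal.ofReal (-Real.log b)) ω ≤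
      ENNReal.ofReal (n * P + (Real.log Q + Real.log 2) - birkhoffSum shift f n ω) := by
    intro ω
    have h1 := (h.log_bounds n ω).2
    have h2 : 0 ≤ -Real.log (μ.real (cyl n ω)) :=
      neg_nonneg.2 (Real.log_nonpos measureReal_nonneg measureReal_le_one)
    have h3 : 0 ≤ -Real.log b := neg_nonneg.2 (Real.log_nonpos hbpos.le hb1)
    have h4 : 0 ≤ -Real.log (q (block n ω)) := by
      refine neg_nonneg.2 (Real.log_nonpos (hq0 _) ?_)
      exact ENNReal.ofReal_le_one.1 ((ENNReal.le_tsum (f := fun w => ENNReal.ofReal (q w)) _).trans hsum)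
    have h5 := hq (block n ω)
    rw [← cyl_eq_preimage] at h5
    have h6 := (h.measureReal_cyl_pos n ω).ne'
    by_cases hω : block n ω ∈ S
    · have hω' : ω ∈ (block n ⁻¹' S : Set (Subshift A)) := hω
      rw [Set.indicator_of_mem hω', ← ENNReal.ofReal_add h4 h3]
      refine ENNReal.ofReal_le_ofReal ?_
      rw [h5, if_pos hω, Real.log_mul h6 (by positivity), Real.log_inv,
        Real.log_mul (by norm_num) hbpos.ne']
      linarith
    · have hω' : ω ∉ (block n ⁻¹' S : Set (Subshift A)) := hω
      rw [Set.indicator_of_notMem hω', add_zero]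
      refine ENNReal.ofReal_le_ofReal ?_
      rw [h5, if_neg hω, Real.log_mul h6 (by positivity), Real.log_inv]
      linarith
  obtain ⟨hi1, hi2⟩ := integral_const_sub_birkhoffSum hν hf n
    (n * P + (Real.log Q + Real.log 2))
  have hval : n * (P - ∫ ω, f ω ∂ν) + (Real.log Q + Real.log 2) =
      n * P + (Real.log Q + Real.log 2) - n * ∫ ω, f ω ∂ν := by ring
  rw [hval, ← hi2, ofReal_integral_eq_lintegral_ofReal hi1 (ae_of_all _ fun ω => by
    have h1 := h.birkhoffSum_le n ω
    have h2 := Real.log_nonneg (show (1 : ℝ) ≤ 2 by norm_num)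
    change 0 ≤ n * P + (Real.log Q + Real.log 2) - birkhoffSum shift f n ω
    linarith)]
  refine (add_le_add hcross hind.le).trans ?_
  rw [← lintegral_add_right _ (measurable_const.indicator (measurableSet_preimage_block n S))]
  exact lintegral_mono hpt

/-- The entropy of the cylinder partition and the mass of a set of cylinders, bounded by the Gibbs
inequality against a measure with the Gibbs property. -/
lemma GibbsBounds.shannon_add_le (h : GibbsBounds f μ Q P) (hν : MeasurePreserving shift ν ν)
    (hf : Integrable f ν) (n : ℕ) (S : Set (Fin n → E)) :
    shannon ν (block n : Subshift A → _) +
        ν (block n ⁻¹' S) * ENNReal.ofReal (-Real.log (μ.real (block n ⁻¹' S))) ≤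
      ENNReal.ofReal (n * (P - ∫ ω, f ω ∂ν) + (Real.log Q + Real.log 2)) := by
  by_cases hb : μ.real (block n ⁻¹' S) = 0
  -- By the convention `Real.log 0 = 0` the extra term is zero here, and it is zero for `S = univ`
  -- as well.
  · have h1 := h.shannon_add_le_of_ne_zero hν hf n (S := Set.univ) (by simp)
    rw [hb, Real.log_zero, neg_zero, ENNReal.ofReal_zero, mul_zero]
    rwa [Set.preimage_univ, probReal_univ, Real.log_one, neg_zero, ENNReal.ofReal_zero,
      mul_zero] at h1
  · exact h.shannon_add_le_of_ne_zero hν hf n hb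

lemma GibbsBounds.shannon_le (h : GibbsBounds f μ Q P) (hν : MeasurePreserving shift ν ν)
    (hf : Integrable f ν) (n : ℕ) : shannon ν (block n : Subshift A → _) ≤
      ENNReal.ofReal (n * (P - ∫ ω, f ω ∂ν) + (Real.log Q + Real.log 2)) :=
  le_self_add.trans (h.shannon_add_le hν hf n ∅)

/-- The entropy of the cylinders is the integral of `-log μ(cyl n ω)`, which the upper Gibbs bound
estimates from below. -/
lemma GibbsBounds.le_shannon_add (h : GibbsBounds f μ Q P) (hμ : MeasurePreserving shift μ μ)
    (hf : Integrable f μ) (n : ℕ) : ENNReal.ofReal (n * (P - ∫ ω, f ω ∂μ)) ≤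
      shannon μ (block n : Subshift A → _) + ENNReal.ofReal (Real.log Q) := by
  have hfib := fibreMeasurable_block (A := A) n
  obtain ⟨hi1, hi2⟩ := integral_const_sub_birkhoffSum hμ hf n (n * P - Real.log Q)
  have h1 : shannon μ (block n : Subshift A → _) =
      ∫⁻ ω, ENNReal.ofReal (-Real.log (μ.real (cyl n ω))) ∂μ := by
    simp_rw [shannon, ofReal_negMulLog]
    rw [hfib.tsum_measure_mul μ fun w => ENNReal.ofReal (-Real.log (μ.real (block n ⁻¹' {w})))]
    simp_rw [cyl_eq_preimage]
  have h2 : ENNReal.ofReal (∫ ω, (n * P - Real.log Q - birkhoffSum shift f n ω) ∂μ) ≤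
      shannon μ (block n : Subshift A → _) := by
    rw [h1]
    refine (ofReal_integral_le_lintegral hi1).trans ?_
    refine lintegral_mono fun ω => ENNReal.ofReal_le_ofReal ?_
    have := (h.log_bounds n ω).1
    linarith
  rw [hi2] at h2
  calc _ ≤ ENNReal.ofReal (n * P - Real.log Q - n * ∫ ω, f ω ∂μ) +
        ENNReal.ofReal (Real.log Q) := by
        refine le_trans (ENNReal.ofReal_le_ofReal ?_) ENNReal.ofReal_add_le
        linarith
    _ ≤ _ := by gcongr

lemma GibbsBounds.shannon_coord_ne_top (h : GibbsBounds f μ Q P)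
    (hν : MeasurePreserving shift ν ν) (hf : Integrable f ν) :
    shannon ν (fun ω : Subshift A => ω.1 0) ≠ ⊤ :=
  ne_top_of_le_ne_top (ne_top_of_le_ne_top ENNReal.ofReal_ne_top (h.shannon_le hν hf 1))
    (shannon_comp_le (μ := ν) (fibreMeasurable_block (A := A) 1) fun w => w 0)

/-- The bound on the entropy of the `n`-cylinders, divided by `n`. -/
lemma GibbsBounds.ksEntropy_le (h : GibbsBounds f μ Q P) (hν : MeasurePreserving shift ν ν)
    (hf : Integrable f ν) : ksEntropy shift ν ≤ ENNReal.ofReal (P - ∫ ω, f ω ∂ν) := by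
  refine le_of_forall_nat_mul_le (c := ENNReal.ofReal (Real.log Q + Real.log 2))
    ENNReal.ofReal_ne_top fun n => ?_
  refine (nat_mul_ksEntropy_le hν (h.shannon_coord_ne_top hν hf) n).trans
    ((h.shannon_le hν hf n).trans (ENNReal.ofReal_add_le.trans (le_of_eq ?_)))
  rw [ENNReal.ofReal_mul (Nat.cast_nonneg n), ENNReal.ofReal_natCast]

lemma GibbsBounds.ksEntropy_eq (h : GibbsBounds f μ Q P) (hμ : MeasurePreserving shift μ μ)
    (hf : Integrable f μ) : ksEntropy shift μ = ENNReal.ofReal (P - ∫ ω, f ω ∂μ) := by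
  refine le_antisymm (h.ksEntropy_le hμ hf) ?_
  refine le_ksEntropy hμ (h.shannon_coord_ne_top hμ hf) (c := ENNReal.ofReal (Real.log Q))
    ENNReal.ofReal_ne_top fun n => le_trans (le_of_eq ?_) (h.le_shannon_add hμ hf n)
  rw [ENNReal.ofReal_mul (Nat.cast_nonneg n), ENNReal.ofReal_natCast]

/-- Integrability of `f` makes both the integral and the entropy finite, so the identity in `EReal`
becomes one of real numbers. -/
lemma GibbsBounds.isEquilibrium_iff {ν : ProbabilityMeasure (Subshift A)}
    (h : GibbsBounds f μ Q P) (hf : Measurable f) :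
    IsEquilibrium f ν ↔ MeasurePreserving shift (ν : Measure (Subshift A)) ν ∧
      Integrable f (ν : Measure (Subshift A)) ∧ ksEntropy shift (ν : Measure (Subshift A)) =
        ENNReal.ofReal (P - ∫ ω, f ω ∂(ν : Measure (Subshift A))) := by
  constructor
  · rintro ⟨hν, hneg, heq⟩
    have hfi := h.integrable hf hneg
    refine ⟨hν, hfi, ?_⟩
    rw [extIntegral_eq hfi, h.pressure_eq] at heq
    have hne := ne_top_of_le_ne_top ENNReal.ofReal_ne_top (h.ksEntropy_le hν hfi)
    rw [← EReal.coe_ennreal_toReal hne, ← EReal.coe_add, EReal.coe_eq_coe_iff] at heq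
    rw [← heq, add_sub_cancel_right, ENNReal.ofReal_toReal hne]
  · rintro ⟨hν, hfi, heq⟩
    refine ⟨hν, hfi.neg.lintegral_lt_top, ?_⟩
    rw [heq, extIntegral_eq hfi, h.pressure_eq, EReal.coe_ennreal_ofReal,
      max_eq_left (sub_nonneg.2 (h.integral_le hν hfi)), ← EReal.coe_add, sub_add_cancel]

/-- Equality in the variational principle uses up the linear term `n (P - ∫ f dν)`; what remains for
the gain on `S` is a constant independent of `n` and `S`. -/
lemma GibbsBounds.mass_bound (h : GibbsBounds f μ Q P) (hν : MeasurePreserving shift ν ν)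
    (hf : Integrable f ν) (heq : ksEntropy shift ν = ENNReal.ofReal (P - ∫ ω, f ω ∂ν)) (n : ℕ)
    (S : Set (Fin n → E)) :
    ν.real (block n ⁻¹' S) * -Real.log (μ.real (block n ⁻¹' S)) ≤ Real.log Q + Real.log 2 := by
  have hc : 0 ≤ Real.log Q + Real.log 2 :=
    add_nonneg (Real.log_nonneg h.1) (Real.log_nonneg (by norm_num))
  have h1 := nat_mul_ksEntropy_le hν (h.shannon_coord_ne_top hν hf) n
  have h2 := (add_le_add h1 le_rfl).trans (h.shannon_add_le hν hf n S)
  rw [heq, ENNReal.ofReal_add (mul_nonneg (Nat.cast_nonneg n)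
    (sub_nonneg.2 (h.integral_le hν hf))) hc, ENNReal.ofReal_mul (Nat.cast_nonneg n),
    ENNReal.ofReal_natCast, ENNReal.add_le_add_iff_left (by finiteness),
    ← ofReal_measureReal (measure_ne_top ν _), ← ENNReal.ofReal_mul measureReal_nonneg] at h2
  exact (ENNReal.ofReal_le_ofReal_iff hc).1 h2

/-- A measure of maximal free energy is absolutely continuous with respect to a Gibbs measure. -/
lemma GibbsBounds.absolutelyContinuous (h : GibbsBounds f μ Q P)
    (hν : MeasurePreserving shift ν ν) (hf : Integrable f ν)
    (heq : ksEntropy shift ν = ENNReal.ofReal (P - ∫ ω, f ω ∂ν)) : ν ≪ μ := by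
  refine Measure.AbsolutelyContinuous.mk fun N hN hμN => ?_
  by_contra hνN
  set β := ν.real N with hβ
  have hβpos : 0 < β := ENNReal.toReal_pos hνN (measure_ne_top _ _)
  set c := Real.log Q + Real.log 2
  -- If `B` has `ν`-mass at least `β / 2` and `μ`-mass below `δ`, the product in `mass_bound` is at
  -- least `c + 1`, exceeding its bound `c`.
  set δ := min (β / 2) (Real.exp (-(2 * (c + 1) / β))) with hδ
  have hδpos : 0 < δ := lt_min (by positivity) (Real.exp_pos _)
  obtain ⟨k, S, hS⟩ := exists_block_symmDiff_lt (μ + ν) hN (ENNReal.ofReal_pos.2 hδpos)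
  rw [Measure.add_apply] at hS
  set B : Set (Subshift A) := block k ⁻¹' S with hB
  have hμB : μ.real B < δ := by
    refine (ENNReal.lt_ofReal_iff_toReal_lt (measure_ne_top _ _)).1 (lt_of_le_of_lt ?_ hS)
    calc μ B ≤ μ (symmDiff B N ∪ N) := measure_mono fun ω hω => by
          by_cases h' : ω ∈ N
          · exact Or.inr h'
          · exact Or.inl (Or.inl ⟨hω, h'⟩)
      _ ≤ μ (symmDiff B N) + μ N := measure_union_le _ _
      _ ≤ _ := by rw [hμN, add_zero]; exact le_self_add
  have hνB : β / 2 ≤ ν.real B := by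
    have h1 : ν.real (symmDiff B N) < δ :=
      (ENNReal.lt_ofReal_iff_toReal_lt (measure_ne_top _ _)).1 (le_add_self.trans_lt hS)
    have h2 : ν.real N ≤ ν.real (symmDiff B N) + ν.real B := by
      refine (measureReal_mono (fun ω hω => ?_)).trans (measureReal_union_le _ _)
      by_cases h' : ω ∈ B
      · exact Or.inr h'
      · exact Or.inl (Or.inr ⟨hω, h'⟩)
    have h3 : δ ≤ β / 2 := min_le_left _ _
    linarith
  -- Positivity is needed since `Real.log 0 = 0`; a nonempty union of cylinders is charged by a
  -- Gibbs measure.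
  have hBpos : 0 < μ.real B := by
    have hne : B.Nonempty := by
      refine nonempty_of_measure_ne_zero (μ := ν) fun h0 => ?_
      rw [measureReal_def, h0, ENNReal.toReal_zero] at hνB
      linarith
    obtain ⟨ω, hω⟩ := hne
    refine (h.measureReal_cyl_pos k ω).trans_le (measureReal_mono fun τ hτ => ?_)
    rw [mem_cyl_iff_block] at hτ
    change block k τ ∈ S
    rw [hτ]
    exact hω
  have hlog : 2 * (c + 1) / β ≤ -Real.log (μ.real B) := by
    have h1 := Real.log_le_log hBpos (hμB.le.trans (min_le_right _ _))
    rw [Real.log_exp] at h1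
    linarith
  have hmass := h.mass_bound hν hf heq k S
  have h1 : β / 2 * (2 * (c + 1) / β) ≤ c := by
    have hc : 0 ≤ c := add_nonneg (Real.log_nonneg h.1) (Real.log_nonneg (by norm_num))
    refine le_trans ?_ hmass
    exact mul_le_mul hνB hlog (by positivity) measureReal_nonneg
  have h2 : β / 2 * (2 * (c + 1) / β) = c + 1 := by
    field_simp
  linarith

end Equilibrium

end MarkovShift

end

/-! ### Assembly of the theorem. -/

theorem corollaryc2p7p5 {E : Type*} [Countable E] [Nonempty E]
    [TopologicalSpace E] [DiscreteTopology E] [MeasurableSpace E] [BorelSpace E]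
    (A : E → E → Fin 2) (hA : MarkovShift.FinitelyIrreducible A)
    (f : MarkovShift.Subshift A → ℝ)
    (hf : MarkovShift.IsHolder f) (hs : MarkovShift.IsSummable f) :
    ∃ P : ℝ, MarkovShift.pressure f = (P : EReal) ∧
      Tendsto (fun n : ℕ => ENNReal.log (MarkovShift.partitionFunction f n) / (n : EReal))
        atTop (𝓝 (P : EReal)) ∧
      ∃ m μ : ProbabilityMeasure (MarkovShift.Subshift A),
        -- (a) the unique eigenmeasure of the conjugate operator and its eigenvalue
        MarkovShift.IsEigenmeasure f hf hs m (Real.exp P) ∧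
        (∀ (m' : ProbabilityMeasure (MarkovShift.Subshift A)) (c : ℝ),
          MarkovShift.IsEigenmeasure f hf hs m' c → m' = m ∧ c = Real.exp P) ∧
        -- (b) it is a Gibbs state
        MarkovShift.IsGibbs f m ∧
        -- (c) the unique invariant Gibbs state
        MarkovShift.IsInvariantGibbs f μ ∧
        (∀ μ' : ProbabilityMeasure (MarkovShift.Subshift A),
          MarkovShift.IsInvariantGibbs f μ' → μ' = μ) ∧
        -- (d) ergodicity, and equivalence with bounded logarithmic density
        Ergodic MarkovShift.shift (μ : Measure (MarkovShift.Subshift A)) ∧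
        (μ : Measure (MarkovShift.Subshift A)) ≪ (m : Measure (MarkovShift.Subshift A)) ∧
        (m : Measure (MarkovShift.Subshift A)) ≪ (μ : Measure (MarkovShift.Subshift A)) ∧
        (∃ K : ℝ, ∀ᵐ ω ∂(m : Measure (MarkovShift.Subshift A)),
          |Real.log ((μ : Measure (MarkovShift.Subshift A)).rnDeriv m ω).toReal| ≤ K) ∧
        -- (e) the unique equilibrium state
        (MarkovShift.NegIntegralFinite f μ →
          MarkovShift.IsEquilibrium f μ ∧
          ∀ ν : ProbabilityMeasure (MarkovShift.Subshift A),
            MarkovShift.IsEquilibrium f ν → ν = μ) ∧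
        -- (f) complete ergodicity
        (MarkovShift.FinitelyPrimitive A →
          MarkovShift.CompletelyErgodic MarkovShift.shift
            (μ : Measure (MarkovShift.Subshift A))) := by
  have hd := hA.connecting
  have hne : Nonempty (MarkovShift.Subshift A) := MarkovShift.nonempty_subshift hd
  obtain ⟨m, c, hc0, hc, hm⟩ := MarkovShift.exists_isConformal hf hs hd
  have hfm : Measurable f := hf.continuous.measurable
  obtain ⟨Q, hQ⟩ := hm.gibbsBounds hf hd hc0 hc
  obtain ⟨C, μ, hC, hμ, hμm, hmμ⟩ := hm.exists_invariant hf hd hc0 hc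
  have hac : (μ : Measure (MarkovShift.Subshift A)) ≪ m :=
    Measure.absolutelyContinuous_of_le_smul hμm
  have hac' : (m : Measure (MarkovShift.Subshift A)) ≪ μ :=
    Measure.absolutelyContinuous_of_le_smul hmμ
  obtain ⟨Q', hQ'⟩ := hQ.mono_of_le hC hμm hmμ
  have hexp : Real.exp (Real.log c.toReal) = c.toReal :=
    Real.exp_log (ENNReal.toReal_pos hc0 hc)
  have hmn : ∀ n : ℕ, MarkovShift.IsConformal f n (c ^ n) m := fun n =>
    MarkovShift.IsConformal.of_dvd hfm (by rwa [pow_one]) (one_dvd n)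
  have herg : ∀ n : ℕ, 1 ≤ n → MarkovShift.Connecting A n →
      Ergodic MarkovShift.shift^[n] (μ : Measure (MarkovShift.Subshift A)) := fun n hn hdn =>
    ⟨hμ.iterate n, MarkovShift.PreErgodic.of_absolutelyContinuous
      (hf.preErgodic_iterate hn hdn hc0 hc (hmn n)) hac⟩
  have herg1 := herg 1 le_rfl hd
  rw [Function.iterate_one] at herg1
  refine ⟨Real.log c.toReal, hQ.pressure_eq, hQ.tendsto_pressure, m, μ, ?_, fun m' c' hm' => ?_,
    MarkovShift.isGibbs_iff.2 ⟨Q, _, hQ⟩, ⟨MarkovShift.isGibbs_iff.2 ⟨Q', _, hQ'⟩, hμ⟩,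
    fun μ' hμ' => ?_, herg1, hac, hac', MarkovShift.abs_log_rnDeriv_le hC hμm hmμ,
    fun hneg => ⟨?_, fun ν hν => ?_⟩, fun hprim n hn => herg n hn (hprim.connecting hn)⟩
  · refine MarkovShift.IsConformal.isEigenmeasure (Real.exp_pos _).le ?_
    rwa [hexp, ENNReal.ofReal_toReal hc]
  · obtain ⟨hc', hconf⟩ := hm'.isConformal
    -- Any eigenmeasure is a Gibbs state with constant the logarithm of its eigenvalue; both
    -- constants are the pressure, so the eigenvalues agree and uniqueness for a fixed eigenvalue
    -- applies.
    have hc0' := hconf.ne_zero hf hd ENNReal.ofReal_ne_top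
    obtain ⟨Q₁, hQ₁⟩ := hconf.gibbsBounds hf hd hc0' ENNReal.ofReal_ne_top
    have hP := hQ.unique hQ₁
    rw [ENNReal.toReal_ofReal hc'] at hP
    have hcc : c' = c.toReal := by
      rw [← hexp, ← hP, Real.exp_log (ENNReal.ofReal_pos.1 (pos_iff_ne_zero.2 hc0'))]
    rw [hcc, ENNReal.ofReal_toReal hc] at hconf
    exact ⟨ProbabilityMeasure.toMeasure_injective (hf.conformal_unique hd hc0 hc hm hconf), hcc.trans hexp.symm⟩
  · obtain ⟨hG, hinv⟩ := hμ'
    obtain ⟨Q₁, P₁, hQ₁⟩ := MarkovShift.isGibbs_iff.1 hG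
    obtain rfl := hQ'.unique hQ₁
    -- Gibbs states with the same constant are comparable, and an invariant probability measure
    -- absolutely continuous with respect to an ergodic one equals it.
    exact ProbabilityMeasure.toMeasure_injective (herg1.eq_of_absolutelyContinuous hinv
      (Measure.absolutelyContinuous_of_le_smul (hQ'.le hQ₁)))
  · have hfi := hQ'.integrable hfm hneg
    exact (hQ'.isEquilibrium_iff hfm).2 ⟨hμ, hfi, hQ'.ksEntropy_eq hμ hfi⟩
  · obtain ⟨hinv, hfi, heq⟩ := (hQ'.isEquilibrium_iff hfm).1 hν
    exact ProbabilityMeasure.toMeasure_injective (herg1.eq_of_absolutelyContinuous hinv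
      (hQ'.absolutelyContinuous hinv hfi heq))
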